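/- Computations are carried out by deterministic random access machines (programs with assignments, conditionals and loops over finitely many arrays of natural numbers with computed addresses) under logarithmic cost: each elementary operation costs $1$ plus the total number of bits of the numbers it handles (operands, result and addresses). In the $k$-coloring problem one is given a graph $G$ and has to decide whether there is a map $c\colon V(G)\to\{1,\dots,k\}$ with $c(u)\neq c(v)$ for every edge $uv$ of $G$. In the $k$-list-coloring problem one is given a graph $G$ and, for every vertex $v$, a set $C_v$ of at most $k$ colors out of some universe $U$, and has to decide whether there is a map $c\colon V(G)\to U$ with $c(v)\in C_v$ for every vertex $v$ and $c(u)\neq c(v)$ for every edge $uv$. Graphs are given by adjacency matrices and lists by vertex-color incidence matrices; the at most $k\cdot|V(G)|$ colors that occur in the lists are named by numbers in $\{0,\dots,k\cdot|V(G)|-1\}$. Running times are worst-case bounds in terms of the number $n=|V(G)|$ of vertices. **Theorem.** For every integer $k\ge 1$ and every real $\varepsilon$ with $0<\varepsilon<2$ there is a real $\varepsilon'$ with $0<\varepsilon'<2$ such that, given any (deterministic) algorithm that solves $(k-1)$-list-coloring in time $O\left((2-\varepsilon)^n\right)$, there is a deterministic algorithm that solves $k$-coloring in time $O\left((2-\varepsilon')^n\right)$.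 -/

import Mathlib

/-! ### A deterministic random access machine with logarithmic cost

Programs are structured programs over a random access memory.  The memory consists of banks
`0, 1, 2, …`; every bank is an infinite array of natural numbers.  A program names its banks by
literals, so it uses finitely many of them, and it computes the addresses inside a bank.
Time is the logarithmic (bit) cost: every elementary operation costs `1` plus the number of bits
of all the numbers it handles (operands, result, addresses). -/

namespace RAM

/-- The memory: `m b a` is the content of the cell with address `a` of bank `b`. -/
abbrev Mem : Type := ℕ → ℕ → ℕ

/-- Elementary operations on natural numbers. -/
inductive Op : Type
  | add | sub | mul | div | mod | land | lor | eq | lt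

/-- The value of an elementary operation.  Subtraction is truncated, division rounds down,
`land` and `lor` are bitwise, and comparisons return `1` (true) or `0` (false). -/
def Op.eval : Op → ℕ → ℕ → ℕ
  | .add, x, y => x + y
  | .sub, x, y => x - y
  | .mul, x, y => x * y
  | .div, x, y => x / y
  | .mod, x, y => x % y
  | .land, x, y => x &&& y
  | .lor, x, y => x ||| y
  | .eq, x, y => if x = y then 1 else 0
  | .lt, x, y => if x < y then 1 else 0

/-- Expressions: constants, memory cells (with a computed address), elementary operations. -/
inductive Expr : Type
  | const (c : ℕ)
  | load (b : ℕ) (addr : Expr)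
  | op (o : Op) (e₁ e₂ : Expr)

/-- The value of an expression in a memory. -/
def Expr.eval (m : Mem) : Expr → ℕ
  | .const c => c
  | .load b e => m b (e.eval m)
  | .op o e₁ e₂ => o.eval (e₁.eval m) (e₂.eval m)

/-- The logarithmic cost of evaluating an expression (`Nat.size x` is the number of binary digits
of `x`). -/
def Expr.cost (m : Mem) : Expr → ℕ
  | .const c => 1 + c.size
  | .load b e => e.cost m + (1 + (e.eval m).size + (m b (e.eval m)).size)
  | .op o e₁ e₂ => e₁.cost m + e₂.cost m +
      (1 + (e₁.eval m).size + (e₂.eval m).size + (o.eval (e₁.eval m) (e₂.eval m)).size)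

/-- Programs. -/
inductive Program : Type
  | skip
  | store (b : ℕ) (addr val : Expr)
  | seq (p q : Program)
  | cond (e : Expr) (p q : Program)
  | loop (e : Expr) (p : Program)

/-- The memory after writing `x` into the cell with address `a` of bank `b`. -/
def Mem.write (m : Mem) (b a x : ℕ) : Mem :=
  fun b' a' => if b' = b ∧ a' = a then x else m b' a'

/-- `Exec p m t m'`: the program `p`, started in memory `m`, halts after time `t` in memory `m'`.
A test succeeds if its value is not `0`; `loop e p` repeats `p` as long as the test `e`
succeeds. -/
inductive Exec : Program → Mem → ℕ → Mem → Prop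
  | skip (m : Mem) : Exec .skip m 1 m
  | store (m : Mem) (b : ℕ) (addr val : Expr) :
      Exec (.store b addr val) m
        (addr.cost m + val.cost m + (1 + (addr.eval m).size + (val.eval m).size))
        (m.write b (addr.eval m) (val.eval m))
  | seq {p q : Program} {m m₁ m₂ : Mem} {t₁ t₂ : ℕ} :
      Exec p m t₁ m₁ → Exec q m₁ t₂ m₂ → Exec (.seq p q) m (t₁ + t₂) m₂
  | condTrue {e : Expr} {p q : Program} {m m' : Mem} {t : ℕ} :
      e.eval m ≠ 0 → Exec p m t m' → Exec (.cond e p q) m (e.cost m + 1 + t) m'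
  | condFalse {e : Expr} {p q : Program} {m m' : Mem} {t : ℕ} :
      e.eval m = 0 → Exec q m t m' → Exec (.cond e p q) m (e.cost m + 1 + t) m'
  | loopTrue {e : Expr} {p : Program} {m m₁ m₂ : Mem} {t₁ t₂ : ℕ} :
      e.eval m ≠ 0 → Exec p m t₁ m₁ → Exec (.loop e p) m₁ t₂ m₂ →
      Exec (.loop e p) m (e.cost m + 1 + t₁ + t₂) m₂
  | loopFalse {e : Expr} {p : Program} {m : Mem} :
      e.eval m = 0 → Exec (.loop e p) m (e.cost m + 1) m

/-- Programs are deterministic: the running time and the final memory are determined by the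
program and the initial memory. -/
theorem Exec.deterministic {p : Program} {m m₁ m₂ : Mem} {t₁ t₂ : ℕ}
    (h₁ : Exec p m t₁ m₁) (h₂ : Exec p m t₂ m₂) : t₁ = t₂ ∧ m₁ = m₂ := by
  induction h₁ generalizing t₂ m₂ with
  | skip m => cases h₂; exact ⟨rfl, rfl⟩
  | store m b addr val => cases h₂; exact ⟨rfl, rfl⟩
  | seq _ _ ih₁ ih₂ =>
    cases h₂ with
    | seq a b =>
      obtain ⟨rfl, rfl⟩ := ih₁ a
      obtain ⟨rfl, rfl⟩ := ih₂ b
      exact ⟨rfl, rfl⟩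
  | condTrue he _ ih =>
    cases h₂ with
    | condTrue _ a =>
      obtain ⟨rfl, rfl⟩ := ih a
      exact ⟨rfl, rfl⟩
    | condFalse h _ => exact absurd h he
  | condFalse he _ ih =>
    cases h₂ with
    | condTrue h _ => exact absurd he h
    | condFalse _ a =>
      obtain ⟨rfl, rfl⟩ := ih a
      exact ⟨rfl, rfl⟩
  | loopTrue he _ _ ih₁ ih₂ =>
    cases h₂ with
    | loopTrue _ a b =>
      obtain ⟨rfl, rfl⟩ := ih₁ a
      obtain ⟨rfl, rfl⟩ := ih₂ b
      exact ⟨rfl, rfl⟩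
    | loopFalse h => exact absurd h he
  | loopFalse he =>
    cases h₂ with
    | loopTrue h _ _ => exact absurd he h
    | loopFalse _ => exact ⟨rfl, rfl⟩

/-- Started in memory `m`, the program `p` halts after at most `t` time, and it answers the
question whether `P` holds: cell `0` of bank `0` is finally nonzero exactly if `P` holds. -/
def Decides (p : Program) (m : Mem) (t : ℕ) (P : Prop) : Prop :=
  ∃ (s : ℕ) (m' : Mem), Exec p m s m' ∧ s ≤ t ∧ (m' 0 0 ≠ 0 ↔ P)

end RAM

/-! ### The coloring problems -/

/-- `G` has a proper coloring in which every vertex `v` gets a color of its list `L v`.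
The universe `U` of colors is arbitrary. -/
def ListColorable {V U : Type*} (G : SimpleGraph V) (L : V → Finset U) : Prop :=
  ∃ c : G.Coloring U, ∀ v, c v ∈ L v

/-- Lists of at most `k` colors for `n` vertices use at most `k * n` colors in total.  Hence every
instance, over any universe of colors, can be renamed to an instance with colors
`0, …, k * n - 1`. -/
theorem exists_renamed_lists {U : Type*} (k n : ℕ) (G : SimpleGraph (Fin n))
    (L : Fin n → Finset U) (hL : ∀ v, (L v).card ≤ k) :
    ∃ L' : Fin n → Finset (Fin (k * n)),
      (∀ v, (L' v).card = (L v).card) ∧ (ListColorable G L' ↔ ListColorable G L) := by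
  classical
  let S : Finset U := Finset.univ.biUnion L
  have hS : S.card ≤ k * n := by
    have h := Finset.card_biUnion_le_card_mul (Finset.univ : Finset (Fin n)) L k
      (fun v _ => hL v)
    simpa [S, mul_comm] using h
  have hLS : ∀ v, ∀ x ∈ L v, x ∈ S := fun v x hx => by
    simp only [S, Finset.mem_biUnion, Finset.mem_univ, true_and]
    exact ⟨v, hx⟩
  let f : {x // x ∈ S} ↪ Fin (k * n) :=
    S.equivFin.toEmbedding.trans (Fin.castLEEmb hS)
  refine ⟨fun v => (L v).attach.map
    ⟨fun x => f ⟨x.1, hLS v x.1 x.2⟩, fun x y h => by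
      have h' := f.injective h
      exact Subtype.ext (congrArg (fun z : {x // x ∈ S} => z.1) h')⟩, fun v => by simp, ?_⟩
  constructor
  · rintro ⟨c, hc⟩
    have h : ∀ v, ∃ x, ∃ hx : x ∈ L v, f ⟨x, hLS v x hx⟩ = c v := fun v => by
      have h := hc v
      simp only [Finset.mem_map, Finset.mem_attach, true_and,
        Subtype.exists] at h
      exact h
    choose d hd hdc using h
    refine ⟨SimpleGraph.Coloring.mk d fun {u v} huv he => c.valid huv ?_, hd⟩
    rw [← hdc u, ← hdc v]
    exact congrArg f (Subtype.ext he)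
  · rintro ⟨c, hc⟩
    refine ⟨SimpleGraph.Coloring.mk (fun v => f ⟨c v, hLS v _ (hc v)⟩) fun {u v} huv he => ?_,
      fun v => ?_⟩
    · exact c.valid huv (congrArg (fun z : {x // x ∈ S} => z.1) (f.injective he))
    · simp only [Finset.mem_map, Finset.mem_attach, true_and,
        Subtype.exists]
      exact ⟨c v, hc v, rfl⟩

open Classical in
/-- The initial memory for a graph `G` with vertices `0, …, n - 1`: cell `0` of bank `0` holds `n`,
and bank `1` holds the adjacency matrix, row by row.  All other cells are `0`. -/
noncomputable def graphInput {n : ℕ} (G : SimpleGraph (Fin n)) : RAM.Mem := fun b a =>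
  if b = 0 ∧ a = 0 then n
  else if b = 1 ∧ ∃ u v : Fin n, G.Adj u v ∧ a = (u : ℕ) * n + (v : ℕ) then 1
  else 0

open Classical in
/-- The initial memory for a graph `G` with lists of colors out of `{0, …, q - 1}`: banks `0` and
`1` hold the graph, and bank `2` holds the incidence matrix of vertices and colors, row by row. -/
noncomputable def listInput {n q : ℕ} (G : SimpleGraph (Fin n)) (L : Fin n → Finset (Fin q)) :
    RAM.Mem := fun b a =>
  if b = 2 then
    if ∃ (v : Fin n) (c : Fin q), c ∈ L v ∧ a = (v : ℕ) * q + (c : ℕ) then 1 else 0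
  else graphInput G b a

/-- The program `p` solves the `k`-coloring problem, in time at most `T n` on all graphs with `n`
vertices. -/
def SolvesColoring (k : ℕ) (p : RAM.Program) (T : ℕ → ℕ) : Prop :=
  ∀ (n : ℕ) (G : SimpleGraph (Fin n)),
    RAM.Decides p (graphInput G) (T n) (G.Colorable k)

/-- The program `p` solves the `k`-list-coloring problem, in time at most `T n` on all instances
with `n` vertices.  The colors are named `0, …, k * n - 1`, which covers every instance over any
universe up to the names of its colors (see `exists_renamed_lists`). -/
def SolvesListColoring (k : ℕ) (p : RAM.Program) (T : ℕ → ℕ) : Prop :=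
  ∀ (n : ℕ) (G : SimpleGraph (Fin n)) (L : Fin n → Finset (Fin (k * n))),
    (∀ v, (L v).card ≤ k) →
      RAM.Decides p (listInput G L) (T n) (ListColorable G L)

/-! Fix a large integer `q` depending only on `k` and `ε`. A graph on `n` vertices is treated in one
of two ways, according to the size of a dominating set that is found greedily.

Scan the vertices and choose each one that has at least `2 * q` neighbours not yet dominated. At
most `n / (2 * q)` vertices get chosen. Let `U` be the set of vertices left without a chosen
neighbour. The chosen vertices together with `U` form a dominating set `S`.

If `q * S.card ≤ n`, guess the colors of `S`. A vertex outside `S` has a neighbour in `S`, so it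
loses a color and keeps at most `k - 1`; a vertex of `S` keeps at most one. Hence `k ^ S.card` calls
of the list coloring algorithm decide the question (`card_guessLists_le`,
`colorable_iff_exists_guess`). Their number is at most `K ^ n`, where `K > 1` can be taken so close
to `1` that `K * (2 - ε) < 2`.

Otherwise `U` has more than `n / (2 * q)` elements, while every vertex has fewer than `2 * q`
neighbours in `U`. Double counting shows that half of `U` has bounded degree, and a maximal
conflict-free choice gives linearly many vertices with pairwise disjoint closed neighbourhoods of
bounded size (`exists_disjoint_neighbourhoods`). A dominating set meets each of these blocks, and
this costs a constant factor below `1` per block (`Finset.card_meets_mul_le`). So there are at most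
`(2 * γ) ^ n` dominating sets with a constant `γ < 1`.

Few dominating sets make inclusion-exclusion cheap. A color class can be enlarged to a maximal
independent set, which dominates, so `k`-colorability means being covered by `k` independent
dominating sets (`colorable_iff_cover`). The number of such covers is an alternating sum over vertex
sets `X` of `F X ^ k`, where `F X` counts the independent dominating subsets of `X`. This vanishes
unless `X` dominates (`colorable_iff_sum_ne`). The dominating sets can be listed with no partial
list longer than the final one (`mem_dominatingList`, `length_dominatingList_le`). They are closed
under supersets, so `F` is computed by a zeta transform on them alone (`zeta_succ`, `zeta_eq_zero`).

Two points concern the machine. Programs that store only short numbers are analysed by counting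
steps (`StepExec.exec`, `Run`), since a step then costs `O(W)`. The given program `A` is arbitrary
and expects an otherwise empty memory; instead of erasing the memory between calls, each call runs
in its own residue class of addresses modulo the number of guesses, with an overhead factor linear
in the bit length of that number (`Stamped.exec`). -/

namespace RAM

/-! ### Notation for expressions -/

/-- The scalar variable kept in cell `0` of bank `b`. -/
def Expr.var (b : ℕ) : Expr := .load b (.const 0)

instance : Add Expr := ⟨.op .add⟩
instance : Sub Expr := ⟨.op .sub⟩
instance : Mul Expr := ⟨.op .mul⟩
instance : Div Expr := ⟨.op .div⟩
instance : Mod Expr := ⟨.op .mod⟩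
instance : AndOp Expr := ⟨.op .land⟩
instance : OrOp Expr := ⟨.op .lor⟩

/-- The test `e₁ = e₂`. -/
def Expr.eqTest (e₁ e₂ : Expr) : Expr := .op .eq e₁ e₂

/-- The test `e₁ < e₂`. -/
def Expr.ltTest (e₁ e₂ : Expr) : Expr := .op .lt e₁ e₂

section eval
variable (m : Mem) (x y : Expr)

@[simp] theorem Expr.eval_var (b : ℕ) : (Expr.var b).eval m = m b 0 := rfl
@[simp] theorem Expr.eval_const (c : ℕ) : (Expr.const c).eval m = c := rfl
@[simp] theorem Expr.eval_load (b : ℕ) : (Expr.load b x).eval m = m b (x.eval m) := rfl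
@[simp] theorem Expr.eval_add : (x + y).eval m = x.eval m + y.eval m := rfl
@[simp] theorem Expr.eval_sub : (x - y).eval m = x.eval m - y.eval m := rfl
@[simp] theorem Expr.eval_mul : (x * y).eval m = x.eval m * y.eval m := rfl
@[simp] theorem Expr.eval_div : (x / y).eval m = x.eval m / y.eval m := rfl
@[simp] theorem Expr.eval_mod : (x % y).eval m = x.eval m % y.eval m := rfl
@[simp] theorem Expr.eval_and : (x &&& y).eval m = x.eval m &&& y.eval m := rfl
@[simp] theorem Expr.eval_or : (x ||| y).eval m = x.eval m ||| y.eval m := rfl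
@[simp] theorem Expr.eval_eqTest :
    (x.eqTest y).eval m = if x.eval m = y.eval m then 1 else 0 := rfl
@[simp] theorem Expr.eval_ltTest :
    (x.ltTest y).eval m = if x.eval m < y.eval m then 1 else 0 := rfl
end eval

@[simp] theorem Mem.write_of_ne (m : Mem) {b b' : ℕ} (a x : ℕ) (h : b' ≠ b) :
    m.write b a x b' = m b' := by
  funext a'
  simp [Mem.write, h]

@[simp] theorem Mem.write_self (m : Mem) (b a x : ℕ) :
    m.write b a x b = Function.update (m b) a x := by
  funext a'
  simp [Mem.write, Function.update_apply]

/-! ### The cost of expressions over small numbers -/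

/-- The value of an expression has at most `width` times as many bits as the numbers in the
memory. -/
def Expr.width : Expr → ℕ
  | .const c => c.size
  | .load _ _ => 1
  | .op _ e₁ e₂ => e₁.width + e₂.width + 1

/-- The cost of an expression is at most `weight` times the number of bits of the numbers in the
memory. -/
def Expr.weight : Expr → ℕ
  | .const c => 1 + c.size
  | .load _ e => e.weight + (2 + e.width)
  | .op _ e₁ e₂ => e₁.weight + e₂.weight + (2 + 2 * (e₁.width + e₂.width))

/-- The expression loads from banks below `N` only. -/
def Expr.ReadsBelow (N : ℕ) : Expr → Prop
  | .const _ => True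
  | .load b e => b < N ∧ e.ReadsBelow N
  | .op _ e₁ e₂ => e₁.ReadsBelow N ∧ e₂.ReadsBelow N

/-- The numbers in the banks below `N` have at most `W` bits. -/
def Mem.Bounded (N W : ℕ) (m : Mem) : Prop := ∀ b < N, ∀ a, m b a < 2 ^ W

/-- Multiplication adds the numbers of bits. The summand `1` is there for the test `0 = 0`, whose
value has one bit although its operands have none. -/
theorem Op.size_eval_le (o : Op) (x y : ℕ) : (o.eval x y).size ≤ x.size + y.size + 1 := by
  have hx := Nat.lt_size_self x
  have hy := Nat.lt_size_self y
  have hX : x < 2 ^ (x.size + y.size) := hx.trans_le (Nat.pow_le_pow_right (by simp) (by simp))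
  have hY : y < 2 ^ (x.size + y.size) := hy.trans_le (Nat.pow_le_pow_right (by simp) (by simp))
  have hle : 1 < 2 ^ (x.size + y.size + 1) := Nat.one_lt_two_pow (by simp)
  rw [Nat.size_le]
  have hP : 2 ^ (x.size + y.size + 1) = 2 * 2 ^ (x.size + y.size) := by ring
  cases o <;> simp only [Op.eval]
  · omega
  · omega
  · calc x * y < 2 ^ x.size * 2 ^ y.size := Nat.mul_lt_mul'' hx hy
      _ = 2 ^ (x.size + y.size) := by ring
      _ ≤ _ := by omega
  · have := Nat.div_le_self x y
    omega
  · have := Nat.mod_le x y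
    omega
  · have := Nat.and_le_left (n := x) (m := y)
    omega
  · have := Nat.or_lt_two_pow hX hY
    omega
  · split <;> omega
  · split <;> omega

theorem Expr.size_eval_le {N W : ℕ} {m : Mem} (hm : m.Bounded N W) :
    ∀ e : Expr, e.ReadsBelow N → (e.eval m).size ≤ e.width * (W + 1)
  | .const c, _ => by
    simp only [Expr.eval, Expr.width]
    nlinarith
  | .load b e, h => by
    have := Nat.size_le.2 (hm b h.1 (e.eval m))
    simp only [Expr.eval, Expr.width]
    omega
  | .op o e₁ e₂, h => by
    have h₁ := e₁.size_eval_le hm h.1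
    have h₂ := e₂.size_eval_le hm h.2
    have h₃ := o.size_eval_le (e₁.eval m) (e₂.eval m)
    simp only [Expr.eval, Expr.width]
    nlinarith

theorem Expr.cost_le {N W : ℕ} {m : Mem} (hm : m.Bounded N W) :
    ∀ e : Expr, e.ReadsBelow N → e.cost m ≤ e.weight * (W + 1)
  | .const c, _ => by
    simp only [Expr.cost, Expr.weight]
    nlinarith
  | .load b e, h => by
    have h₁ := e.cost_le hm h.2
    have h₂ := e.size_eval_le hm h.2
    have := Nat.size_le.2 (hm b h.1 (e.eval m))
    simp only [Expr.cost, Expr.weight]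
    nlinarith
  | .op o e₁ e₂, h => by
    have h₁ := e₁.size_eval_le hm h.1
    have h₂ := e₂.size_eval_le hm h.2
    have h₃ := o.size_eval_le (e₁.eval m) (e₂.eval m)
    have h₄ := e₁.cost_le hm h.1
    have h₅ := e₂.cost_le hm h.2
    simp only [Expr.cost, Expr.weight]
    nlinarith

/-! ### Counting steps -/

/-- `StepExec W p m s m'`: the program `p`, started in memory `m`, halts in memory `m'` after `s`
elementary steps and stores only numbers with at most `W` bits. -/
inductive StepExec (W : ℕ) : Program → Mem → ℕ → Mem → Prop
  | skip (m : Mem) : StepExec W .skip m 1 m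
  | store (m : Mem) (b : ℕ) (addr val : Expr) : val.eval m < 2 ^ W →
      StepExec W (.store b addr val) m 1 (m.write b (addr.eval m) (val.eval m))
  | seq {p q : Program} {m m₁ m₂ : Mem} {t₁ t₂ : ℕ} :
      StepExec W p m t₁ m₁ → StepExec W q m₁ t₂ m₂ → StepExec W (.seq p q) m (t₁ + t₂) m₂
  | condTrue {e : Expr} {p q : Program} {m m' : Mem} {t : ℕ} :
      e.eval m ≠ 0 → StepExec W p m t m' → StepExec W (.cond e p q) m (1 + t) m'
  | condFalse {e : Expr} {p q : Program} {m m' : Mem} {t : ℕ} :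
      e.eval m = 0 → StepExec W q m t m' → StepExec W (.cond e p q) m (1 + t) m'
  | loopTrue {e : Expr} {p : Program} {m m₁ m₂ : Mem} {t₁ t₂ : ℕ} :
      e.eval m ≠ 0 → StepExec W p m t₁ m₁ → StepExec W (.loop e p) m₁ t₂ m₂ →
      StepExec W (.loop e p) m (1 + t₁ + t₂) m₂
  | loopFalse {e : Expr} {p : Program} {m : Mem} :
      e.eval m = 0 → StepExec W (.loop e p) m 1 m

/-- The program loads from banks below `N` only. -/
def Program.ReadsBelow (N : ℕ) : Program → Prop
  | .skip => True
  | .store _ addr val => addr.ReadsBelow N ∧ val.ReadsBelow N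
  | .seq p q => p.ReadsBelow N ∧ q.ReadsBelow N
  | .cond e p q => e.ReadsBelow N ∧ p.ReadsBelow N ∧ q.ReadsBelow N
  | .loop e p => e.ReadsBelow N ∧ p.ReadsBelow N

/-- An elementary step costs at most `weight` times the number of bits of the numbers in the
memory. -/
def Program.weight : Program → ℕ
  | .skip => 1
  | .store _ addr val => addr.weight + val.weight + (1 + addr.width + val.width)
  | .seq p q => p.weight + q.weight
  | .cond e p q => e.weight + 1 + p.weight + q.weight
  | .loop e p => e.weight + 1 + p.weight

/-- The banks to which a program writes. -/
def Program.writes : Program → List ℕ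
  | .skip => []
  | .store b _ _ => [b]
  | .seq p q => p.writes ++ q.writes
  | .cond _ p q => p.writes ++ q.writes
  | .loop _ p => p.writes

/-- As only numbers below `2 ^ W` are stored, the bound on the memory persists, and each step
evaluates expressions of the program over numbers of at most `W` bits. Only banks below `N` are
controlled: higher banks hold the data of an arbitrary program and may contain large numbers. -/
theorem StepExec.exec {N W s : ℕ} {p : Program} {m m' : Mem} (h : StepExec W p m s m')
    (hp : p.ReadsBelow N) (hm : m.Bounded N W) :
    m'.Bounded N W ∧ ∃ t ≤ s * (p.weight * (W + 1)), Exec p m t m' := by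
  induction h with
  | skip m => exact ⟨hm, 1, by simp [Program.weight], .skip m⟩
  | store m b addr val hv =>
    refine ⟨fun b' hb' a' => ?_, _, ?_, .store m b addr val⟩
    · unfold Mem.write
      split
      · exact hv
      · exact hm b' hb' a'
    · have h₁ := addr.cost_le hm hp.1
      have h₂ := val.cost_le hm hp.2
      have h₃ := addr.size_eval_le hm hp.1
      have h₄ := val.size_eval_le hm hp.2
      simp only [Program.weight]
      nlinarith
  | seq _ _ ih₁ ih₂ =>
    obtain ⟨hm₁, t₁, ht₁, h₁⟩ := ih₁ hp.1 hm
    obtain ⟨hm₂, t₂, ht₂, h₂⟩ := ih₂ hp.2 hm₁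
    refine ⟨hm₂, _, ?_, .seq h₁ h₂⟩
    simp only [Program.weight]
    refine (add_le_add ht₁ ht₂).trans ?_
    rw [add_mul]
    gcongr <;> omega
  | @condTrue e p q m m' t he _ ih =>
    obtain ⟨hm₁, t₁, ht₁, h₁⟩ := ih hp.2.1 hm
    refine ⟨hm₁, _, ?_, .condTrue he h₁⟩
    have h₂ := e.cost_le hm hp.1
    simp only [Program.weight]
    have : t * (p.weight * (W + 1)) ≤ t * ((e.weight + 1 + p.weight + q.weight) * (W + 1)) := by
      gcongr; omega
    nlinarith
  | @condFalse e p q m m' t he _ ih =>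
    obtain ⟨hm₁, t₁, ht₁, h₁⟩ := ih hp.2.2 hm
    refine ⟨hm₁, _, ?_, .condFalse he h₁⟩
    have h₂ := e.cost_le hm hp.1
    simp only [Program.weight]
    have : t * (q.weight * (W + 1)) ≤ t * ((e.weight + 1 + p.weight + q.weight) * (W + 1)) := by
      gcongr; omega
    nlinarith
  | @loopTrue e p m m₁ m₂ s₁ s₂ he _ _ ih₁ ih₂ =>
    obtain ⟨hm₁, t₁, ht₁, h₁⟩ := ih₁ hp.2 hm
    obtain ⟨hm₂, t₂, ht₂, h₂⟩ := ih₂ hp hm₁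
    refine ⟨hm₂, _, ?_, .loopTrue he h₁ h₂⟩
    have h₃ := e.cost_le hm hp.1
    simp only [Program.weight] at ht₂ ⊢
    have : s₁ * (p.weight * (W + 1)) ≤ s₁ * ((e.weight + 1 + p.weight) * (W + 1)) := by
      gcongr; omega
    nlinarith
  | @loopFalse e p m he =>
    refine ⟨hm, _, ?_, .loopFalse he⟩
    have h₃ := e.cost_le hm hp.1
    simp only [Program.weight]
    nlinarith

theorem StepExec.frame {W s : ℕ} {p : Program} {m m' : Mem} (h : StepExec W p m s m') :
    ∀ b ∉ p.writes, m' b = m b := by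
  induction h with
  | skip => exact fun _ _ => rfl
  | store => exact fun b hb => Mem.write_of_ne _ _ _ (by simpa [Program.writes] using hb)
  | seq _ _ ih₁ ih₂ =>
    intro b hb
    simp only [Program.writes, List.mem_append, not_or] at hb
    rw [ih₂ b hb.2, ih₁ b hb.1]
  | condTrue _ _ ih =>
    intro b hb
    simp only [Program.writes, List.mem_append, not_or] at hb
    exact ih b hb.1
  | condFalse _ _ ih =>
    intro b hb
    simp only [Program.writes, List.mem_append, not_or] at hb
    exact ih b hb.2
  | loopTrue _ _ _ ih₁ ih₂ =>
    intro b hb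
    rw [ih₂ b hb, ih₁ b hb]
  | loopFalse => exact fun _ _ => rfl

/-! ### Total correctness -/

/-- `Run W p m s Q`: the program `p`, started in memory `m`, halts after at most `s` elementary
steps in a memory that satisfies `Q`, and it stores only numbers with at most `W` bits. -/
def Run (W : ℕ) (p : Program) (m : Mem) (s : ℕ) (Q : Mem → Prop) : Prop :=
  ∃ t ≤ s, ∃ m', StepExec W p m t m' ∧ Q m'

section Run
variable {W s s₁ s₂ : ℕ} {p q : Program} {m : Mem} {Q Q' : Mem → Prop}

/-- The frame condition is available when the postcondition is weakened, so specifications need not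
mention the banks that a program leaves alone. -/
theorem Run.mono (h : Run W p m s₁ Q) (hs : s₁ ≤ s₂)
    (hQ : ∀ m', (∀ b ∉ p.writes, m' b = m b) → Q m' → Q' m') : Run W p m s₂ Q' :=
  let ⟨t, ht, m', he, hm⟩ := h
  ⟨t, ht.trans hs, m', he, hQ m' he.frame hm⟩

theorem Run.le (h : Run W p m s₁ Q) (hs : s₁ ≤ s₂) : Run W p m s₂ Q :=
  h.mono hs fun _ _ h => h

theorem Run.skip (h : Q m) : Run W .skip m 1 Q := ⟨1, le_rfl, m, .skip m, h⟩

theorem Run.store {b : ℕ} {addr val : Expr} (hv : val.eval m < 2 ^ W)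
    (h : Q (m.write b (addr.eval m) (val.eval m))) : Run W (.store b addr val) m 1 Q :=
  ⟨1, le_rfl, _, .store m b addr val hv, h⟩

theorem Run.seq (h : Run W p m s₁ fun m' => (∀ b ∉ p.writes, m' b = m b) → Run W q m' s₂ Q) :
    Run W (.seq p q) m (s₁ + s₂) Q := by
  obtain ⟨t₁, ht₁, m₁, h₁, h⟩ := h
  obtain ⟨t₂, ht₂, m₂, h₂, h⟩ := h h₁.frame
  exact ⟨_, add_le_add ht₁ ht₂, m₂, .seq h₁ h₂, h⟩

theorem Run.store_seq {b : ℕ} {addr val : Expr} (hv : val.eval m < 2 ^ W)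
    (h : Run W q (m.write b (addr.eval m) (val.eval m)) s Q) :
    Run W (.seq (.store b addr val) q) m (1 + s) Q :=
  Run.seq (Run.store hv fun _ => h)

theorem Run.cond {e : Expr} (h₁ : e.eval m ≠ 0 → Run W p m s Q)
    (h₂ : e.eval m = 0 → Run W q m s Q) : Run W (.cond e p q) m (1 + s) Q := by
  by_cases he : e.eval m = 0
  · obtain ⟨t, ht, m', h, hQ⟩ := h₂ he
    exact ⟨_, by omega, m', .condFalse he h, hQ⟩
  · obtain ⟨t, ht, m', h, hQ⟩ := h₁ he
    exact ⟨_, by omega, m', .condTrue he h, hQ⟩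

/-- The loop `for i = 0, …, e - 1 do p`, where `i` is a scalar variable. -/
def Program.forLoop (i : ℕ) (e : Expr) (p : Program) : Program :=
  .seq (.store i (.const 0) (.const 0))
    (.loop ((Expr.var i).ltTest e) (.seq p (.store i (.const 0) (Expr.var i + Expr.const 1))))

/-- The invariant refers to the memory after the counter has been updated. The expression `e` is
evaluated anew in every round, hence the requirement that it keeps the value `N`. Each round pays
for a test and an increment besides `s`; the remaining `2` are the initial store and the failing
test. -/
theorem Run.forLoop {i : ℕ} {e : Expr} (N : ℕ) (I : ℕ → Mem → Prop) (hN : N < 2 ^ W)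
    (hi : i ∉ p.writes) (h₀ : I 0 (m.write i 0 0))
    (hbound : ∀ j ≤ N, ∀ m', (∀ b ∉ i :: p.writes, m' b = m b) → I j m' → e.eval m' = N)
    (hstep : ∀ j < N, ∀ m', (∀ b ∉ i :: p.writes, m' b = m b) → m' i 0 = j → I j m' →
      Run W p m' s fun m'' => I (j + 1) (m''.write i 0 (j + 1))) :
    Run W (.forLoop i e p) m (2 + N * (s + 2)) fun m' => I N m' := by
  -- Induction on the number `d` of rounds that are still to come.
  suffices h : ∀ d j, j + d = N → ∀ m', (∀ b ∉ i :: p.writes, m' b = m b) → m' i 0 = j → I j m' →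
      Run W (.loop ((Expr.var i).ltTest e)
        (.seq p (.store i (.const 0) (Expr.var i + Expr.const 1)))) m' (1 + d * (s + 2))
        fun m' => I N m' by
    have := h N 0 (by simp) (m.write i 0 0) (fun b hb => by
      simp only [List.mem_cons, not_or] at hb
      exact Mem.write_of_ne _ _ _ hb.1) (by simp) h₀
    exact (Run.store_seq (by simp) (by simpa using this)).le (by omega)
  intro d
  induction d with
  | zero =>
    intro j hj m' hf hij hI
    refine ⟨1, by omega, m', .loopFalse ?_, ?_⟩
    · simp [hij, hbound j (by omega) m' hf hI]
      omega
    · rwa [← hj]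
  | succ d ih =>
    intro j hj m' hf hij hI
    obtain ⟨t₁, ht₁, m₁, h₁, hI₁⟩ := hstep j (by omega) m' hf hij hI
    have hm₁ : m₁ i 0 = j := by rw [h₁.frame i hi, hij]
    obtain ⟨t₂, ht₂, m₂, h₂, hI₂⟩ := ih (j + 1) (by omega) (m₁.write i 0 (j + 1)) (fun b hb => by
      have hb' := hb
      simp only [List.mem_cons, not_or] at hb'
      rw [Mem.write_of_ne _ _ _ hb'.1, h₁.frame b hb'.2, hf b hb]) (by simp) hI₁
    refine ⟨1 + (t₁ + 1) + t₂, ?_, m₂, .loopTrue ?_ (.seq h₁ (.store _ i (.const 0) _ ?_)) ?_, hI₂⟩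
    · have : (d + 1) * (s + 2) = d * (s + 2) + (s + 2) := by ring
      omega
    · simp [hij, hbound j (by omega) m' hf hI]
      omega
    · simp [hm₁]
      omega
    · simpa [hm₁] using h₂

@[simp] theorem Program.writes_forLoop (i : ℕ) (e : Expr) (p : Program) :
    (Program.forLoop i e p).writes = i :: (p.writes ++ [i]) := rfl

end Run

end RAM

namespace RAM

/-! ### Running a program many times in disjoint parts of the memory

The stamped program keeps the cell `a` of bank `b` of the original program in the cell `a * R + r`
of bank `b + N`, where the scalar variables `R` and `r < R` are kept in banks `bR` and `br`.  Runs
with different stamps `r` do not interfere. -/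

section stamp
variable (N bR br : ℕ)

/-- The stamped address. -/
def Expr.stampAddr (e : Expr) : Expr := e * Expr.var bR + Expr.var br

/-- The stamped version of an expression. -/
def Expr.stamp : Expr → Expr
  | .const c => .const c
  | .load b e => .load (b + N) (e.stamp.stampAddr bR br)
  | .op o e₁ e₂ => .op o e₁.stamp e₂.stamp

/-- The stamped version of a program. -/
def Program.stamp : Program → Program
  | .skip => .skip
  | .store b a v => .store (b + N) ((a.stamp N bR br).stampAddr bR br) (v.stamp N bR br)
  | .seq p q => .seq p.stamp q.stamp
  | .cond e p q => .cond (e.stamp N bR br) p.stamp q.stamp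
  | .loop e p => .loop (e.stamp N bR br) p.stamp

variable {N bR br} {R r : ℕ}

/-- The memory `M` contains the memory `m` with stamp `r`. -/
structure Stamped (N bR br R r : ℕ) (M m : Mem) : Prop where
  size : M bR 0 = R
  index : M br 0 = r
  lt : r < R
  bank_size : bR < N
  bank_index : br < N
  cell : ∀ b a, M (b + N) (a * R + r) = m b a

theorem size_mul_add_le {a R r : ℕ} (h : r < R) : (a * R + r).size ≤ a.size + R.size := by
  have ha := Nat.lt_size_self a
  have hR := Nat.lt_size_self R
  rw [Nat.size_le, pow_add]
  calc a * R + r < (a + 1) * R := by linarith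
    _ ≤ 2 ^ a.size * 2 ^ R.size := Nat.mul_le_mul ha hR.le

/-- All numbers in the address computation have at most `size a + size R` bits, where `a` is the
original address. The bound is stated as a product so that the overhead becomes one multiplicative
factor for the whole run. -/
theorem Stamped.cost_stampAddr {M m : Mem} (h : Stamped N bR br R r M m) (e : Expr) :
    (e.stampAddr bR br).cost M + 1 + ((e.stampAddr bR br).eval M).size ≤
      e.cost M + 8 * (1 + R.size) * (1 + (e.eval M).size) := by
  have h₁ := size_mul_add_le (a := e.eval M) h.lt
  have h₂ := size_mul_add_le (a := e.eval M) (r := 0) (by have := h.lt; omega : 0 < R)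
  have h₃ := Nat.size_le_size h.lt.le
  have h₄ : (e.stampAddr bR br).eval M = e.eval M * R + r := by
    simp [Expr.stampAddr, h.size, h.index]
  have h₅ : (e.stampAddr bR br).cost M = e.cost M + (1 + (0 : ℕ).size + (1 + (0 : ℕ).size + R.size))
      + (1 + (e.eval M).size + R.size + (e.eval M * R).size)
      + (1 + (0 : ℕ).size + (1 + (0 : ℕ).size + r.size))
      + (1 + (e.eval M * R).size + r.size + (e.eval M * R + r).size) := by
    rw [← h.size, ← h.index]
    rfl
  rw [h₄, h₅]
  simp only [Nat.size_zero]
  rw [add_zero] at h₂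
  nlinarith

theorem Stamped.eval {M m : Mem} (h : Stamped N bR br R r M m) :
    ∀ e : Expr, (e.stamp N bR br).eval M = e.eval m
  | .const _ => rfl
  | .load b e => by
    have := h.eval e
    simp only [Expr.stamp, Expr.stampAddr, Expr.eval_load, Expr.eval_add, Expr.eval_mul,
      Expr.eval_var, this, h.size, h.index, h.cell]
  | .op o e₁ e₂ => by
    have h₁ := h.eval e₁
    have h₂ := h.eval e₂
    simp only [Expr.stamp, Expr.eval, h₁, h₂]

theorem Stamped.cost {M m : Mem} (h : Stamped N bR br R r M m) :
    ∀ e : Expr, (e.stamp N bR br).cost M ≤ 8 * (1 + R.size) * e.cost m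
  | .const c => by
    simp only [Expr.stamp, Expr.cost]
    nlinarith
  | .load b e => by
    have h₁ := h.cost e
    have h₂ := h.cost_stampAddr (e.stamp N bR br)
    have h₃ := h.eval (.load b e)
    have h₄ := h.eval e
    simp only [Expr.stamp, Expr.eval] at h₃ h₄
    simp only [Expr.stamp, Expr.cost, h₃]
    rw [h₄] at h₂
    nlinarith
  | .op o e₁ e₂ => by
    have h₁ := h.cost e₁
    have h₂ := h.cost e₂
    simp only [Expr.stamp, Expr.cost, h.eval]
    nlinarith

/-- The stamped program simulates the original step by step. Banks below `N` survive because stamped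
banks are shifted by `N`. Other slices survive because an address determines its stamp as its
residue modulo `R`. -/
theorem Stamped.exec {A : Program} {m m' : Mem} {t : ℕ} (hA : Exec A m t m') :
    ∀ {M : Mem}, Stamped N bR br R r M m → ∃ t' ≤ 8 * (1 + R.size) * t, ∃ M',
      Exec (A.stamp N bR br) M t' M' ∧ Stamped N bR br R r M' m' ∧ (∀ b < N, M' b = M b) ∧
      ∀ b a, ∀ r' < R, r' ≠ r → M' b (a * R + r') = M b (a * R + r') := by
  induction hA with
  | skip m =>
    exact fun {M} h => ⟨1, by nlinarith, M, .skip M, h, fun _ _ => rfl, fun _ _ _ _ _ => rfl⟩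
  | store m b a v =>
    intro M h
    have he : ((a.stamp N bR br).stampAddr bR br).eval M = a.eval m * R + r := by
      simp [Expr.stampAddr, h.eval, h.size, h.index]
    -- Uniqueness of quotient and remainder modulo `R`.
    have inj : ∀ a₁ a₂ r', r' < R → a₁ * R + r' = a₂ * R + r → a₁ = a₂ ∧ r' = r := by
      intro a₁ a₂ r' hr' hh
      have hmod := congrArg (· % R) hh
      simp only [Nat.mul_add_mod_self_right, Nat.mod_eq_of_lt hr', Nat.mod_eq_of_lt h.lt] at hmod
      subst hmod
      exact ⟨Nat.eq_of_mul_eq_mul_right (by omega : 0 < R) (by omega), rfl⟩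
    have hlow : ∀ b' < N, ∀ x y, M.write (b + N) x y b' = M b' :=
      fun b' hb' x y => Mem.write_of_ne _ _ _ (by omega)
    refine ⟨_, ?_, _, .store _ _ _ _, ⟨?_, ?_, h.lt, h.bank_size, h.bank_index, ?_⟩, ?_, ?_⟩
    · have h₁ := h.cost_stampAddr (a.stamp N bR br)
      have h₂ := h.cost a
      have h₃ := h.cost v
      rw [h.eval] at h₁
      rw [h.eval]
      nlinarith
    · rw [hlow _ h.bank_size, h.size]
    · rw [hlow _ h.bank_index, h.index]
    · intro b' a'
      rw [he, h.eval]
      unfold Mem.write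
      by_cases hc : b' = b ∧ a' = a.eval m
      · simp [hc]
      · rw [if_neg hc, if_neg, h.cell]
        rintro ⟨h₁, h₂⟩
        exact hc ⟨by omega, (inj _ _ _ h.lt h₂).1⟩
    · exact fun b' hb' => hlow b' hb' _ _
    · intro b' a' r' hr' hne
      unfold Mem.write
      rw [if_neg]
      rintro ⟨-, h₂⟩
      rw [he] at h₂
      exact hne (inj _ _ _ hr' h₂).2
  | seq _ _ ih₁ ih₂ =>
    intro M h
    obtain ⟨t₁, ht₁, M₁, h₁, hs₁, hl₁, hr₁⟩ := ih₁ h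
    obtain ⟨t₂, ht₂, M₂, h₂, hs₂, hl₂, hr₂⟩ := ih₂ hs₁
    exact ⟨_, by nlinarith, M₂, .seq h₁ h₂, hs₂, fun b hb => by rw [hl₂ b hb, hl₁ b hb],
      fun b a r' hr' hne => by rw [hr₂ b a r' hr' hne, hr₁ b a r' hr' hne]⟩
  | @condTrue e _ _ _ _ _ he _ ih =>
    intro M h
    obtain ⟨t₁, ht₁, M₁, h₁, hs₁, hl₁, hr₁⟩ := ih h
    have := h.cost e
    exact ⟨_, by nlinarith, M₁, .condTrue (by rwa [h.eval]) h₁, hs₁, hl₁, hr₁⟩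
  | @condFalse e _ _ _ _ _ he _ ih =>
    intro M h
    obtain ⟨t₁, ht₁, M₁, h₁, hs₁, hl₁, hr₁⟩ := ih h
    have := h.cost e
    exact ⟨_, by nlinarith, M₁, .condFalse (by rwa [h.eval]) h₁, hs₁, hl₁, hr₁⟩
  | @loopTrue e _ _ _ _ _ _ he _ _ ih₁ ih₂ =>
    intro M h
    obtain ⟨t₁, ht₁, M₁, h₁, hs₁, hl₁, hr₁⟩ := ih₁ h
    obtain ⟨t₂, ht₂, M₂, h₂, hs₂, hl₂, hr₂⟩ := ih₂ hs₁
    have := h.cost e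
    exact ⟨_, by nlinarith, M₂, .loopTrue (by rwa [h.eval]) h₁ h₂, hs₂,
      fun b hb => by rw [hl₂ b hb, hl₁ b hb],
      fun b a r' hr' hne => by rw [hr₂ b a r' hr' hne, hr₁ b a r' hr' hne]⟩
  | @loopFalse e _ _ he =>
    intro M h
    have := h.cost e
    exact ⟨_, by nlinarith, M, .loopFalse (by rwa [h.eval]), h, fun _ _ => rfl,
      fun _ _ _ _ _ => rfl⟩

end stamp

/-- A program needs time to produce large numbers. -/
theorem Exec.size_le {p : Program} {m m' : Mem} {t : ℕ} (h : Exec p m t m') (b a : ℕ) :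
    (m' b a).size ≤ (m b a).size + t := by
  induction h with
  | skip => omega
  | store =>
    unfold Mem.write
    split <;> omega
  | seq => omega
  | condTrue => omega
  | condFalse => omega
  | loopTrue => omega
  | loopFalse => omega

end RAM

/-! ### Covers by independent dominating sets -/

namespace SimpleGraph
variable {V : Type*}

/-- `X` meets the closed neighbourhood of every vertex. -/
def Dominates (G : SimpleGraph V) (X : Finset V) : Prop := ∀ v, ∃ w ∈ X, w = v ∨ G.Adj v w

theorem Dominates.mono {G : SimpleGraph V} {X Y : Finset V} (h : G.Dominates X) (hXY : X ⊆ Y) :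
    G.Dominates Y := fun v =>
  let ⟨w, hw, h⟩ := h v
  ⟨w, hXY hw, h⟩

variable [Fintype V] [DecidableEq V]

/-- A maximal independent set dominates: a vertex outside its closed neighbourhood could be added to
it. -/
theorem exists_dominates_of_indep (G : SimpleGraph V) (S : Finset V) (hS : G.IsIndepSet S) :
    ∃ T, S ⊆ T ∧ G.IsIndepSet (T : Set V) ∧ G.Dominates T := by
  classical
  obtain ⟨T, hST, hT⟩ := Finset.exists_le_maximal
    (s := Finset.univ.filter fun T : Finset V => G.IsIndepSet (T : Set V)) (by simpa using hS)
  have hTi : G.IsIndepSet (T : Set V) := by simpa using hT.prop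
  refine ⟨T, hST, hTi, fun v => ?_⟩
  by_contra! h
  have hvT : v ∉ T := fun hv => (h v hv).1 rfl
  have : insert v T ≤ T := by
    refine hT.le_of_ge ?_ (Finset.subset_insert v T)
    simp only [Finset.mem_filter, Finset.mem_univ, true_and, Finset.coe_insert]
    intro x hx y hy hxy hadj
    rcases hx with rfl | hx <;> rcases hy with rfl | hy
    · exact hxy rfl
    · exact (h y hy).2 hadj
    · exact (h x hx).2 hadj.symm
    · exact hTi hx hy hxy hadj
  exact hvT (this (Finset.mem_insert_self v T))

/-- A graph is `k`-colorable if and only if it is covered by `k` independent dominating sets. -/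
theorem colorable_iff_cover (G : SimpleGraph V) (k : ℕ) :
    G.Colorable k ↔ ∃ t : Fin k → Finset V,
      (∀ i, G.IsIndepSet (t i : Set V) ∧ G.Dominates (t i)) ∧ ∀ v, ∃ i, v ∈ t i := by
  classical
  constructor
  · rintro ⟨c⟩
    -- Each color class is enlarged to an independent dominating set. The enlarged classes may
    -- overlap, which is harmless for a cover.
    have h : ∀ i, ∃ T, Finset.univ.filter (fun v => c v = i) ⊆ T ∧ G.IsIndepSet (T : Set V) ∧
        G.Dominates T := fun i => G.exists_dominates_of_indep _ (by
      intro x hx y hy _ hadj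
      simp only [Finset.coe_filter, Finset.mem_univ, true_and, Set.mem_ofPred_eq] at hx hy
      exact c.valid hadj (hx.trans hy.symm))
    choose t ht using h
    exact ⟨t, fun i => (ht i).2, fun v => ⟨c v, (ht (c v)).1 (by simp)⟩⟩
  · rintro ⟨t, ht, hc⟩
    choose c hc using hc
    exact ⟨Coloring.mk c fun {u v} huv he =>
      (ht (c u)).1 (hc u) (by rw [he]; exact hc v) huv.ne huv⟩

end SimpleGraph

/-! ### Inclusion and exclusion -/

/-- Taking complements turns this into the alternating sum over the subsets of `Yᶜ`, which cancels
unless `Yᶜ` is empty. -/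
theorem Finset.sum_superset_neg_one_pow {V : Type*} [Fintype V] [DecidableEq V] (Y : Finset V) :
    ∑ X : Finset V, (if Y ⊆ X then (-1 : ℤ) ^ Xᶜ.card else 0) = if Y = univ then 1 else 0 := by
  have h := Finset.sum_powerset_neg_one_pow_card (x := Yᶜ)
  rw [← Finset.sum_filter]
  simp only [Finset.compl_eq_empty_iff] at h
  rw [← h]
  refine Finset.sum_nbij' (fun X => Xᶜ) (fun X => Xᶜ) ?_ ?_ ?_ ?_ ?_ <;> simp
  intro X hX
  exact Finset.subset_compl_comm.1 hX

/-- The number of covers by `k` sets with the property `P`. -/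
theorem Finset.sum_neg_one_pow_mul_card_pow {V : Type*} [Fintype V] [DecidableEq V]
    (P : Finset V → Prop) [DecidablePred P] (k : ℕ) :
    ∑ X : Finset V, (-1 : ℤ) ^ Xᶜ.card * ((univ.filter fun S => P S ∧ S ⊆ X).card : ℤ) ^ k =
      (univ.filter fun t : Fin k → Finset V => (∀ i, P (t i)) ∧ ∀ v, ∃ i, v ∈ t i).card := by
  -- The `k`-th power counts `k`-tuples of sets with `P` whose union lies in `X`. After the order of
  -- summation is exchanged, each tuple contributes an alternating sum over the supersets of its
  -- union.
  have h₁ : ∀ X : Finset V, ((univ.filter fun S => P S ∧ S ⊆ X).card : ℤ) ^ k =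
      ∑ t : Fin k → Finset V, if (∀ i, P (t i)) ∧ univ.biUnion t ⊆ X then 1 else 0 := by
    intro X
    rw [← Nat.cast_pow, ← Fintype.card_piFinset_const, Finset.sum_boole]
    congr 2
    ext t
    simp only [Fintype.mem_piFinset, mem_filter, mem_univ, true_and, Finset.biUnion_subset]
    exact forall_and.trans (by simp)
  simp_rw [h₁, Finset.mul_sum]
  rw [Finset.sum_comm, Finset.card_filter]
  push_cast
  refine Finset.sum_congr rfl fun t _ => ?_
  have h₂ := Finset.sum_superset_neg_one_pow (univ.biUnion t)
  by_cases hP : ∀ i, P (t i)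
  · simp only [hP, implies_true, true_and, mul_ite, mul_one, mul_zero]
    rw [h₂]
    congr 1
    simp [Finset.eq_univ_iff_forall]
  · simp [hP]

/-- The inclusion-exclusion criterion for `k`-colorability, over the dominating sets. -/
theorem SimpleGraph.colorable_iff_sum_ne {V : Type*} [Fintype V] [DecidableEq V]
    (G : SimpleGraph V) {k : ℕ} (hk : k ≠ 0) (F : Finset V → ℕ) [DecidablePred G.Dominates]
    (hF : ∀ X, F X = Set.ncard {S : Finset V | (G.IsIndepSet (S : Set V) ∧ G.Dominates S) ∧ S ⊆ X}) :
    G.Colorable k ↔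
      ∑ X ∈ (Finset.univ : Finset (Finset V)) with G.Dominates X ∧ Even X.card, F X ^ k ≠
      ∑ X ∈ (Finset.univ : Finset (Finset V)) with G.Dominates X ∧ ¬ Even X.card, F X ^ k := by
  classical
  have hF' : ∀ X, F X =
      (Finset.univ.filter fun S : Finset V => (G.IsIndepSet (S : Set V) ∧ G.Dominates S) ∧
        S ⊆ X).card := by
    intro X
    rw [hF, ← Set.ncard_coe_finset]
    simp
  have h := Finset.sum_neg_one_pow_mul_card_pow
    (fun S : Finset V => G.IsIndepSet (S : Set V) ∧ G.Dominates S) k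
  simp_rw [← hF'] at h
  have h0 : ∀ X, ¬ G.Dominates X → F X = 0 := by
    intro X hX
    -- A superset of a dominating set dominates, so an `X` that does not dominate contains no
    -- dominating set.
    rw [hF', Finset.card_eq_zero, Finset.filter_eq_empty_iff]
    exact fun S _ hS => hX (hS.1.2.mono hS.2)
  -- Up to a global sign, the parity of `X` may replace that of its complement. The positive and
  -- negative terms are collected separately, so that natural numbers suffice for the comparison.
  have hsign : ∀ X : Finset V, (-1 : ℤ) ^ Xᶜ.card = (-1) ^ Fintype.card V * (-1) ^ X.card := by
    intro X
    have hc := Finset.card_add_card_compl X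
    rw [← hc, pow_add, mul_right_comm, ← mul_pow]
    simp
  have hsum : ∑ X : Finset V, (-1 : ℤ) ^ X.card * (F X : ℤ) ^ k =
      (∑ X ∈ (Finset.univ : Finset (Finset V)) with G.Dominates X ∧ Even X.card, F X ^ k : ℕ) -
      (∑ X ∈ (Finset.univ : Finset (Finset V)) with G.Dominates X ∧ ¬ Even X.card, F X ^ k : ℕ) := by
    push_cast
    rw [Finset.sum_filter, Finset.sum_filter, ← Finset.sum_sub_distrib]
    refine Finset.sum_congr rfl fun X _ => ?_
    by_cases hX : G.Dominates X
    · by_cases he : Even X.card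
      · simp [hX, he]
      · simp [hX, he, (Nat.not_even_iff_odd.1 he).neg_one_pow]
    -- Here `k ≠ 0` matters: a set that does not dominate contributes `0 ^ k`.
    · simp [h0 X hX, hX, hk]
  simp_rw [hsign, mul_assoc] at h
  rw [← Finset.mul_sum, hsum] at h
  rw [colorable_iff_cover]
  set e := ∑ X ∈ (Finset.univ : Finset (Finset V)) with G.Dominates X ∧ Even X.card, F X ^ k
  set o := ∑ X ∈ (Finset.univ : Finset (Finset V)) with G.Dominates X ∧ ¬ Even X.card, F X ^ k
  have hne : e ≠ o ↔ (-1 : ℤ) ^ Fintype.card V * ((e : ℤ) - o) ≠ 0 := by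
    rw [mul_ne_zero_iff, sub_ne_zero]
    simp
  rw [hne, h, Nat.cast_ne_zero, Finset.card_ne_zero]
  constructor
  · rintro ⟨t, ht⟩
    exact ⟨t, by simpa using ht⟩
  · rintro ⟨t, ht⟩
    exact ⟨t, by simpa using ht⟩

/-! ### Sets of vertices as bit masks -/

/-- Writing `X = 2 ^ u * (2 * a + 1) + b` with `b < 2 ^ u` shows that the subtraction needs no
borrow. -/
theorem Nat.testBit_sub_two_pow {X u : ℕ} (h : X.testBit u) (i : ℕ) :
    (X - 2 ^ u).testBit i = (X.testBit i && decide (i ≠ u)) := by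
  obtain ⟨a, b, hb, rfl⟩ : ∃ a b, b < 2 ^ u ∧ X = 2 ^ u * (2 * a + 1) + b := by
    refine ⟨X / 2 ^ u / 2, X % 2 ^ u, Nat.mod_lt _ (by positivity), ?_⟩
    rw [Nat.testBit_eq_decide_div_mod_eq, decide_eq_true_eq] at h
    have h₁ := Nat.div_add_mod (X / 2 ^ u) 2
    rw [h] at h₁
    rw [h₁, Nat.div_add_mod]
  have h₁ : 2 ^ u * (2 * a + 1) + b - 2 ^ u = 2 ^ u * (2 * a) + b := by
    rw [mul_add, mul_one]
    omega
  rw [h₁, Nat.testBit_two_pow_mul_add _ hb, Nat.testBit_two_pow_mul_add _ hb]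
  rcases lt_trichotomy i u with hi | rfl | hi
  · simp [hi, hi.ne]
  · simp
  · obtain ⟨d, rfl⟩ := Nat.exists_eq_add_of_lt hi
    have : u + d + 1 - u = d + 1 := by omega
    have h₂ : (2 * a + 1) / 2 = a := by omega
    have h₃ : 2 * a / 2 = a := by omega
    rw [if_neg (by omega), if_neg (by omega), this, Nat.testBit_succ, Nat.testBit_succ, h₂, h₃]
    simp [show u + d + 1 ≠ u by omega]

theorem Nat.and_ne_zero_iff {x y : ℕ} : x &&& y ≠ 0 ↔ ∃ i, x.testBit i ∧ y.testBit i := by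
  constructor
  · intro h
    obtain ⟨i, hi⟩ := Nat.exists_testBit_of_ne_zero h
    exact ⟨i, by simpa using hi⟩
  · rintro ⟨i, hx, hy⟩ h
    have := congrArg (Nat.testBit · i) h
    simp [hx, hy] at this

/-- The set of vertices with bit mask `X`. -/
def maskSet (n X : ℕ) : Finset (Fin n) := Finset.univ.filter fun i => X.testBit i

@[simp] theorem mem_maskSet {n X : ℕ} {i : Fin n} : i ∈ maskSet n X ↔ X.testBit i := by
  simp [maskSet]

/-- The bound on `S` is needed because `maskSet n` does not see bits from position `n` on. -/
theorem maskSet_subset {n S X : ℕ} (hS : S < 2 ^ n) :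
    maskSet n S ⊆ maskSet n X ↔ ∀ i, S.testBit i → X.testBit i := by
  constructor
  · intro h i hi
    have hin : i < n := by
      by_contra hn
      rw [Nat.testBit_lt_two_pow (hS.trans_le (Nat.pow_le_pow_right (by simp) (by omega)))] at hi
      simp at hi
    exact mem_maskSet.1 (h (mem_maskSet.2 hi : (⟨i, hin⟩ : Fin n) ∈ _))
  · exact fun h i hi => mem_maskSet.2 (h i (mem_maskSet.1 hi))

theorem maskSet_injOn (n : ℕ) : Set.InjOn (maskSet n) (Set.Iio (2 ^ n)) := by
  intro X hX Y hY h
  refine Nat.eq_of_testBit_eq fun i => ?_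
  have h₁ := (maskSet_subset hX).1 h.le i
  have h₂ := (maskSet_subset hY).1 h.ge i
  exact Bool.eq_iff_iff.2 ⟨h₁, h₂⟩

theorem exists_maskSet {n : ℕ} (s : Finset (Fin n)) : ∃ X < 2 ^ n, maskSet n X = s := by
  refine ⟨Nat.ofBits fun i => decide (i ∈ s), Nat.ofBits_lt_two_pow _, ?_⟩
  ext i
  simp

theorem sum_maskSet {n : ℕ} {M : Type*} [AddCommMonoid M] (p : Finset (Fin n) → Prop)
    [DecidablePred p] (f : Finset (Fin n) → M) :
    ∑ s with p s, f s = ∑ X ∈ Finset.range (2 ^ n) with p (maskSet n X), f (maskSet n X) := by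
  symm
  refine Finset.sum_nbij (maskSet n) ?_ ?_ ?_ fun _ _ => rfl
  · simp
  · exact (maskSet_injOn n).mono fun X hX => by simpa using (by simpa using hX : _ ∧ _).1
  · intro s hs
    obtain ⟨X, hX, rfl⟩ := exists_maskSet s
    exact ⟨X, by simpa [hX] using hs, rfl⟩

theorem card_maskSet (n X : ℕ) :
    (maskSet n X).card = ((Finset.range n).filter fun v => X.testBit v).card := by
  refine Finset.card_nbij (fun i => (i : ℕ)) ?_ ?_ ?_
  · intro i hi
    simpa using hi
  · exact fun i _ j _ h => Fin.ext h
  · intro v hv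
    simp only [Finset.coe_filter, Finset.mem_range, Set.mem_ofPred_eq] at hv
    exact ⟨⟨v, hv.1⟩, by simpa using hv.2, rfl⟩

/-! ### Domination, independence and the zeta transform in terms of bit masks. -/

namespace SimpleGraph
variable {n : ℕ} (G : SimpleGraph (Fin n))

/-- Adjacency of vertices that are given by their numbers. -/
def NatAdj (u v : ℕ) : Prop := ∃ (hu : u < n) (hv : v < n), G.Adj ⟨u, hu⟩ ⟨v, hv⟩

@[simp] theorem natAdj_coe {u v : Fin n} : G.NatAdj u v ↔ G.Adj u v := by
  simp [NatAdj]

theorem NatAdj.symm {G : SimpleGraph (Fin n)} {u v : ℕ} (h : G.NatAdj u v) : G.NatAdj v u :=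
  let ⟨hu, hv, h⟩ := h
  ⟨hv, hu, h.symm⟩

open Classical in
/-- The bit mask of the closed neighbourhood of a vertex. -/
noncomputable def nbhdMask (v : ℕ) : ℕ :=
  Nat.ofBits fun w : Fin n => decide ((w : ℕ) = v ∨ G.NatAdj v w)

theorem testBit_nbhdMask (v w : ℕ) :
    (G.nbhdMask v).testBit w ↔ w < n ∧ (w = v ∨ G.NatAdj v w) := by
  by_cases hw : w < n
  · simp [nbhdMask, hw]
  · simp [nbhdMask, hw, not_lt.1 hw]

theorem nbhdMask_lt (v : ℕ) : G.nbhdMask v < 2 ^ n := Nat.ofBits_lt_two_pow _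

/-- `X` is the bit mask of a dominating set. -/
def DominatingMask (X : ℕ) : Prop := ∀ v < n, G.nbhdMask v &&& X ≠ 0

/-- `X` is the bit mask of an independent set. -/
def IndepMask (X : ℕ) : Prop := ∀ v < n, X.testBit v → G.nbhdMask v &&& X = 2 ^ v

theorem dominates_maskSet (X : ℕ) : G.Dominates (maskSet n X) ↔ G.DominatingMask X := by
  simp only [Dominates, DominatingMask, Nat.and_ne_zero_iff, testBit_nbhdMask, mem_maskSet,
    Fin.forall_iff, Fin.exists_iff]
  refine forall₂_congr fun v hv => ⟨?_, ?_⟩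
  · rintro ⟨w, hw, h, h'⟩
    exact ⟨w, ⟨hw, h'.imp (by simp) fun h => ⟨hv, hw, h⟩⟩, h⟩
  · rintro ⟨w, ⟨hw, h'⟩, h⟩
    exact ⟨w, hw, h, h'.imp (by simp) fun h => h.2.2⟩

theorem isIndepSet_maskSet (X : ℕ) :
    G.IsIndepSet (maskSet n X : Set (Fin n)) ↔ G.IndepMask X := by
  constructor
  · intro h v hv hX
    refine Nat.eq_of_testBit_eq fun w => Bool.eq_iff_iff.2 ?_
    simp only [Nat.testBit_and, Bool.and_eq_true, testBit_nbhdMask, Nat.testBit_two_pow,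
      decide_eq_true_eq]
    constructor
    · rintro ⟨⟨hw, rfl | hadj⟩, hwX⟩
      · rfl
      · by_contra hne
        exact h (x := ⟨v, hv⟩) (by simpa using hX) (y := ⟨w, hw⟩) (by simpa using hwX)
          (by simpa using hne) hadj.2.2
    · rintro rfl
      exact ⟨⟨hv, Or.inl rfl⟩, hX⟩
  · intro h u hu v hv hne hadj
    simp only [SetLike.mem_coe, mem_maskSet] at hu hv
    have h₁ := congrArg (Nat.testBit · v) (h u u.2 hu)
    have h₂ : (G.nbhdMask u).testBit v := (G.testBit_nbhdMask u v).2 ⟨v.2, Or.inr (by simpa)⟩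
    simp only [Nat.testBit_and, h₂, hv, Nat.testBit_two_pow] at h₁
    exact hne (Fin.ext (by simpa using h₁))

open Classical in
/-- The number of independent dominating sets `S ⊆ X` that agree with `X` on the bits from `u`
on. -/
noncomputable def zeta (u X : ℕ) : ℕ :=
  ((Finset.range (2 ^ n)).filter fun S => (G.IndepMask S ∧ G.DominatingMask S) ∧
    (∀ i, S.testBit i → X.testBit i) ∧ ∀ i, u ≤ i → S.testBit i = X.testBit i).card

-- Agreement with `X` on all bits forces `S = X`, so the only question left is whether `X` itself is
-- independent.
open Classical in
theorem zeta_zero {X : ℕ} (hX : X < 2 ^ n) (hd : G.DominatingMask X) :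
    G.zeta 0 X = if G.IndepMask X then 1 else 0 := by
  have h : ((Finset.range (2 ^ n)).filter fun S => (G.IndepMask S ∧ G.DominatingMask S) ∧
      (∀ i, S.testBit i → X.testBit i) ∧ ∀ i, 0 ≤ i → S.testBit i = X.testBit i) =
      if G.IndepMask X then {X} else ∅ := by
    ext S
    have : (∀ i, 0 ≤ i → S.testBit i = X.testBit i) ↔ S = X :=
      ⟨fun h => Nat.eq_of_testBit_eq fun i => h i (by simp), fun h => by simp [h]⟩
    rw [Finset.mem_filter, this]
    split
    · simp only [Finset.mem_range, Finset.mem_singleton]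
      constructor
      · exact fun h => h.2.2.2
      · rintro rfl
        simp_all
    · rename_i hX'
      simp only [Finset.notMem_empty, iff_false]
      rintro ⟨_, ⟨h₁, _⟩, _, rfl⟩
      exact hX' h₁
  rw [zeta, h]
  split <;> simp

/-- Domination passes to supersets. This lets the table be maintained on the dominating sets only:
at every level, the entries elsewhere are zero. -/
theorem zeta_eq_zero {u X : ℕ} (h : ¬ G.DominatingMask X) : G.zeta u X = 0 := by
  classical
  rw [zeta, Finset.card_eq_zero, Finset.filter_eq_empty_iff]
  rintro S - ⟨⟨-, hS⟩, hSX, -⟩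
  refine h fun v hv => ?_
  obtain ⟨i, h₁, h₂⟩ := Nat.and_ne_zero_iff.1 (hS v hv)
  exact Nat.and_ne_zero_iff.2 ⟨i, h₁, hSX i h₂⟩

/-- A subset of `X` agrees with `X` at `u` automatically if `u` is not in `X`. -/
theorem zeta_succ_of_not {u X : ℕ} (h : ¬ X.testBit u) : G.zeta (u + 1) X = G.zeta u X := by
  classical
  unfold zeta
  congr 1
  refine Finset.filter_congr fun S _ => and_congr_right fun _ => and_congr_right fun hS => ?_
  constructor
  · intro h' i hi
    rcases hi.eq_or_lt with rfl | hi
    · have := mt (hS u) h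
      simp_all
    · exact h' i hi
  · exact fun h' i hi => h' i (by omega)

/-- Split the counted sets by whether they contain `u`. Those that do agree with `X` from `u` on;
those that do not are subsets of `X - 2 ^ u` and agree with it from `u` on. -/
theorem zeta_succ {u X : ℕ} (h : X.testBit u) :
    G.zeta (u + 1) X = G.zeta u X + G.zeta u (X - 2 ^ u) := by
  classical
  unfold zeta
  rw [← Finset.card_filter_add_card_filter_not (fun S : ℕ => S.testBit u)]
  rw [Finset.filter_filter, Finset.filter_filter]
  congr 2 <;> refine Finset.filter_congr fun S _ => ?_
  · rw [and_assoc]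
    refine and_congr_right fun _ => ?_
    rw [and_assoc]
    refine and_congr_right fun hS => ?_
    constructor
    · rintro ⟨h₁, h₂⟩ i hi
      rcases hi.eq_or_lt with rfl | hi
      · rw [h, h₂]
      · exact h₁ i hi
    · exact fun h' => ⟨fun i hi => h' i (by omega), by rw [h' u le_rfl, h]⟩
  · rw [and_assoc]
    refine and_congr_right fun _ => ?_
    simp only [Nat.testBit_sub_two_pow h, Bool.and_eq_true, decide_eq_true_eq]
    constructor
    · rintro ⟨⟨h₁, h₂⟩, h₃⟩
      refine ⟨fun i hi => ⟨h₁ i hi, ?_⟩, fun i hi => ?_⟩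
      · rintro rfl
        exact h₃ hi
      · rcases hi.eq_or_lt with rfl | hi
        · simpa using h₃
        · rw [h₂ i hi]
          simp [hi.ne']
    · rintro ⟨h₁, h₂⟩
      refine ⟨⟨fun i hi => (h₁ i hi).1, fun i hi => ?_⟩, fun hu => (h₁ u hu).2 rfl⟩
      rw [h₂ i (by omega)]
      simp [show i ≠ u by omega]

theorem zeta_le (u X : ℕ) : G.zeta u X ≤ 2 ^ n := by
  classical
  exact (Finset.card_filter_le _ _).trans (by simp)

/-- At level `n` the agreement condition is void, since both masks have no bits from `n` on. -/
theorem zeta_card (X : ℕ) (hX : X < 2 ^ n) : G.zeta n X =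
    Set.ncard {S : Finset (Fin n) | (G.IsIndepSet (S : Set (Fin n)) ∧ G.Dominates S) ∧
      S ⊆ maskSet n X} := by
  classical
  have h := sum_maskSet (fun S : Finset (Fin n) =>
    (G.IsIndepSet (S : Set (Fin n)) ∧ G.Dominates S) ∧ S ⊆ maskSet n X) fun _ => 1
  rw [← Finset.card_eq_sum_ones, ← Finset.card_eq_sum_ones] at h
  rw [zeta, show ({S : Finset (Fin n) | _} : Set (Finset (Fin n))) = _ from
    (Finset.coe_filter_univ _).symm, Set.ncard_coe_finset, h]
  congr 1
  refine Finset.filter_congr fun S hS => ?_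
  rw [isIndepSet_maskSet, dominates_maskSet, maskSet_subset (Finset.mem_range.1 hS)]
  refine and_congr_right fun _ => and_iff_left fun i hi => ?_
  have h₁ : ∀ Y < 2 ^ n, Y.testBit i = false := fun Y hY =>
    Nat.testBit_lt_two_pow (hY.trans_le (Nat.pow_le_pow_right (by simp) hi))
  rw [h₁ X hX, h₁ S (Finset.mem_range.1 hS)]

open Classical in
/-- The bit masks of the dominating sets. -/
noncomputable def dominatingMasks : Finset ℕ :=
  (Finset.range (2 ^ n)).filter fun X => G.DominatingMask X

theorem mem_dominatingMasks {X : ℕ} :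
    X ∈ G.dominatingMasks ↔ X < 2 ^ n ∧ G.DominatingMask X := by
  classical
  simp [dominatingMasks]

/-- The number of vertices in the set with bit mask `X`. -/
def _root_.popCount (n X : ℕ) : ℕ := ((Finset.range n).filter fun v => X.testBit v).card

theorem colorable_iff_mask {k : ℕ} (hk : k ≠ 0) :
    G.Colorable k ↔
      ∑ X ∈ G.dominatingMasks, (if Even (popCount n X) then G.zeta n X ^ k else 0) ≠
      ∑ X ∈ G.dominatingMasks, (if Even (popCount n X) then 0 else G.zeta n X ^ k) := by
  classical
  rw [G.colorable_iff_sum_ne hk (fun X => Set.ncard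
    {S : Finset (Fin n) | (G.IsIndepSet (S : Set (Fin n)) ∧ G.Dominates S) ∧ S ⊆ X}) fun _ => rfl]
  rw [sum_maskSet, sum_maskSet]
  simp only [dominates_maskSet, card_maskSet]
  rw [← Finset.filter_filter, ← Finset.filter_filter, Finset.sum_filter (p := fun X => Even _),
    Finset.sum_filter (p := fun X => ¬ Even _)]
  refine not_congr (Eq.congr ?_ ?_) <;>
  · refine Finset.sum_congr rfl fun X hX => ?_
    rw [dominatingMasks, Finset.mem_filter, Finset.mem_range] at *
    rw [← zeta_card G X hX.1]
    by_cases h : Even (popCount n X) <;> simp only [popCount] at h ⊢ <;> simp [h]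

/-! ### Listing the dominating sets -/

/-- The set `X` of vertices below `u` meets all closed neighbourhoods that are contained in
`{0, …, u}`. -/
def DominatesBelow (u X : ℕ) : Prop := ∀ v < n, G.nbhdMask v < 2 ^ u → G.nbhdMask v &&& X ≠ 0

open Classical in
/-- The sets of vertices below `u` that dominate the vertices with neighbourhoods below `u`. -/
noncomputable def dominatingList : ℕ → List ℕ
  | 0 => [0]
  | u + 1 =>
    (dominatingList u).map (fun X => if G.DominatesBelow (u + 1) X then X else X ||| 2 ^ u) ++
    ((dominatingList u).filter (G.DominatesBelow (u + 1))).map (· ||| 2 ^ u)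

/-- A closed neighbourhood that fits below `u + 1` but not below `u` contains `u`. Hence adding `u`
to a member of the previous list always gives a valid set, while omitting `u` has to be tested.
Conversely, dropping the bit `u` leads back to a member of the previous list. -/
theorem mem_dominatingList {u X : ℕ} :
    X ∈ G.dominatingList u ↔ X < 2 ^ u ∧ G.DominatesBelow u X := by
  classical
  induction u generalizing X with
  | zero =>
    simp only [dominatingList, List.mem_singleton, pow_zero, Nat.lt_one_iff]
    refine ⟨?_, fun h => h.1⟩
    rintro rfl
    refine ⟨rfl, fun v hv h => ?_⟩
    -- A closed neighbourhood contains its centre, so none has mask `0` and nothing is required at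
    -- `u = 0`.
    have h₁ := (G.testBit_nbhdMask v v).2 ⟨hv, Or.inl rfl⟩
    have h₂ : G.nbhdMask v = 0 := by simpa using h
    simp [h₂] at h₁
  | succ u ih =>
    have hor : ∀ X < 2 ^ u, G.DominatesBelow u X → X ||| 2 ^ u < 2 ^ (u + 1) ∧
        G.DominatesBelow (u + 1) (X ||| 2 ^ u) := by
      intro X hX h
      refine ⟨Nat.or_lt_two_pow (hX.trans (Nat.pow_lt_pow_right (by simp) (by simp)))
        (Nat.pow_lt_pow_right (by simp) (by simp)), fun v hv h' => ?_⟩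
      rw [Nat.and_ne_zero_iff]
      by_cases hb : (G.nbhdMask v).testBit u
      · exact ⟨u, hb, by simp⟩
      · have : G.nbhdMask v < 2 ^ u := by
          refine Nat.lt_pow_two_of_testBit _ fun i hi => ?_
          rcases hi.eq_or_lt with rfl | hi
          · simpa using hb
          · exact Nat.testBit_lt_two_pow (h'.trans_le (Nat.pow_le_pow_right (by simp) hi))
        obtain ⟨i, h₁, h₂⟩ := Nat.and_ne_zero_iff.1 (h v hv this)
        exact ⟨i, h₁, by simp [h₂]⟩
    simp only [dominatingList, List.mem_append, List.mem_map, List.mem_filter, decide_eq_true_eq,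
      ih]
    constructor
    · rintro (⟨Y, ⟨h₁, h₂⟩, rfl⟩ | ⟨Y, ⟨⟨h₁, h₂⟩, -⟩, rfl⟩)
      · split
        · exact ⟨h₁.trans (Nat.pow_lt_pow_right (by simp) (by simp)), ‹_›⟩
        · exact hor Y h₁ h₂
      · exact hor Y h₁ h₂
    · rintro ⟨h₁, h₂⟩
      by_cases hb : X.testBit u
      · have hX : (X % 2 ^ u) ||| 2 ^ u = X := by
          refine Nat.eq_of_testBit_eq fun i => ?_
          rw [Nat.testBit_or, Nat.testBit_mod_two_pow, Nat.testBit_two_pow]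
          rcases lt_trichotomy i u with hi | rfl | hi
          · simp [hi, hi.ne']
          · simp [hb]
          · simp [hi.ne, not_lt.2 hi.le]
            exact (Nat.testBit_lt_two_pow (h₁.trans_le (Nat.pow_le_pow_right (by simp) hi)))
        have hY : X % 2 ^ u < 2 ^ u ∧ G.DominatesBelow u (X % 2 ^ u) := by
          refine ⟨Nat.mod_lt _ (by positivity), fun v hv h => ?_⟩
          obtain ⟨i, h₃, h₄⟩ := Nat.and_ne_zero_iff.1
            (h₂ v hv (h.trans (Nat.pow_lt_pow_right (by simp) (by simp))))
          refine Nat.and_ne_zero_iff.2 ⟨i, h₃, ?_⟩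
          have : i < u := by
            by_contra hi
            rw [Nat.testBit_lt_two_pow (h.trans_le (Nat.pow_le_pow_right (by simp)
              (not_lt.1 hi)))] at h₃
            simp at h₃
          simp [this, h₄]
        by_cases hg : G.DominatesBelow (u + 1) (X % 2 ^ u)
        · exact Or.inr ⟨_, ⟨hY, hg⟩, hX⟩
        · exact Or.inl ⟨_, hY, by rw [if_neg hg, hX]⟩
      · have hX : X < 2 ^ u := by
          refine Nat.lt_pow_two_of_testBit _ fun i hi => ?_
          rcases hi.eq_or_lt with rfl | hi
          · simpa using hb
          · exact Nat.testBit_lt_two_pow (h₁.trans_le (Nat.pow_le_pow_right (by simp) hi))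
        exact Or.inl ⟨X, ⟨hX, fun v hv h =>
          h₂ v hv (h.trans (Nat.pow_lt_pow_right (by simp) (by simp)))⟩, by rw [if_pos h₂]⟩

/-- Reduction modulo `2 ^ u` recovers the set from which an entry arose. A set that produces two
entries produces one without and one with the bit `u`. -/
theorem nodup_dominatingList (u : ℕ) : (G.dominatingList u).Nodup := by
  classical
  induction u with
  | zero => simp [dominatingList]
  | succ u ih =>
    have hlt : ∀ X ∈ G.dominatingList u, X < 2 ^ u := fun X hX => (G.mem_dominatingList.1 hX).1
    have hmod : ∀ X ∈ G.dominatingList u, (X ||| 2 ^ u) % 2 ^ u = X := fun X hX => by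
      rw [Nat.or_two_pow_eq_add_of_lt (hlt X hX), Nat.add_mod_right, Nat.mod_eq_of_lt (hlt X hX)]
    have hmod' : ∀ X ∈ G.dominatingList u,
        (if G.DominatesBelow (u + 1) X then X else X ||| 2 ^ u) % 2 ^ u = X := fun X hX => by
      split
      · exact Nat.mod_eq_of_lt (hlt X hX)
      · exact hmod X hX
    rw [dominatingList, List.nodup_append]
    refine ⟨ih.map_on fun X hX Y hY h => ?_, (ih.filter _).map_on fun X hX Y hY h => ?_, ?_⟩
    · rw [← hmod' X hX, ← hmod' Y hY, h]
    · rw [← hmod X (List.mem_of_mem_filter hX), ← hmod Y (List.mem_of_mem_filter hY), h]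
    · rintro a ha b hb rfl
      obtain ⟨X, hX, rfl⟩ := List.mem_map.1 ha
      obtain ⟨Y, hY, hXY⟩ := List.mem_map.1 hb
      obtain ⟨hY, hg⟩ := List.mem_filter.1 hY
      have : X = Y := by rw [← hmod' X hX, ← hmod Y hY, hXY]
      subst this
      rw [if_pos (by simpa using hg), Nat.or_two_pow_eq_add_of_lt (hlt X hX)] at hXY
      have : 0 < 2 ^ u := by positivity
      omega

/-- Every partial set has an extension, so there are no dead ends and the work at each stage is
bounded by the final number of dominating sets. -/
theorem length_dominatingList_le {u w : ℕ} (h : u ≤ w) :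
    (G.dominatingList u).length ≤ (G.dominatingList w).length := by
  induction h with
  | refl => rfl
  | step _ ih =>
    refine ih.trans ?_
    simp [dominatingList]

/-- At `u = n` all closed neighbourhoods are complete, so the partial condition becomes domination.
-/
theorem toFinset_dominatingList : (G.dominatingList n).toFinset = G.dominatingMasks := by
  ext X
  rw [List.mem_toFinset, mem_dominatingList, mem_dominatingMasks]
  simp only [DominatingMask, DominatesBelow, G.nbhdMask_lt, forall_const]

theorem length_dominatingList : (G.dominatingList n).length = G.dominatingMasks.card := by
  rw [← toFinset_dominatingList, List.toFinset_card_of_nodup (G.nodup_dominatingList n)]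

theorem sum_dominatingList (f : ℕ → ℕ) :
    ((G.dominatingList n).map f).sum = ∑ X ∈ G.dominatingMasks, f X := by
  rw [← toFinset_dominatingList, List.sum_toFinset _ (G.nodup_dominatingList n)]

end SimpleGraph

/-! ### Counting dominating sets -/

namespace Finset
variable {V ι : Type*} [DecidableEq V] [DecidableEq ι]

/-- The number of sets that meet all of the given disjoint small blocks. -/
theorem card_meets_mul_le [Fintype V] (B : ι → Finset V) (s : ℕ) (I : Finset ι)
    (hs : ∀ i ∈ I, (B i).card ≤ s) (hd : (I : Set ι).PairwiseDisjoint B) :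
    (univ.filter fun X : Finset V => ∀ i ∈ I, ∃ w ∈ B i, w ∈ X).card * (2 ^ s) ^ I.card ≤
      2 ^ Fintype.card V * (2 ^ s - 1) ^ I.card := by
  induction I using Finset.induction_on with
  | empty => simp
  | insert v I hv ih =>
    have ih := ih (fun i hi => hs i (mem_insert_of_mem hi)) (hd.subset (by simp))
    set H := univ.filter fun X : Finset V => ∀ i ∈ I, ∃ w ∈ B i, w ∈ X with hH
    set H' := univ.filter fun X : Finset V => ∀ i ∈ insert v I, ∃ w ∈ B i, w ∈ X with hH'
    set H₀ := H.filter fun X => ¬ ∃ w ∈ B v, w ∈ X with hH₀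
    have h₁ : H'.card + H₀.card = H.card := by
      rw [← card_filter_add_card_filter_not (s := H) fun X => ∃ w ∈ B v, w ∈ X]
      congr 2
      ext X
      simp [H, H', and_comm]
    -- Deleting the block `B v` maps `H` into the sets that miss it; the other blocks are still met
    -- because they are disjoint from `B v`. A fibre is determined by the intersection with `B v`,
    -- which has at most `2 ^ s` values. So at least a fraction `1 / 2 ^ s` of `H` is lost.
    have h₂ : H.card ≤ 2 ^ s * H₀.card := by
      refine card_le_mul_card_image_of_maps_to (f := fun X => X \ B v) ?_ _ ?_
      · intro X hX
        simp only [H₀, H, mem_filter, mem_univ, true_and, mem_sdiff] at hX ⊢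
        refine ⟨fun i hi => ?_, fun ⟨w, hw, hwX⟩ => hwX.2 hw⟩
        obtain ⟨w, hw, hwX⟩ := hX i hi
        refine ⟨w, hw, hwX, fun hwv => ?_⟩
        have := hd (mem_coe.2 (mem_insert_of_mem hi)) (mem_coe.2 (mem_insert_self v I))
          (by rintro rfl; exact hv hi)
        exact disjoint_left.1 this hw hwv
      · intro Y _
        calc _ ≤ ((B v).powerset).card := by
              refine card_le_card_of_injOn (fun X => X ∩ B v) ?_ ?_
              · intro X _
                simp
              · intro X hX X' hX' h
                simp only [coe_filter, Set.mem_ofPred_eq] at hX hX' h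
                rw [← sdiff_union_inter X (B v), ← sdiff_union_inter X' (B v), hX.2, hX'.2, h]
          _ ≤ 2 ^ s := by
              rw [card_powerset]
              exact Nat.pow_le_pow_right (by simp) (hs v (mem_insert_self v I))
    have h₃ : H'.card * 2 ^ s ≤ H.card * (2 ^ s - 1) := by
      rw [Nat.mul_sub_one, ← h₁, add_mul]
      have : H₀.card * 2 ^ s = 2 ^ s * H₀.card := mul_comm _ _
      omega
    rw [card_insert_of_notMem hv, pow_succ, pow_succ]
    calc H'.card * ((2 ^ s) ^ I.card * 2 ^ s) = H'.card * 2 ^ s * (2 ^ s) ^ I.card := by ring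
      _ ≤ H.card * (2 ^ s - 1) * (2 ^ s) ^ I.card := Nat.mul_le_mul_right _ h₃
      _ = H.card * (2 ^ s) ^ I.card * (2 ^ s - 1) := by ring
      _ ≤ 2 ^ Fintype.card V * (2 ^ s - 1) ^ I.card * (2 ^ s - 1) := Nat.mul_le_mul_right _ ih
      _ = _ := by ring

/-- A set in which every element conflicts with few others has a large conflict-free subset. -/
theorem exists_conflict_free (U : Finset V) (c : V → V → Prop) (hc : ∀ v, c v v)
    (hsymm : ∀ u v, c u v → c v u) [DecidableRel c] (K : ℕ)
    (hK : ∀ v ∈ U, (U.filter (c v)).card ≤ K) :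
    ∃ I ⊆ U, (I : Set V).Pairwise (fun u v => ¬ c u v) ∧ U.card ≤ I.card * K := by
  classical
  -- By maximality of `I`, every element of `U` conflicts with a member of `I`; so `U` is covered by
  -- `I.card` sets of size at most `K`.
  obtain ⟨I, -, hI⟩ := exists_le_maximal (a := (∅ : Finset V))
    (s := U.powerset.filter fun I : Finset V => (I : Set V).Pairwise fun u v => ¬ c u v) (by simp)
  have hI' : I ⊆ U ∧ (I : Set V).Pairwise fun u v => ¬ c u v := by simpa using hI.prop
  refine ⟨I, hI'.1, hI'.2, ?_⟩
  calc U.card ≤ (I.biUnion fun v => U.filter (c v)).card := by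
        refine card_le_card fun u hu => ?_
        by_contra hn
        simp only [mem_biUnion, mem_filter, not_exists, not_and] at hn
        have : insert u I ≤ I := by
          refine hI.le_of_ge ?_ (subset_insert u I)
          simp only [mem_filter, mem_powerset, insert_subset_iff, hu, hI'.1, true_and,
            coe_insert]
          refine hI'.2.insert fun v hv _ => ⟨fun h => ?_, fun h => ?_⟩
          · exact hn v hv hu (hsymm _ _ h)
          · exact hn v hv hu h
        exact hn u (this (mem_insert_self u I)) hu (hc u)
    _ ≤ I.card * K := card_biUnion_le_card_mul _ _ _ fun v hv => hK v (hI'.1 hv)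

end Finset

namespace SimpleGraph
variable {V : Type*} [Fintype V] [DecidableEq V]

open Classical in
/-- If every vertex has few neighbours in a large set `U`, then `U` has a large subset of vertices
with disjoint small closed neighbourhoods. -/
theorem exists_disjoint_neighbourhoods (G : SimpleGraph V) (q : ℕ) (hq : 0 < q) (U : Finset V)
    (hU : Fintype.card V < 2 * q * U.card)
    (hG : ∀ v, (U.filter (G.Adj v)).card < 2 * q) :
    ∃ I : Finset V, Fintype.card V ≤ 8 * q ^ 2 * (8 * q ^ 2 + 1) * I.card ∧
      (∀ v ∈ I, (Finset.univ.filter fun w => w = v ∨ G.Adj v w).card ≤ 8 * q ^ 2 + 1) ∧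
      (I : Set V).PairwiseDisjoint fun v => Finset.univ.filter fun w => w = v ∨ G.Adj v w := by
  set N : V → Finset V := fun v => Finset.univ.filter fun w => w = v ∨ G.Adj v w with hN
  set D := 8 * q ^ 2 with hD
  have hNc : ∀ v, (N v).card ≤ (Finset.univ.filter (G.Adj v)).card + 1 := by
    intro v
    have : N v = insert v (Finset.univ.filter (G.Adj v)) := by
      ext w
      simp [N]
    rw [this]
    exact Finset.card_insert_le _ _
  -- Count the pairs of adjacent `u ∈ U` and `v` from the side of `v`, where each `v` has fewer than
  -- `2 * q` partners.
  have hsum : ∑ u ∈ U, (Finset.univ.filter (G.Adj u)).card ≤ 2 * q * Fintype.card V := by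
    have h := Finset.sum_card_bipartiteAbove_eq_sum_card_bipartiteBelow (s := U)
      (t := (Finset.univ : Finset V)) G.Adj
    simp only [Finset.bipartiteAbove, Finset.bipartiteBelow] at h
    rw [h, mul_comm]
    refine (Finset.sum_le_card_nsmul _ _ (2 * q) fun v _ => ?_).trans (by simp)
    simp_rw [G.adj_comm _ v]
    exact (hG v).le
  set L := U.filter fun u => (Finset.univ.filter (G.Adj u)).card ≤ D with hL
  have hhigh : (U.filter fun u => ¬ (Finset.univ.filter (G.Adj u)).card ≤ D).card * D ≤
      2 * q * Fintype.card V := by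
    refine le_trans ?_ hsum
    refine le_trans ?_ (Finset.sum_le_sum_of_subset (Finset.filter_subset
      (fun u => ¬ (Finset.univ.filter (G.Adj u)).card ≤ D) U))
    rw [← smul_eq_mul]
    exact Finset.card_nsmul_le_sum _ _ _ fun u hu => (not_le.1 (Finset.mem_filter.1 hu).2).le
  -- If more than half of `U` had degree above `8 * q ^ 2`, the degree sum would be at least `4 * q
  -- ^ 2 * U.card`, which exceeds `2 * q * Fintype.card V`.
  have hLc : U.card ≤ 2 * L.card := by
    have h := Finset.card_filter_add_card_filter_not (s := U)
      fun u => (Finset.univ.filter (G.Adj u)).card ≤ D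
    rw [← hL] at h
    set x := (U.filter fun u => ¬ (Finset.univ.filter (G.Adj u)).card ≤ D).card
    by_contra! hlt
    have h₁ : U.card ≤ 2 * x := by omega
    have h₂ : x * (8 * q ^ 2) ≤ 2 * q * Fintype.card V := hhigh
    have h₃ : 2 * q * Fintype.card V < 2 * q * (2 * q * U.card) :=
      Nat.mul_lt_mul_of_pos_left hU (by omega)
    have h₄ : 2 * q * (2 * q * U.card) ≤ 2 * q * (2 * q * (2 * x)) := by gcongr
    nlinarith
  -- A conflict between `v` and `u` passes through some `w ∈ N v`. There are at most `D + 1` such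
  -- `w`, and each accounts for at most `2 * q` vertices `u`: itself and its neighbours in `U`.
  obtain ⟨I, hIL, hI, hIc⟩ := L.exists_conflict_free (fun u v => ¬ Disjoint (N u) (N v))
    (fun v h => Finset.disjoint_left.1 h (by simp [N] : v ∈ N v) (by simp [N]))
    (fun u v h h' => h h'.symm) ((D + 1) * (2 * q)) (by
      intro v hv
      have hsub : L.filter (fun u => ¬ Disjoint (N v) (N u)) ⊆
          (N v).biUnion fun w => insert w (U.filter (G.Adj w)) := by
        intro u hu
        rw [Finset.mem_filter, Finset.not_disjoint_iff] at hu
        obtain ⟨huL, w, hw, hw'⟩ := hu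
        refine Finset.mem_biUnion.2 ⟨w, hw, ?_⟩
        simp only [N, Finset.mem_filter, Finset.mem_univ, true_and] at hw'
        rw [Finset.mem_insert, Finset.mem_filter]
        exact hw'.imp (fun h => h.symm) fun h => ⟨(Finset.mem_filter.1 huL).1, h.symm⟩
      refine (Finset.card_le_card hsub).trans ((Finset.card_biUnion_le_card_mul _ _ (2 * q)
        fun w _ => (Finset.card_insert_le _ _).trans (hG w)).trans ?_)
      exact Nat.mul_le_mul_right _ ((hNc v).trans (by
        have := (Finset.mem_filter.1 hv).2
        omega)))
  refine ⟨I, ?_, fun v hv => (hNc v).trans ?_, fun u hu v hv huv => ?_⟩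
  · calc Fintype.card V ≤ 2 * q * U.card := hU.le
      _ ≤ 2 * q * (2 * (I.card * ((D + 1) * (2 * q)))) := by
        gcongr
        exact hLc.trans (by gcongr)
      _ = _ := by rw [hD]; ring
  · have := (Finset.mem_filter.1 (hIL hv)).2
    omega
  · by_contra h
    exact hI hu hv huv h

open Classical in
/-- Graphs with a large set of vertices in which every vertex has few neighbours have few
dominating sets. -/
theorem card_dominates_le (G : SimpleGraph V) (q : ℕ) (hq : 0 < q) (U : Finset V)
    (hU : Fintype.card V < 2 * q * U.card)
    (hG : ∀ v, (U.filter (G.Adj v)).card < 2 * q) :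
    ∃ i, Fintype.card V ≤ 8 * q ^ 2 * (8 * q ^ 2 + 1) * i ∧
      (Finset.univ.filter fun X => G.Dominates X).card * (2 ^ (8 * q ^ 2 + 1)) ^ i ≤
        2 ^ Fintype.card V * (2 ^ (8 * q ^ 2 + 1) - 1) ^ i := by
  obtain ⟨I, hI, hs, hd⟩ := G.exists_disjoint_neighbourhoods q hq U hU hG
  refine ⟨I.card, hI, le_trans ?_ (Finset.card_meets_mul_le _ _ I hs hd)⟩
  gcongr with X
  intro hX v _
  obtain ⟨w, hw, h⟩ := hX v
  exact ⟨w, by simpa using h, hw⟩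

end SimpleGraph

/-! ### Truth values -/

open Classical in
/-- The truth value of a proposition, as a number. -/
noncomputable def truth (p : Prop) : ℕ := if p then 1 else 0

section truth
variable {p q : Prop}

@[simp] theorem truth_eq_zero : truth p = 0 ↔ ¬ p := by simp [truth]
@[simp] theorem truth_true : truth True = 1 := by simp [truth]
@[simp] theorem truth_false : truth False = 0 := by simp [truth]
theorem truth_of (h : p) : truth p = 1 := by simp [truth, h]
theorem truth_of_not (h : ¬ p) : truth p = 0 := by simp [truth, h]
theorem truth_le : truth p ≤ 1 := by unfold truth; split <;> simp
theorem truth_lt {W : ℕ} (hW : 1 < 2 ^ W) : truth p < 2 ^ W := truth_le.trans_lt hW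
theorem truth_congr (h : p ↔ q) : truth p = truth q := by rw [propext h]
theorem one_sub_truth : 1 - truth p = truth (¬ p) := by by_cases h : p <;> simp [truth, h]
theorem truth_mul : truth p * truth q = truth (p ∧ q) := by
  by_cases h : p <;> by_cases h' : q <;> simp [truth, h, h']
theorem truth_or : truth p ||| truth q = truth (p ∨ q) := by
  by_cases h : p <;> by_cases h' : q <;> simp [truth, h, h']
theorem truth_eq_ite [Decidable p] : truth p = if p then 1 else 0 := by
  by_cases h : p <;> simp [truth, h]
end truth

/-! ### Programs for the greedy choice of vertices. -/

namespace RAM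

/-- Sequential composition. -/
infixr:60 " ;; " => Program.seq

/-- The memory `m` holds the adjacency matrix of `G`. -/
structure HoldsGraph {n : ℕ} (G : SimpleGraph (Fin n)) (m : Mem) : Prop where
  size : m 0 0 = n
  adj : ∀ u < n, ∀ v < n, m 1 (u * n + v) = truth (G.NatAdj u v)

theorem HoldsGraph.congr {n : ℕ} {G : SimpleGraph (Fin n)} {m m' : Mem} (h : HoldsGraph G m)
    (h₀ : m' 0 = m 0) (h₁ : m' 1 = m 1) : HoldsGraph G m' :=
  ⟨by rw [h₀, h.size], by rw [h₁]; exact h.adj⟩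

/-! The banks that are used by the programs below. -/

/-- Marks of dominated vertices. -/
notation "bDom" => 2
/-- Marks of the vertices whose colors are guessed. -/
notation "bMark" => 3
/-- A counter. -/
notation "bCount" => 4
/-- A loop variable, usually a vertex. -/
notation "bV" => 5
/-- A loop variable, usually a vertex. -/
notation "bU" => 6
/-- A loop variable. -/
notation "bI" => 7

/-- The entry of the adjacency matrix for the vertices in the variables `bV` and `bU`. -/
def adjExpr : Expr := .load 1 (.var bV * .var 0 + .var bU)

theorem adjExpr_eval {n : ℕ} {G : SimpleGraph (Fin n)} {m : Mem} (h : HoldsGraph G m) {u v : ℕ}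
    (hv : v < n) (hu : u < n) (h₁ : m bV 0 = v) (h₂ : m bU 0 = u) :
    adjExpr.eval m = truth (G.NatAdj v u) := by
  simp [adjExpr, h₁, h₂, h.size, h.adj v hv u hu]

/-- Counts the undominated neighbours of the vertex in the variable `bV`. -/
def countUndominated : Program :=
  .store bCount (.const 0) (.const 0) ;;
  .forLoop bU (.var 0)
    (.store bCount (.const 0)
      (.var bCount + adjExpr * (.const 1 - .load bDom (.var bU))))

/-- Marks the neighbours of the vertex in the variable `bV` as dominated. -/
def markNeighbours : Program :=
  .forLoop bU (.var 0) (.store bDom (.var bU) (.load bDom (.var bU) ||| adjExpr))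

/-- Greedily chooses vertices that dominate at least `d` new vertices. -/
def greedy (d : ℕ) : Program :=
  .forLoop bV (.var 0)
    (countUndominated ;;
    .cond ((Expr.var bCount).ltTest (.const d)) .skip
      (.store bMark (.var bV) (.const 1) ;; markNeighbours))

section
variable {n W : ℕ} {G : SimpleGraph (Fin n)} {m : Mem}

open Classical in
theorem run_countUndominated (hG : HoldsGraph G m) (hW : n + 1 < 2 ^ W) {v : ℕ} (hv : v < n)
    (hmv : m bV 0 = v) (P : ℕ → Prop) (hP : ∀ u < n, m bDom u = truth (P u)) :
    Run W countUndominated m (3 + n * 3) fun m' =>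
      m' bCount 0 = ((Finset.range n).filter fun u => G.NatAdj v u ∧ ¬ P u).card := by
  refine (Run.store_seq (by simp) (Run.forLoop (s := 1) n (fun j m' =>
    m' bCount 0 = ((Finset.range j).filter fun u => G.NatAdj v u ∧ ¬ P u).card)
    (by omega) (by simp [Program.writes]) (by simp) ?_ ?_)).le (by omega)
  · intro j hj m' hf _
    simp [hf 0 (by simp [Program.writes]), hG.size]
  · intro j hj m' hf hij hI
    have hG' : HoldsGraph G m' := hG.congr (by simp [hf 0 (by simp [Program.writes])])
      (by simp [hf 1 (by simp [Program.writes])])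
    have hv' : m' bV 0 = v := by simp [hf bV (by simp [Program.writes]), hmv]
    have hd : m' bDom = m bDom := by simp [hf bDom (by simp [Program.writes])]
    have he : (Expr.var bCount + adjExpr * (.const 1 - .load bDom (.var bU))).eval m' =
        ((Finset.range (j + 1)).filter fun u => G.NatAdj v u ∧ ¬ P u).card := by
      simp only [Expr.eval_add, Expr.eval_mul, adjExpr_eval hG' hv hj hv' hij, Expr.eval_sub,
        Expr.eval_load, Expr.eval_var, hij, hd, hP j hj, Expr.eval_const, one_sub_truth, truth_mul,
        hI]
      rw [Finset.range_add_one, Finset.filter_insert]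
      split_ifs with h
      · rw [Finset.card_insert_of_notMem (by simp), truth_of h]
      · rw [truth_of_not h, add_zero]
    refine Run.store ?_ ?_
    · rw [he]
      refine lt_of_le_of_lt (Finset.card_filter_le _ _) ?_
      simp
      omega
    · simp [he]

theorem run_markNeighbours (hG : HoldsGraph G m) (hW : n + 1 < 2 ^ W) {v : ℕ} (hv : v < n)
    (hmv : m bV 0 = v) (P : ℕ → Prop) (hP : ∀ u < n, m bDom u = truth (P u)) :
    Run W markNeighbours m (2 + n * 3) fun m' =>
      ∀ u < n, m' bDom u = truth (P u ∨ G.NatAdj v u) := by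
  refine (Run.forLoop (s := 1) n (fun j m' =>
    ∀ u < n, m' bDom u = truth (P u ∨ (u < j ∧ G.NatAdj v u)))
    (by omega) (by simp [Program.writes]) (by simpa using hP) ?_ ?_).mono (by omega) ?_
  · intro j hj m' hf _
    simp [hf 0 (by simp [Program.writes]), hG.size]
  · intro j hj m' hf hij hI
    have hG' : HoldsGraph G m' := hG.congr (by simp [hf 0 (by simp [Program.writes])])
      (by simp [hf 1 (by simp [Program.writes])])
    have hv' : m' bV 0 = v := by simp [hf bV (by simp [Program.writes]), hmv]
    have he : (Expr.load bDom (.var bU) ||| adjExpr).eval m' = truth (P j ∨ G.NatAdj v j) := by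
      simp only [Expr.eval_or, adjExpr_eval hG' hv hj hv' hij, Expr.eval_load, Expr.eval_var, hij,
        hI j hj, truth_or]
      exact truth_congr (by simp)
    refine Run.store ?_ ?_
    · rw [he]
      exact truth_lt (by omega)
    · intro u hu
      simp only [he, Mem.write_of_ne _ _ _ (by simp : bDom ≠ bU), Mem.write_self, Expr.eval_var,
        hij, Function.update_apply]
      split_ifs with h
      · subst h
        exact truth_congr (by simp)
      · rw [hI u hu]
        refine truth_congr (or_congr_right (and_congr_left fun _ => ?_))
        omega
  · intro m' _ h u hu
    rw [h u hu]
    exact truth_congr (by simp [hu])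

end

end RAM

/-! ### What the greedy choice achieves. -/

namespace SimpleGraph
variable {n : ℕ} (G : SimpleGraph (Fin n))

/-- The vertex `u` has a neighbour in `S`. -/
def NatDominated (S : Finset ℕ) (u : ℕ) : Prop := ∃ s ∈ S, G.NatAdj s u

/-- The graph has few dominating sets. -/
def FewDominating (q : ℕ) : Prop :=
  ∃ i, n ≤ 8 * q ^ 2 * (8 * q ^ 2 + 1) * i ∧
    G.dominatingMasks.card * (2 ^ (8 * q ^ 2 + 1)) ^ i ≤ 2 ^ n * (2 ^ (8 * q ^ 2 + 1) - 1) ^ i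

open Classical in
/-- The possible outcomes of the greedy choice among the first `j` vertices: every chosen vertex
dominates `d` new vertices, and every other one has less than `d` undominated neighbours. -/
def IsGreedy (d j : ℕ) (S : Finset ℕ) : Prop :=
  S ⊆ Finset.range j ∧
  d * S.card ≤ ((Finset.range n).filter (G.NatDominated S)).card ∧
  ∀ v < j, ((Finset.range n).filter fun u => G.NatAdj v u ∧ ¬ G.NatDominated S u).card < d

variable {G}

open Classical in
theorem IsGreedy.keep {d j : ℕ} {S : Finset ℕ} (h : G.IsGreedy d j S)
    (hj : ((Finset.range n).filter fun u => G.NatAdj j u ∧ ¬ G.NatDominated S u).card < d) :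
    G.IsGreedy d (j + 1) S := by
  refine ⟨h.1.trans (Finset.range_mono (by simp)), h.2.1, fun v hv => ?_⟩
  rcases Nat.lt_succ_iff_lt_or_eq.1 hv with hv | rfl
  · exact h.2.2 v hv
  · exact hj

theorem natDominated_insert {S : Finset ℕ} {j u : ℕ} :
    G.NatDominated (insert j S) u ↔ G.NatDominated S u ∨ G.NatAdj j u := by
  simp [NatDominated, or_comm]

-- The vertices newly dominated by `j` are disjoint from those dominated before, so the count grows
-- by `d`. The undominated neighbours of earlier vertices only become fewer, and `j` itself has none
-- left.
open Classical in
theorem IsGreedy.insert {d j : ℕ} {S : Finset ℕ} (hd : 0 < d) (h : G.IsGreedy d j S)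
    (hj : d ≤ ((Finset.range n).filter fun u => G.NatAdj j u ∧ ¬ G.NatDominated S u).card) :
    G.IsGreedy d (j + 1) (insert j S) := by
  refine ⟨?_, ?_, fun v hv => ?_⟩
  · rw [Finset.insert_subset_iff]
    exact ⟨by simp, h.1.trans (Finset.range_mono (by simp))⟩
  · have hdisj : Disjoint ((Finset.range n).filter (G.NatDominated S))
        ((Finset.range n).filter fun u => G.NatAdj j u ∧ ¬ G.NatDominated S u) := by
      rw [Finset.disjoint_filter]
      exact fun u _ h h' => h'.2 h
    rw [Finset.card_insert_of_notMem fun hS => by simpa using h.1 hS, mul_add, mul_one]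
    refine (add_le_add h.2.1 hj).trans ?_
    rw [← Finset.card_union_of_disjoint hdisj, ← Finset.filter_or]
    refine Finset.card_le_card (Finset.monotone_filter_right _ fun u _ hu => ?_)
    exact natDominated_insert.2 (hu.imp_right fun h => h.1)
  · rcases Nat.lt_succ_iff_lt_or_eq.1 hv with hv | rfl
    · refine lt_of_le_of_lt (Finset.card_le_card ?_) (h.2.2 v hv)
      exact Finset.monotone_filter_right _ fun u _ hu =>
        ⟨hu.1, fun h => hu.2 (natDominated_insert.2 (Or.inl h))⟩
    · rw [Finset.filter_false_of_mem]
      · simpa using hd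
      · exact fun u _ hu => hu.2 (natDominated_insert.2 (Or.inr hu.1))

theorem card_dominatingMasks [DecidablePred G.Dominates] : G.dominatingMasks.card =
    (Finset.univ.filter fun X : Finset (Fin n) => G.Dominates X).card := by
  classical
  rw [Finset.card_eq_sum_ones (Finset.univ.filter _), sum_maskSet, ← Finset.card_eq_sum_ones]
  congr 1
  ext X
  simp [mem_dominatingMasks, dominates_maskSet]

/-- If the greedy choice leaves many vertices undominated, then there are few dominating sets. -/
theorem IsGreedy.fewDominating {q : ℕ} (hq : 0 < q) {S S' : Finset ℕ}
    (h : G.IsGreedy (2 * q) n S)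
    (hS' : ∀ u, u ∈ S' ↔ u < n ∧ (u ∈ S ∨ ¬ G.NatDominated S u)) (hn : n < q * S'.card) :
    G.FewDominating q := by
  classical
  obtain ⟨hSn, hc, hd⟩ := h
  set U : Finset (Fin n) := Finset.univ.filter fun u => ¬ G.NatDominated S u with hU
  have hUm : U.map Fin.valEmbedding = (Finset.range n).filter fun u => ¬ G.NatDominated S u := by
    ext u
    simp only [U, Finset.mem_map, Finset.mem_filter, Finset.mem_univ, true_and,
      Fin.valEmbedding_apply, Finset.mem_range]
    exact ⟨by rintro ⟨u, h, rfl⟩; exact ⟨u.2, h⟩, fun h => ⟨⟨u, h.1⟩, h.2, rfl⟩⟩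
  have hSU : S'.card ≤ S.card + U.card := by
    rw [← U.card_map Fin.valEmbedding, hUm]
    refine (Finset.card_le_card fun u hu => ?_).trans (Finset.card_union_le _ _)
    have := (hS' u).1 hu
    simpa using this.2.imp_right fun h => ⟨this.1, h⟩
  -- The chosen vertices use up at most half of the threshold `n / q`, so the undominated ones
  -- exceed the other half.
  have hSc : 2 * q * S.card ≤ n := hc.trans ((Finset.card_filter_le _ _).trans (by simp))
  have hbig : Fintype.card (Fin n) < 2 * q * U.card := by
    have := Nat.mul_le_mul_left q hSU
    rw [Fintype.card_fin]
    nlinarith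
  obtain ⟨i, h₁, h₂⟩ := G.card_dominates_le q hq U hbig fun v => by
    refine lt_of_eq_of_lt ?_ (hd v v.2)
    rw [← Finset.card_map Fin.valEmbedding]
    congr 1
    ext u
    simp only [U, Finset.mem_map, Finset.mem_filter, Finset.mem_univ, true_and,
      Fin.valEmbedding_apply, Finset.mem_range]
    constructor
    · rintro ⟨u, ⟨h₁, h₂⟩, rfl⟩
      exact ⟨u.2, by simpa using h₂, h₁⟩
    · rintro ⟨hu, h₁, h₂⟩
      exact ⟨⟨u, hu⟩, ⟨h₂, h₁.2.2⟩, rfl⟩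
  rw [Fintype.card_fin] at h₁ h₂
  refine ⟨i, h₁, ?_⟩
  rw [card_dominatingMasks]
  exact h₂

end SimpleGraph

/-! ### Correctness of the greedy programs. -/

namespace RAM
variable {n W : ℕ} {G : SimpleGraph (Fin n)} {m : Mem}

theorem run_greedy (hG : HoldsGraph G m) (hW : n + 1 < 2 ^ W) {d : ℕ} (hd : 0 < d)
    (hmark : m bMark = 0) (hdom : m bDom = 0) :
    Run W (greedy d) m (2 + n * (n * 6 + 10)) fun m' => ∃ S, G.IsGreedy d n S ∧
      (∀ u < n, m' bMark u = truth (u ∈ S)) ∧ ∀ u < n, m' bDom u = truth (G.NatDominated S u) := by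
  classical
  refine (Run.forLoop (s := (3 + n * 3) + (1 + (1 + (2 + n * 3)))) n (fun j m' =>
    ∃ S, G.IsGreedy d j S ∧
      (∀ u < n, m' bMark u = truth (u ∈ S)) ∧ ∀ u < n, m' bDom u = truth (G.NatDominated S u))
    (by omega) ?_ ?_ ?_ ?_).le ?_
  · simp [Program.writes, countUndominated, markNeighbours]
  · exact ⟨∅, ⟨by simp, by simp, by simp⟩, by simp [hmark],
      by simp [hdom, SimpleGraph.NatDominated]⟩
  · intro j hj m' hf _
    simp [hf 0 (by simp [Program.writes, countUndominated, markNeighbours]), hG.size]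
  · rintro j hj m' hf hij ⟨S, hS, hm, hD⟩
    have hG' : HoldsGraph G m' := hG.congr
      (hf 0 (by simp [Program.writes, countUndominated, markNeighbours]))
      (hf 1 (by simp [Program.writes, countUndominated, markNeighbours]))
    refine Run.seq ((run_countUndominated hG' hW hj hij _ hD).mono le_rfl fun m₁ hf₁ hc hf₁' =>
      Run.cond ?_ ?_)
    all_goals
      have h0 := hf₁ 0 (by simp [Program.writes, countUndominated])
      have h1 := hf₁ 1 (by simp [Program.writes, countUndominated])
      have h2 := hf₁ bDom (by simp [Program.writes, countUndominated])
      have h3 := hf₁ bMark (by simp [Program.writes, countUndominated])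
      have h5 := hf₁ bV (by simp [Program.writes, countUndominated])
    · intro hlt
      refine (Run.skip ?_).le (by omega)
      rw [Expr.eval_ltTest, Expr.eval_var, Expr.eval_const, hc] at hlt
      exact ⟨S, hS.keep (by simpa using hlt), by simpa [h3] using hm, by simpa [h2] using hD⟩
    · intro hlt
      rw [Expr.eval_ltTest, Expr.eval_var, Expr.eval_const, hc] at hlt
      refine Run.store_seq (by rw [Expr.eval_const]; omega) ?_
      refine (run_markNeighbours (hG'.congr (by simp [h0]) (by simp [h1])) hW hj
        (by simp [h5, hij]) (G.NatDominated S) (by simpa [h2] using hD)).mono le_rfl ?_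
      intro m₂ hf₂ hD₂
      have hm₂ := hf₂ bMark (by simp [Program.writes, markNeighbours])
      refine ⟨insert j S, hS.insert hd (by simpa using hlt), ?_, ?_⟩
      · intro u hu
        simp only [Mem.write_of_ne _ _ _ (by simp : bMark ≠ bV), hm₂, Mem.write_self,
          Expr.eval_var, h5, hij, Expr.eval_const, Function.update_apply, h3]
        split_ifs with hu'
        · rw [truth_of (by simp [hu'])]
        · rw [hm u hu]
          exact truth_congr (by simp [hu'])
      · intro u hu
        rw [Mem.write_of_ne _ _ _ (by simp : bDom ≠ bV), hD₂ u hu]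
        exact truth_congr SimpleGraph.natDominated_insert.symm
  · exact Nat.add_le_add_left (Nat.mul_le_mul_left _ (by omega)) _

/-- Adds the undominated vertices to the marked vertices, and counts the marked vertices. -/
def markUndominated : Program :=
  .store bCount (.const 0) (.const 0) ;;
  .forLoop bV (.var 0)
    (.store bMark (.var bV) (.load bMark (.var bV) ||| (.const 1 - .load bDom (.var bV))) ;;
    .store bCount (.const 0) (.var bCount + .load bMark (.var bV)))

theorem run_markUndominated (hG : HoldsGraph G m) (hW : n + 1 < 2 ^ W) (P Q : ℕ → Prop)
    (hP : ∀ u < n, m bMark u = truth (P u)) (hQ : ∀ u < n, m bDom u = truth (Q u)) :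
    Run W markUndominated m (3 + n * 4) fun m' => ∃ S : Finset ℕ,
      (∀ u, u ∈ S ↔ u < n ∧ (P u ∨ ¬ Q u)) ∧
      (∀ u < n, m' bMark u = truth (u ∈ S)) ∧ m' bCount 0 = S.card := by
  classical
  refine (Run.store_seq (by simp) (Run.forLoop (s := 2) n (fun j m' =>
    (∀ u < n, m' bMark u = truth (P u ∨ (u < j ∧ ¬ Q u))) ∧
    m' bCount 0 = ((Finset.range j).filter fun u => P u ∨ ¬ Q u).card)
    (by omega) (by simp [Program.writes]) (by simpa using hP) ?_ ?_)).mono (by omega) ?_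
  · intro j hj m' hf _
    simp [hf 0 (by simp [Program.writes]), hG.size]
  · rintro j hj m' hf hij ⟨hm, hc⟩
    have hd : m' bDom = m bDom := by simp [hf bDom (by simp [Program.writes])]
    have he : (Expr.load bMark (.var bV) ||| (.const 1 - .load bDom (.var bV))).eval m' =
        truth (P j ∨ ¬ Q j) := by
      simp only [Expr.eval_or, Expr.eval_load, Expr.eval_var, Expr.eval_sub, Expr.eval_const, hij,
        hm j hj, hd, hQ j hj, one_sub_truth, truth_or]
      exact truth_congr (by simp)
    have hcard : ((Finset.range (j + 1)).filter fun u => P u ∨ ¬ Q u).card =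
        ((Finset.range j).filter fun u => P u ∨ ¬ Q u).card + truth (P j ∨ ¬ Q j) := by
      rw [Finset.range_add_one, Finset.filter_insert]
      split_ifs with h
      · rw [Finset.card_insert_of_notMem (by simp), truth_of h]
      · rw [truth_of_not h, add_zero]
    have hle : ((Finset.range (j + 1)).filter fun u => P u ∨ ¬ Q u).card ≤ j + 1 :=
      (Finset.card_filter_le _ _).trans (by simp)
    refine Run.store_seq ?_ (Run.store ?_ ⟨?_, ?_⟩)
    · rw [he]
      exact truth_lt (by omega)
    · simp [he, hij, hc]
      omega
    · intro u hu
      simp only [Mem.write_of_ne _ _ _ (by simp : bMark ≠ bV),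
        Mem.write_of_ne _ _ _ (by simp : bMark ≠ bCount), Mem.write_self, he, Expr.eval_var, hij,
        Function.update_apply]
      split_ifs with h
      · subst h
        exact truth_congr (by simp)
      · rw [hm u hu]
        refine truth_congr (or_congr_right (and_congr_left fun _ => ?_))
        omega
    · simp [he, hij, hc, hcard]
  · rintro m' - ⟨hm, hc⟩
    refine ⟨(Finset.range n).filter fun u => P u ∨ ¬ Q u, by simp, fun u hu => ?_, hc⟩
    rw [hm u hu]
    exact truth_congr (by simp [hu])

/-- Chooses the vertices whose colors are guessed. -/
def chooseVertices (q : ℕ) : Program := greedy (2 * q) ;; markUndominated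

/-- The marked set consists of the greedily chosen vertices and all vertices without a chosen
neighbour, so every unmarked vertex has a marked neighbour. If the set is too large for guessing,
the greedy condition yields few dominating sets. -/
theorem run_chooseVertices (hG : HoldsGraph G m) (hW : n + 1 < 2 ^ W) {q : ℕ} (hq : 0 < q)
    (hmark : m bMark = 0) (hdom : m bDom = 0) :
    Run W (chooseVertices q) m (5 + n * (n * 6 + 14)) fun m' => ∃ S : Finset ℕ,
      S ⊆ Finset.range n ∧ (∀ u < n, m' bMark u = truth (u ∈ S)) ∧ m' bCount 0 = S.card ∧
      (∀ u < n, u ∉ S → ∃ s ∈ S, G.NatAdj u s) ∧ (q * S.card ≤ n ∨ G.FewDominating q) := by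
  refine (Run.seq ((run_greedy hG hW (d := 2 * q) (by omega) hmark hdom).mono le_rfl
    (Q' := fun m₁ => (∀ b ∉ (greedy (2 * q)).writes, m₁ b = m b) →
      Run W markUndominated m₁ (3 + n * 4) _) ?_)).le ?_
  · rintro m₁ hf ⟨S, hS, hm, hD⟩ -
    have h0 := hf 0 (by simp [greedy, Program.writes, countUndominated, markNeighbours])
    have h1 := hf 1 (by simp [greedy, Program.writes, countUndominated, markNeighbours])
    refine (run_markUndominated (hG.congr h0 h1) hW _ _ hm hD).mono le_rfl ?_
    rintro m₂ - ⟨S', hS', hm', hc⟩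
    refine ⟨S', fun u hu => ?_, hm', hc, fun u hu hu' => ?_, ?_⟩
    · simpa using ((hS' u).1 hu).1
    · rw [hS'] at hu'
      have hdom : G.NatDominated S u := by
        by_contra h
        exact hu' ⟨hu, Or.inr h⟩
      obtain ⟨s, hs, hadj⟩ := hdom
      exact ⟨s, (hS' s).2 ⟨by simpa using hS.1 hs, Or.inl hs⟩, hadj.symm⟩
    · by_cases h : q * S'.card ≤ n
      · exact Or.inl h
      · exact Or.inr (hS.fewDominating hq hS' (not_le.1 h))
  · nlinarith

end RAM

/-! ### Memory layout and number sizes for inclusion-exclusion. -/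

namespace RAM
variable {n W : ℕ} {G : SimpleGraph (Fin n)} {m : Mem}

/-- The bit masks of the closed neighbourhoods. -/
notation "bNbhd" => 8
/-- A power of two. -/
notation "bPow" => 9
/-- The list of dominating sets. -/
notation "bList" => 10
/-- The length of the list. -/
notation "bLen" => 11
/-- The length of the list at the beginning of a loop. -/
notation "bBound" => 12
/-- A bit mask. -/
notation "bX" => 13
/-- An auxiliary number. -/
notation "bFlag" => 14

theorem lt_two_pow_of_add_two_le (hW : n + 2 ≤ W) : n + 1 < 2 ^ W :=
  calc n + 1 < W := by omega
    _ < 2 ^ W := Nat.lt_two_pow_self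

theorem two_pow_lt_of_le {j : ℕ} (hW : n + 2 ≤ W) (hj : j ≤ n + 1) : 2 ^ j < 2 ^ W :=
  Nat.pow_lt_pow_right (by simp) (by omega)

theorem one_lt_two_pow_of (hW : n + 2 ≤ W) : 1 < 2 ^ W := Nat.one_lt_two_pow (by omega)

theorem nbhdMask_lt_two_pow (hW : n + 2 ≤ W) (v : ℕ) : G.nbhdMask v < 2 ^ W :=
  (G.nbhdMask_lt v).trans (two_pow_lt_of_le hW (by omega))

/-! ### The masks of the neighbourhoods -/

/-- Computes the mask of the closed neighbourhood of the vertex in the variable `bV`. -/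
def computeMask : Program :=
  .store bPow (.const 0) (.const 1) ;;
  .store bX (.const 0) (.const 0) ;;
  .forLoop bU (.var 0)
    (.cond (adjExpr + (Expr.var bU).eqTest (.var bV))
      (.store bX (.const 0) (.var bX ||| .var bPow)) .skip ;;
    .store bPow (.const 0) (.var bPow + .var bPow))

theorem run_computeMask (hG : HoldsGraph G m) (hW : n + 2 ≤ W) {v : ℕ} (hv : v < n)
    (hmv : m bV 0 = v) :
    Run W computeMask m (4 + n * 5) fun m' => m' bX 0 = G.nbhdMask v := by
  have hn := lt_two_pow_of_add_two_le hW
  refine (Run.store_seq (one_lt_two_pow_of hW) (Run.store_seq (by simp)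
    (Run.forLoop (s := 3) n (fun j m' => m' bPow 0 = 2 ^ j ∧
      ∀ i, (m' bX 0).testBit i ↔ i < j ∧ (i = v ∨ G.NatAdj v i))
    (by omega) (by simp [Program.writes]) (by simp) ?_ ?_))).mono (by omega) ?_
  · intro j hj m' hf _
    simp [hf 0 (by simp [Program.writes]), hG.size]
  · rintro j hj m' hf hij ⟨hp, hx⟩
    have hG' : HoldsGraph G m' := hG.congr (by simp [hf 0 (by simp [Program.writes])])
      (by simp [hf 1 (by simp [Program.writes])])
    have hv' : m' bV 0 = v := by simp [hf bV (by simp [Program.writes]), hmv]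
    have hxlt : m' bX 0 < 2 ^ j := Nat.lt_pow_two_of_testBit _ fun i hi => by
      have := hx i
      simpa [not_lt.2 hi] using this
    refine (Run.seq (s₁ := 2) (s₂ := 1) (Run.cond (s := 1) ?_ ?_)).le (by omega)
    · intro hc
      refine Run.store ?_ fun _ => Run.store ?_ ⟨?_, fun i => ?_⟩
      · simp only [Expr.eval_or, Expr.eval_var, hp]
        exact Nat.or_lt_two_pow (hxlt.trans (two_pow_lt_of_le hW (by omega)))
          (two_pow_lt_of_le hW (by omega))
      · simp only [Expr.eval_add, Expr.eval_var, ne_eq, Nat.reduceEqDiff,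
          not_false_eq_true, Mem.write_of_ne, hp, ← two_mul, ← pow_succ']
        exact two_pow_lt_of_le hW (by omega)
      · simp [hp, pow_succ, mul_two]
      · simp only [Expr.eval_add, adjExpr_eval hG' hv hj hv' hij, Expr.eval_eqTest, Expr.eval_var,
          hij, hv'] at hc
        have hc' : j = v ∨ G.NatAdj v j := by
          by_contra h
          rw [not_or] at h
          simp [h.1, truth_of_not h.2] at hc
        simp only [Expr.eval_or, Expr.eval_var, Expr.eval_const, hp, ne_eq, Nat.reduceEqDiff, not_false_eq_true, Mem.write_of_ne, Mem.write_self,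
          Function.update_self, Nat.testBit_or, Nat.testBit_two_pow, Bool.or_eq_true, hx,
          decide_eq_true_eq]
        constructor
        · rintro (h | rfl)
          · exact ⟨by omega, h.2⟩
          · exact ⟨by omega, hc'⟩
        · rintro ⟨h₁, h₂⟩
          rcases Nat.lt_succ_iff_lt_or_eq.1 h₁ with h | h
          · exact Or.inl ⟨h, h₂⟩
          · exact Or.inr h.symm
    · intro hc
      refine Run.skip fun _ => Run.store ?_ ⟨?_, fun i => ?_⟩
      · simp only [Expr.eval_add, Expr.eval_var, hp, ← two_mul, ← pow_succ']
        exact two_pow_lt_of_le hW (by omega)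
      · simp [hp, pow_succ, mul_two]
      · simp only [Expr.eval_add, adjExpr_eval hG' hv hj hv' hij, Expr.eval_eqTest, Expr.eval_var,
          hij, hv', Nat.add_eq_zero_iff, truth_eq_zero, ite_eq_right_iff, one_ne_zero, imp_false]
          at hc
        simp only [ne_eq, Nat.reduceEqDiff, not_false_eq_true,
          Mem.write_of_ne, hx]
        refine ⟨fun h => ⟨by omega, h.2⟩, fun ⟨h₁, h₂⟩ => ⟨?_, h₂⟩⟩
        rcases Nat.lt_succ_iff_lt_or_eq.1 h₁ with h | rfl
        · exact h
        · exact absurd h₂ (by simp [hc.1, hc.2])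
  · rintro m' - ⟨-, hx⟩
    refine Nat.eq_of_testBit_eq fun i => Bool.eq_iff_iff.2 ?_
    rw [hx, G.testBit_nbhdMask]

/-- Computes the masks of all closed neighbourhoods. -/
def computeMasks : Program :=
  .forLoop bV (.var 0) (computeMask ;; .store bNbhd (.var bV) (.var bX))

theorem run_computeMasks (hG : HoldsGraph G m) (hW : n + 2 ≤ W) :
    Run W computeMasks m (2 + n * (n * 5 + 7)) fun m' => ∀ v < n, m' bNbhd v = G.nbhdMask v := by
  have hn := lt_two_pow_of_add_two_le hW
  refine (Run.forLoop (s := (4 + n * 5) + 1) n (fun j m' => ∀ v < j, m' bNbhd v = G.nbhdMask v)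
    (by omega) (by simp [Program.writes, computeMask]) (by simp) ?_ ?_).le
    (Nat.add_le_add_left (Nat.mul_le_mul_left _ (by omega)) _)
  · intro j hj m' hf _
    simp [hf 0 (by simp [Program.writes, computeMask]), hG.size]
  · intro j hj m' hf hij hI
    have hG' : HoldsGraph G m' := hG.congr
      (by simp [hf 0 (by simp [Program.writes, computeMask])])
      (by simp [hf 1 (by simp [Program.writes, computeMask])])
    refine Run.seq ((run_computeMask hG' hW hj hij).mono le_rfl fun m₁ hf₁ hx _ => Run.store ?_ ?_)
    · rw [Expr.eval_var, hx]
      exact nbhdMask_lt_two_pow hW _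
    · intro v hv
      have h5 := hf₁ bV (by simp [Program.writes, computeMask])
      have h8 := hf₁ bNbhd (by simp [Program.writes, computeMask])
      simp only [Expr.eval_var, hx, h5, hij, ne_eq, Nat.reduceEqDiff,
        not_false_eq_true, Mem.write_of_ne, Mem.write_self, Function.update_apply, h8]
      split_ifs with h
      · rw [h]
      · exact hI v (by omega)

/-! ### The list of dominating sets -/

/-- A bank that holds a list is `0` beyond its end, which is why the default value is `0`. -/
theorem getD_set_eq_update (l : List ℕ) {i : ℕ} (hi : i < l.length) (x : ℕ) :
    (fun a => (l.set i x).getD a 0) = Function.update (fun a => l.getD a 0) i x := by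
  funext a
  rw [Function.update_apply]
  split_ifs with h
  · subst h
    simp [hi]
  · simp [List.getD_eq_getElem?_getD, List.getElem?_set_ne (Ne.symm h)]

theorem getD_append_eq_update (l : List ℕ) (x : ℕ) :
    (fun a => (l ++ [x]).getD a 0) = Function.update (fun a => l.getD a 0) l.length x := by
  funext a
  rw [Function.update_apply]
  split_ifs with h
  · subst h
    simp
  · rcases lt_or_gt_of_ne h with h | h
    · simp [List.getD_eq_getElem?_getD, List.getElem?_append_left h]
    · simp only [List.getD_eq_getElem?_getD]
      rw [List.getElem?_eq_none (by simp; omega), List.getElem?_eq_none (by omega)]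

/-- The list `l` is kept in the banks `bList` and `bLen`. -/
structure HoldsList (l : List ℕ) (m : Mem) : Prop where
  list : m bList = fun a => l.getD a 0
  length : m bLen 0 = l.length

theorem HoldsList.congr {l : List ℕ} {m m' : Mem} (h : HoldsList l m) (h₁ : m' bList = m bList)
    (h₂ : m' bLen = m bLen) : HoldsList l m' :=
  ⟨by rw [h₁, h.list], by rw [h₂, h.length]⟩

/-- Tests whether the set in `bX` misses a neighbourhood among the vertices up to `bV`. -/
def testMissed : Program :=
  .store bFlag (.const 0) (.const 0) ;;
  .forLoop bU (.var 0)
    (.store bFlag (.const 0) (.var bFlag |||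
      (Expr.load bNbhd (.var bU)).ltTest (.var bPow + .var bPow) *
        (Expr.load bNbhd (.var bU) &&& .var bX).eqTest (.const 0)))

theorem run_testMissed (hG : HoldsGraph G m) (hN : ∀ v < n, m bNbhd v = G.nbhdMask v)
    (hW : n + 2 ≤ W) {u X : ℕ} (hp : m bPow 0 = 2 ^ u) (hX : m bX 0 = X) :
    Run W testMissed m (3 + n * 3) fun m' => m' bFlag 0 = truth (¬ G.DominatesBelow (u + 1) X) := by
  have hn := lt_two_pow_of_add_two_le hW
  refine (Run.store_seq (by simp) (Run.forLoop (s := 1) n (fun j m' => m' bFlag 0 =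
    truth (∃ v < j, G.nbhdMask v < 2 ^ (u + 1) ∧ G.nbhdMask v &&& X = 0))
    (by omega) (by simp [Program.writes]) (by simp) ?_ ?_)).mono (by omega) ?_
  · intro j hj m' hf _
    simp [hf 0 (by simp [Program.writes]), hG.size]
  · intro j hj m' hf hij hI
    have h8 : m' bNbhd = m bNbhd := by simp [hf bNbhd (by simp [Program.writes])]
    have h9 : m' bPow = m bPow := by simp [hf bPow (by simp [Program.writes])]
    have h13 : m' bX = m bX := by simp [hf bX (by simp [Program.writes])]
    have he : (Expr.var bFlag ||| (Expr.load bNbhd (.var bU)).ltTest (.var bPow + .var bPow) *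
        (Expr.load bNbhd (.var bU) &&& .var bX).eqTest (.const 0)).eval m' =
        truth (∃ v < j + 1, G.nbhdMask v < 2 ^ (u + 1) ∧ G.nbhdMask v &&& X = 0) := by
      simp only [Expr.eval_or, Expr.eval_var, Expr.eval_mul, Expr.eval_ltTest, Expr.eval_load,
        Expr.eval_eqTest, Expr.eval_and, Expr.eval_const, Expr.eval_add, hI, h8, h9, h13, hij,
        hN j hj, hp, hX, ← truth_eq_ite, truth_mul, truth_or, ← two_mul, ← pow_succ']
      exact truth_congr Nat.exists_lt_succ_right.symm
    refine Run.store ?_ ?_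
    · rw [he]
      exact truth_lt (by omega)
    · simp [he]
  · rintro m' - hI
    rw [hI]
    exact truth_congr (by simp [SimpleGraph.DominatesBelow])

open Classical in
/-- The list in the middle of step `u`, when `i` sets have been treated. -/
noncomputable def partialList (G : SimpleGraph (Fin n)) (u i : ℕ) : List ℕ :=
  ((G.dominatingList u).take i).map (fun X => if G.DominatesBelow (u + 1) X then X else X ||| 2 ^ u)
    ++ (G.dominatingList u).drop i ++
    (((G.dominatingList u).take i).filter (G.DominatesBelow (u + 1))).map (· ||| 2 ^ u)

theorem partialList_zero (u : ℕ) : partialList G u 0 = G.dominatingList u := by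
  simp [partialList]

theorem partialList_length (u : ℕ) :
    partialList G u (G.dominatingList u).length = G.dominatingList (u + 1) := by
  simp [partialList, SimpleGraph.dominatingList]

theorem getD_partialList {u i : ℕ} (hi : i < (G.dominatingList u).length) :
    (partialList G u i).getD i 0 = (G.dominatingList u)[i] := by
  rw [partialList, List.drop_eq_getElem_cons hi, List.getD_eq_getElem?_getD, List.append_assoc,
    List.getElem?_append_right (by simp), List.length_map, List.length_take, min_eq_left hi.le,
    Nat.sub_self, List.cons_append, List.getElem?_cons_zero, Option.getD_some]

theorem length_partialList {u i : ℕ} (hi : i < (G.dominatingList u).length) :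
    i < (partialList G u i).length := by
  simp only [partialList, List.length_append, List.length_map, List.length_take, List.length_drop]
  omega

theorem length_partialList_le (u i : ℕ) :
    (partialList G u i).length ≤ 2 * (G.dominatingList u).length := by
  classical
  have h := List.length_filter_le (fun X => decide (G.DominatesBelow (u + 1) X))
    ((G.dominatingList u).take i)
  simp only [partialList, List.length_append, List.length_map, List.length_take,
    List.length_drop] at h ⊢
  omega

/-- The list is updated in place: a set that fails the test is overwritten by its extension, whereas
a set that passes stays and its extension is appended. -/
theorem partialList_succ_of_not {u i : ℕ} (hi : i < (G.dominatingList u).length)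
    (h : ¬ G.DominatesBelow (u + 1) (G.dominatingList u)[i]) :
    partialList G u (i + 1) = (partialList G u i).set i ((G.dominatingList u)[i] ||| 2 ^ u) := by
  rw [partialList, partialList, List.drop_eq_getElem_cons hi, List.take_succ_eq_append_getElem hi,
    List.append_assoc (List.map _ (List.take i _)), List.set_append_right _ _ (by simp),
    List.length_map, List.length_take, min_eq_left hi.le, Nat.sub_self, List.cons_append,
    List.set_cons_zero]
  simp only [List.map_append, List.filter_append, List.map_cons, List.map_nil, if_neg h,
    List.filter_cons, List.filter_nil, List.append_assoc, List.cons_append, List.nil_append]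
  simp [h]

theorem partialList_succ {u i : ℕ} (hi : i < (G.dominatingList u).length)
    (h : G.DominatesBelow (u + 1) (G.dominatingList u)[i]) :
    partialList G u (i + 1) = partialList G u i ++ [(G.dominatingList u)[i] ||| 2 ^ u] := by
  rw [partialList, partialList, List.drop_eq_getElem_cons hi, List.take_succ_eq_append_getElem hi]
  simp only [List.map_append, List.filter_append, List.map_cons, List.map_nil, if_pos h,
    List.filter_cons, List.filter_nil, List.append_assoc, List.cons_append, List.nil_append]
  simp [h]

theorem length_dominatingList_le_two_pow (u : ℕ) : (G.dominatingList u).length ≤ 2 ^ u := by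
  induction u with
  | zero => simp [SimpleGraph.dominatingList]
  | succ u ih =>
    rw [← partialList_length, pow_succ]
    refine (length_partialList_le u _).trans (by omega)

/-- Extends the sets of the list by the vertex in `bV`. -/
def extendList : Program :=
  .store bBound (.const 0) (.var bLen) ;;
  .forLoop bI (.var bBound)
    (.store bX (.const 0) (.load bList (.var bI)) ;; testMissed ;;
    .cond (.var bFlag)
      (.store bList (.var bI) (.var bX ||| .var bPow) ;; .skip)
      (.store bList (.var bLen) (.var bX ||| .var bPow) ;;
      .store bLen (.const 0) (.var bLen + .const 1)))

/-- The loop runs up to the length saved in `bBound`, so the sets appended on the way are not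
treated again. That length is at most the final number of dominating sets, hence the factor in the
step count. -/
theorem run_extendList (hG : HoldsGraph G m) (hN : ∀ v < n, m bNbhd v = G.nbhdMask v)
    (hW : n + 2 ≤ W) {u : ℕ} (hu : u < n) (hp : m bPow 0 = 2 ^ u)
    (hl : HoldsList (G.dominatingList u) m) :
    Run W extendList m (3 + G.dominatingMasks.card * (n * 3 + 9))
      (HoldsList (G.dominatingList (u + 1))) := by
  set l := G.dominatingList u with hl'
  have hlen : (G.dominatingList u).length ≤ 2 ^ u := length_dominatingList_le_two_pow u
  have hlen' : l.length ≤ 2 ^ u := hlen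
  have hL : l.length ≤ G.dominatingMasks.card := by
    rw [← G.length_dominatingList]
    exact G.length_dominatingList_le hu.le
  have hpu : 2 ^ u < 2 ^ W := two_pow_lt_of_le hW (by omega)
  have hpu' : 2 * 2 ^ u < 2 ^ W := by
    rw [← pow_succ']
    exact two_pow_lt_of_le hW (by omega)
  refine (Run.store_seq (by rw [Expr.eval_var, hl.length]; omega)
    (Run.forLoop (s := 1 + ((3 + n * 3) + (1 + 2))) l.length
    (fun i m' => HoldsList (partialList G u i) m') (by omega)
    (by simp [Program.writes, testMissed]) ?_ ?_ ?_)).mono ?_ ?_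
  · rw [partialList_zero]
    exact hl.congr (by simp) (by simp)
  · intro j _ m' hf _
    simp [hf bBound (by simp [Program.writes, testMissed]), hl.length]
  · intro i hi m' hf hij hI
    have hX := getD_partialList (G := G) (u := u) hi
    have hXlt : l[i] < 2 ^ u := (G.mem_dominatingList.1 (List.getElem_mem hi)).1
    have hXe : m' bList i = l[i] := by rw [hI.list]; exact hX
    have hor : l[i] ||| 2 ^ u < 2 ^ W := Nat.or_lt_two_pow (hXlt.trans hpu) hpu
    refine Run.store_seq (by simp only [Expr.eval_load, Expr.eval_var, hij, hXe]; omega) ?_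
    simp only [Expr.eval_load, Expr.eval_var, hij, hXe, Expr.eval_const]
    refine Run.seq ((run_testMissed (G := G) (u := u) (X := l[i]) (hG.congr ?_ ?_) ?_ hW ?_
      ?_).mono le_rfl fun m₁ hf₁ hflag hf₁' => ?_)
    · simp [hf 0 (by simp [Program.writes, testMissed])]
    · simp [hf 1 (by simp [Program.writes, testMissed])]
    · simpa [hf bNbhd (by simp [Program.writes, testMissed])] using hN
    · simpa [hf bPow (by simp [Program.writes, testMissed])] using hp
    · simp
    have h7 : m₁ bI 0 = i := by simpa [hij] using congrFun (hf₁ bI (by simp [Program.writes, testMissed])) 0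
    have h9 : m₁ bPow 0 = 2 ^ u := by
      simpa [hf bPow (by simp [Program.writes, testMissed]), hp] using
        congrFun (hf₁ bPow (by simp [Program.writes, testMissed])) 0
    have h13 : m₁ bX 0 = l[i] := by
      simpa using congrFun (hf₁ bX (by simp [Program.writes, testMissed])) 0
    have hI₁ : HoldsList (partialList G u i) m₁ := hI.congr
      (by simpa using hf₁ bList (by simp [Program.writes, testMissed]))
      (by simpa using hf₁ bLen (by simp [Program.writes, testMissed]))
    refine Run.cond ?_ ?_
    · intro hc
      rw [Expr.eval_var, hflag, Ne, truth_eq_zero, not_not] at hc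
      refine Run.store_seq ?_ (Run.skip ?_)
      · simpa [h13, h9] using hor
      · rw [partialList_succ_of_not hi hc]
        refine ⟨?_, ?_⟩
        · rw [getD_set_eq_update _ (length_partialList hi)]
          simp [h7, h13, h9, hI₁.list, l]
        · simpa using hI₁.length
    · intro hc
      rw [Expr.eval_var, hflag, truth_eq_zero, not_not] at hc
      refine Run.store_seq ?_ (Run.store ?_ ?_)
      · simpa [h13, h9] using hor
      · have h₁ := length_partialList_le (G := G) u (i + 1)
        rw [partialList_succ hi hc, List.length_append, List.length_singleton] at h₁
        simp only [Expr.eval_var, Expr.eval_add, Expr.eval_const, ne_eq, Nat.reduceEqDiff,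
          not_false_eq_true, Mem.write_of_ne, hI₁.length]
        omega
      · rw [partialList_succ hi hc]
        refine ⟨?_, ?_⟩
        · rw [getD_append_eq_update]
          simp [h13, h9, hI₁.list, hI₁.length, l]
        · simp [hI₁.length]
  · have : l.length * (1 + (3 + n * 3 + (1 + 2)) + 2) ≤ G.dominatingMasks.card * (n * 3 + 9) :=
      Nat.mul_le_mul hL (by omega)
    omega
  · intro m' _ h
    rwa [partialList_length] at h

/-- Lists the dominating sets. -/
def listDominating : Program :=
  .store bList (.const 0) (.const 0) ;;
  .store bLen (.const 0) (.const 1) ;;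
  .store bPow (.const 0) (.const 1) ;;
  .forLoop bV (.var 0) (extendList ;; .store bPow (.const 0) (.var bPow + .var bPow))

theorem run_listDominating (hG : HoldsGraph G m) (hN : ∀ v < n, m bNbhd v = G.nbhdMask v)
    (hW : n + 2 ≤ W) (hl : m bList = 0) :
    Run W listDominating m (5 + n * (6 + G.dominatingMasks.card * (n * 3 + 9)))
      (HoldsList (G.dominatingList n)) := by
  have hn := lt_two_pow_of_add_two_le hW
  have h1 := one_lt_two_pow_of hW
  refine (Run.store_seq (by simp) (Run.store_seq h1 (Run.store_seq h1
    (Run.forLoop (s := (3 + G.dominatingMasks.card * (n * 3 + 9)) + 1) n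
    (fun j m' => m' bPow 0 = 2 ^ j ∧ HoldsList (G.dominatingList j) m') (by omega)
    (by simp [Program.writes, extendList, testMissed]) ?_ ?_ ?_)))).mono ?_ fun _ _ h => h.2
  · refine ⟨by simp, ?_, by simp [SimpleGraph.dominatingList]⟩
    funext a
    rcases a with _ | a <;> simp [SimpleGraph.dominatingList, hl]
  · intro j hj m' hf _
    simp [hf 0 (by simp [Program.writes, extendList, testMissed]), hG.size]
  · rintro j hj m' hf hij ⟨hp, hI⟩
    refine Run.seq ((run_extendList (G := G) (hG.congr ?_ ?_) ?_ hW hj hp hI).mono le_rfl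
      fun m₁ hf₁ hI₁ _ => ?_)
    · simp [hf 0 (by simp [Program.writes, extendList, testMissed])]
    · simp [hf 1 (by simp [Program.writes, extendList, testMissed])]
    · simpa [hf bNbhd (by simp [Program.writes, extendList, testMissed])] using hN
    have h9 := hf₁ bPow (by simp [Program.writes, extendList, testMissed])
    refine Run.store ?_ ⟨?_, hI₁.congr (by simp) (by simp)⟩
    · simp only [Expr.eval_add, Expr.eval_var, h9, hp, ← two_mul, ← pow_succ']
      exact two_pow_lt_of_le hW (by omega)
    · simp [h9, hp, pow_succ, mul_two]
  · have : 3 + G.dominatingMasks.card * (n * 3 + 9) + 1 + 2 =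
      6 + G.dominatingMasks.card * (n * 3 + 9) := by omega
    rw [this]
    omega

end RAM

theorem Nat.and_two_pow_ne_zero {X u : ℕ} : X &&& 2 ^ u ≠ 0 ↔ X.testBit u := by
  rw [Nat.and_two_pow]
  cases X.testBit u <;> simp

/-! ### Loops over the listed sets and over the bits of a mask. -/

namespace RAM
variable {n W s k : ℕ} {G : SimpleGraph (Fin n)} {m : Mem} {p : Program}

/-- The table of the numbers of independent dominating subsets. -/
notation "bTab" => 15
/-- The sum over the even sets. -/
notation "bEven" => 16
/-- The sum over the odd sets. -/
notation "bOdd" => 17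
/-- A power of a table entry. -/
notation "bY" => 18
/-- A loop variable. -/
notation "bK" => 19

/-- Runs `p` for all members `bX` of the list. -/
def Program.forList (p : Program) : Program :=
  .forLoop bI (.var bLen) (.store bX (.const 0) (.load bList (.var bI)) ;; p)

/-- The invariant has to be insensitive to the banks `bI` and `bX`, which the loop itself
overwrites. -/
theorem Run.forList {l : List ℕ} (hl : HoldsList l m) (hlen : l.length < 2 ^ W)
    (hX : ∀ X ∈ l, X < 2 ^ W)
    (hp : bI ∉ p.writes ∧ bX ∉ p.writes ∧ bList ∉ p.writes ∧ bLen ∉ p.writes)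
    (I : ℕ → Mem → Prop)
    (hI : ∀ j m' b x, b = bI ∨ b = bX → I j m' → I j (m'.write b 0 x)) (h₀ : I 0 m)
    (hstep : ∀ j (hj : j < l.length) m', (∀ b ∉ bI :: bX :: p.writes, m' b = m b) →
      m' bX 0 = l[j] → I j m' → Run W p m' s (I (j + 1))) :
    Run W (.forList p) m (2 + l.length * (s + 3)) (I l.length) := by
  refine (Run.forLoop (s := 1 + s) l.length I hlen (by simp [Program.writes, hp.1])
    (hI _ _ _ _ (Or.inl rfl) h₀) ?_ ?_).le (by
      exact Nat.add_le_add_left (Nat.mul_le_mul_left _ (by omega)) _)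
  · intro j _ m' hf _
    simp [hf bLen (by simp [Program.writes, hp]), hl.length]
  · intro j hj m' hf hij hIj
    have hXe : m' bList j = l[j] := by
      rw [hf bList (by simp [Program.writes, hp]), hl.list]
      simp [hj]
    refine Run.store_seq ?_ ((hstep j hj _ ?_ ?_ ?_).mono le_rfl fun m₁ _ h =>
      hI _ _ _ _ (Or.inl rfl) h)
    · rw [Expr.eval_load, Expr.eval_var, hij, hXe]
      exact hX _ (List.getElem_mem hj)
    · intro b hb
      simp only [List.mem_cons, not_or] at hb
      rw [Mem.write_of_ne _ _ _ hb.2.1, hf b (by simp [Program.writes, hb])]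
    · simp [hij, hXe]
    · exact hI _ _ _ _ (Or.inr rfl) hIj

theorem Program.writes_forList : (Program.forList p).writes = bI :: ((bX :: p.writes) ++ [bI]) :=
  rfl

/-- Runs `p` for all vertices `bU`, where `bPow` is the corresponding power of two. -/
def Program.forBits (p : Program) : Program :=
  .store bPow (.const 0) (.const 1) ;;
  .forLoop bU (.var 0) (p ;; .store bPow (.const 0) (.var bPow + .var bPow))

theorem Program.writes_forBits :
    (Program.forBits p).writes = bPow :: bU :: ((p.writes ++ [bPow]) ++ [bU]) := rfl

theorem Run.forBits (hn : m 0 0 = n) (hW : n + 2 ≤ W)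
    (hp : 0 ∉ p.writes ∧ bU ∉ p.writes ∧ bPow ∉ p.writes) (I : ℕ → Mem → Prop)
    (hI : ∀ j m' b x, b = bU ∨ b = bPow → I j m' → I j (m'.write b 0 x)) (h₀ : I 0 m)
    (hstep : ∀ j < n, ∀ m', (∀ b ∉ bU :: bPow :: p.writes, m' b = m b) →
      m' bU 0 = j → m' bPow 0 = 2 ^ j → I j m' → Run W p m' s (I (j + 1))) :
    Run W (.forBits p) m (3 + n * (s + 3)) (I n) := by
  have hn' := lt_two_pow_of_add_two_le hW
  refine (Run.store_seq (one_lt_two_pow_of hW) (Run.forLoop (s := s + 1) n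
    (fun j m' => m' bPow 0 = 2 ^ j ∧ I j m') (by omega) (by simp [Program.writes, hp.2.1])
    ⟨by simp, hI _ _ _ _ (Or.inl rfl) (hI _ _ _ _ (Or.inr rfl) h₀)⟩ ?_ ?_)).mono ?_
    fun _ _ h => h.2
  · intro j _ m' hf _
    simp [hf 0 (by simp [Program.writes, hp]), hn]
  · rintro j hj m' hf hij ⟨h9, hIj⟩
    refine Run.seq ((hstep j hj m' ?_ hij h9 hIj).mono le_rfl fun m₁ hf₁ h _ => Run.store ?_ ⟨?_, ?_⟩)
    · intro b hb
      simp only [List.mem_cons, not_or] at hb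
      rw [hf b (by simp [Program.writes, hb]), Mem.write_of_ne _ _ _ hb.2.1]
    · simp only [Expr.eval_add, Expr.eval_var, hf₁ bPow hp.2.2, h9, ← two_mul, ← pow_succ']
      exact two_pow_lt_of_le hW (by omega)
    · simp [hf₁ bPow hp.2.2, h9, pow_succ, mul_two]
    · exact hI _ _ _ _ (Or.inl rfl) (hI _ _ _ _ (Or.inr rfl) h)
  · have : 1 + (2 + n * (s + 1 + 2)) = 3 + n * (s + 3) := by ring
    omega

/-! ### Counting independent dominating subsets -/

/-- Tests whether the set in `bX` is independent. -/
def testIndep : Program :=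
  .store bFlag (.const 0) (.const 1) ;;
  .forBits (.cond (.var bX &&& .var bPow)
    (.store bFlag (.const 0)
      (.var bFlag * (Expr.load bNbhd (.var bU) &&& .var bX).eqTest (.var bPow))) .skip)

theorem run_testIndep (hn : m 0 0 = n) (hN : ∀ v < n, m bNbhd v = G.nbhdMask v)
    (hW : n + 2 ≤ W) {X : ℕ} (hX : m bX 0 = X) :
    Run W testIndep m (4 + n * 5) fun m' => m' bFlag 0 = truth (G.IndepMask X) := by
  have h1 := one_lt_two_pow_of hW
  refine (Run.store_seq h1 (Run.forBits (s := 2) (by simp [hn]) hW (by simp [Program.writes])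
    (fun j m' => m' bFlag 0 = truth (∀ v < j, X.testBit v → G.nbhdMask v &&& X = 2 ^ v))
    ?_ (by simp) ?_)).mono (by omega) fun _ _ h => h
  · rintro j m' b x (rfl | rfl) h <;> simpa using h
  · intro j hj m' hf hij h9 hI
    have h8 : m' bNbhd = m bNbhd := by simp [hf bNbhd (by simp [Program.writes])]
    have h13 : m' bX = m bX := by simp [hf bX (by simp [Program.writes])]
    refine Run.cond (s := 1) ?_ ?_ <;> intro hc <;>
      simp only [Expr.eval_and, Expr.eval_var, h13, hX, h9] at hc
    · have he : (Expr.var bFlag * (Expr.load bNbhd (.var bU) &&& .var bX).eqTest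
          (.var bPow)).eval m' =
          truth (∀ v < j + 1, X.testBit v → G.nbhdMask v &&& X = 2 ^ v) := by
        simp only [Expr.eval_mul, Expr.eval_var, Expr.eval_eqTest, Expr.eval_and, Expr.eval_load,
          hI, h8, h13, hX, hij, h9, hN j hj, ← truth_eq_ite, truth_mul]
        refine truth_congr ?_
        rw [Nat.forall_lt_succ_right]
        simp [Nat.and_two_pow_ne_zero.1 hc]
      refine Run.store ?_ ?_
      · rw [he]
        exact truth_lt h1
      · simp [he]
    · refine Run.skip ?_
      rw [hI]
      refine truth_congr ?_
      rw [Nat.forall_lt_succ_right]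
      have : ¬ X.testBit j := fun h => Nat.and_two_pow_ne_zero.2 h hc
      simp [this]

/-- Marks the independent sets in the table. -/
def initTable : Program := .forList (testIndep ;; .store bTab (.var bX) (.var bFlag))

theorem dominatingList_lt {X : ℕ} (hX : X ∈ G.dominatingList n) : X < 2 ^ n :=
  (G.mem_dominatingList.1 hX).1

theorem mem_dominatingList_iff {X : ℕ} (hX : X < 2 ^ n) :
    X ∈ G.dominatingList n ↔ G.DominatingMask X := by
  rw [← List.mem_toFinset, G.toFinset_dominatingList, G.mem_dominatingMasks, and_iff_right hX]

/-- Only the listed sets are visited, yet the table is right for all masks: it starts at `0`, which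
is the correct value at sets that do not dominate. -/
theorem run_initTable (hn : m 0 0 = n) (hN : ∀ v < n, m bNbhd v = G.nbhdMask v)
    (hW : n + 2 ≤ W) (hl : HoldsList (G.dominatingList n) m) (ht : m bTab = 0) :
    Run W initTable m (2 + G.dominatingMasks.card * (n * 5 + 8)) fun m' =>
      ∀ X < 2 ^ n, m' bTab X = G.zeta 0 X := by
  classical
  have h1 := one_lt_two_pow_of hW
  have h2 : 2 ^ n < 2 ^ W := two_pow_lt_of_le hW (by omega)
  refine (Run.forList (s := (4 + n * 5) + 1) hl
    ((length_dominatingList_le_two_pow n).trans_lt h2)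
    (fun X hX => (dominatingList_lt hX).trans h2)
    (by simp [Program.writes, testIndep, Program.writes_forBits])
    (fun j m' => ∀ X < 2 ^ n, m' bTab X =
      if X ∈ (G.dominatingList n).take j then G.zeta 0 X else 0) ?_ (by simp [ht]) ?_).mono ?_ ?_
  · rintro j m' b x (rfl | rfl) h <;> simpa using h
  · intro j hj m' hf hX hI
    refine Run.seq ((run_testIndep (G := G) (W := W) ?_ ?_ hW hX).mono le_rfl
      fun m₁ hf₁ h _ => Run.store ?_ ?_)
    · rw [hf 0 (by simp [Program.writes, testIndep, Program.writes_forBits]), hn]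
    · rw [hf bNbhd (by simp [Program.writes, testIndep, Program.writes_forBits])]
      exact hN
    · rw [Expr.eval_var, h]
      exact truth_lt h1
    · intro X hXn
      have h13 := hf₁ bX (by simp [Program.writes, testIndep, Program.writes_forBits])
      have h15 := hf₁ bTab (by simp [Program.writes, testIndep, Program.writes_forBits])
      have hmem : (G.dominatingList n)[j] ∈ G.dominatingList n := List.getElem_mem hj
      simp only [Mem.write_self, Expr.eval_var, h13, hX, h, Function.update_apply, h15,
        List.take_succ_eq_append_getElem hj, List.mem_append, List.mem_singleton]
      split_ifs with h₁ h₂ h₂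
      · rw [h₁, G.zeta_zero (dominatingList_lt hmem)
          ((mem_dominatingList_iff (dominatingList_lt hmem)).1 hmem), truth_eq_ite]
      · exact absurd (Or.inr h₁) h₂
      · rw [hI X hXn, if_pos (h₂.resolve_right h₁)]
      · rw [hI X hXn, if_neg fun h => h₂ (Or.inl h)]
  · rw [G.length_dominatingList]
    exact Nat.add_le_add_left (Nat.mul_le_mul_left _ (by omega)) _
  · intro m' _ h X hX
    rw [h X hX, List.take_length]
    split_ifs with h'
    · rfl
    · rw [G.zeta_eq_zero fun hd => h' ((mem_dominatingList_iff hX).2 hd)]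

/-- The zeta transform of the table. -/
def zetaTransform : Program :=
  .forBits (.forList (.cond (.var bX &&& .var bPow)
    (.store bTab (.var bX) (.load bTab (.var bX) + .load bTab (.var bX - .var bPow))) .skip))

/-- One pass per vertex `u`, in place and restricted to the dominating sets. The order inside a pass
is irrelevant, because the entry that is read belongs to a set without `u` and has the same value at
levels `u` and `u + 1`. -/
theorem run_zetaTransform (hn : m 0 0 = n) (hW : n + 2 ≤ W)
    (hl : HoldsList (G.dominatingList n) m) (ht : ∀ X < 2 ^ n, m bTab X = G.zeta 0 X) :
    Run W zetaTransform m (3 + n * (5 + G.dominatingMasks.card * 5)) fun m' =>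
      ∀ X < 2 ^ n, m' bTab X = G.zeta n X := by
  classical
  have h2 : 2 ^ n < 2 ^ W := two_pow_lt_of_le hW (by omega)
  refine (Run.forBits (s := 2 + G.dominatingMasks.card * 5) hn hW
    (by simp [Program.writes, Program.writes_forList])
    (fun u m' => ∀ X < 2 ^ n, m' bTab X = G.zeta u X) ?_ ht ?_).le ?_
  · rintro j m' b x (rfl | rfl) h <;> simpa using h
  · intro u hu m' hf hij h9 hI
    have hl' : HoldsList (G.dominatingList n) m' := hl.congr
      (hf bList (by simp [Program.writes, Program.writes_forList]))
      (hf bLen (by simp [Program.writes, Program.writes_forList]))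
    refine (Run.forList (s := 2) hl' ((length_dominatingList_le_two_pow n).trans_lt h2)
      (fun X hX => (dominatingList_lt hX).trans h2) (by simp [Program.writes])
      (fun j m' => ∀ X < 2 ^ n, m' bTab X =
        if X ∈ (G.dominatingList n).take j then G.zeta (u + 1) X else G.zeta u X)
      ?_ (by simpa using hI) ?_).mono ?_ ?_
    · rintro j m' b x (rfl | rfl) h <;> simpa using h
    · intro j hj m₁ hf₁ hX hI₁
      have hmem : (G.dominatingList n)[j] ∈ G.dominatingList n := List.getElem_mem hj
      set Y := (G.dominatingList n)[j] with hY
      have hYn : Y < 2 ^ n := dominatingList_lt hmem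
      have hp : m₁ bPow 0 = 2 ^ u := by rw [hf₁ bPow (by simp [Program.writes]), h9]
      -- The list has no repetitions, so the entry of `Y` is still at level `u`.
      have hnew : Y ∉ (G.dominatingList n).take j := by
        intro h
        obtain ⟨i, hi, hiY⟩ := List.getElem_of_mem h
        rw [List.length_take] at hi
        rw [List.getElem_take] at hiY
        have := (G.nodup_dominatingList n).getElem_inj_iff.1 hiY
        omega
      refine Run.cond (s := 1) ?_ ?_ <;> intro hc <;>
        simp only [Expr.eval_and, Expr.eval_var, hX, hp] at hc
      · have hb := Nat.and_two_pow_ne_zero.1 hc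
        -- The entry at `Y - 2 ^ u` may or may not have been treated; its value is the same either
        -- way.
        have hb' : ¬ (Y - 2 ^ u).testBit u := by simp [Nat.testBit_sub_two_pow hb]
        have hv : (Expr.load bTab (.var bX) + .load bTab (.var bX - .var bPow)).eval m₁ =
            G.zeta (u + 1) Y := by
          simp only [Expr.eval_add, Expr.eval_load, Expr.eval_var, Expr.eval_sub, hX, hp]
          rw [hI₁ Y hYn, if_neg hnew, hI₁ _ ((Nat.sub_le _ _).trans_lt hYn),
            G.zeta_succ_of_not hb', ite_self, G.zeta_succ hb]
        refine Run.store ?_ ?_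
        · rw [hv]
          exact (G.zeta_le _ _).trans_lt h2
        · intro X hXn
          rw [hv]
          simp only [Mem.write_self, Expr.eval_var, hX, Function.update_apply,
            List.take_succ_eq_append_getElem hj, List.mem_append, List.mem_singleton, ← hY]
          split_ifs with h₁ h₂ h₂
          · rw [h₁]
          · exact absurd (Or.inr h₁) h₂
          · rw [hI₁ X hXn, if_pos (h₂.resolve_right h₁)]
          · rw [hI₁ X hXn, if_neg fun h => h₂ (Or.inl h)]
      · have hb : ¬ Y.testBit u := fun h => Nat.and_two_pow_ne_zero.2 h hc
        refine Run.skip fun X hXn => ?_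
        simp only [List.take_succ_eq_append_getElem hj, List.mem_append, List.mem_singleton, ← hY]
        rw [hI₁ X hXn]
        by_cases h₁ : X = Y
        · rw [h₁, if_neg hnew, G.zeta_succ_of_not hb, ite_self]
        · simp [h₁]
    · rw [G.length_dominatingList]
    · intro m' _ h X hX
      rw [h X hX, List.take_length]
      split_ifs with h'
      · rfl
      · rw [G.zeta_eq_zero fun hd => h' ((mem_dominatingList_iff hX).2 hd),
          G.zeta_eq_zero fun hd => h' ((mem_dominatingList_iff hX).2 hd)]
  · exact Nat.add_le_add_left (Nat.mul_le_mul_left _ (by omega)) _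

/-! ### The alternating sum -/

/-- Counts the elements of the set in `bX`. -/
def countBits : Program :=
  .store bFlag (.const 0) (.const 0) ;;
  .forBits (.cond (.var bX &&& .var bPow)
    (.store bFlag (.const 0) (.var bFlag + .const 1)) .skip)

theorem run_countBits (hn : m 0 0 = n) (hW : n + 2 ≤ W) {X : ℕ} (hX : m bX 0 = X) :
    Run W countBits m (4 + n * 5) fun m' => m' bFlag 0 = popCount n X := by
  have hn' := lt_two_pow_of_add_two_le hW
  refine (Run.store_seq (by simp) (Run.forBits (s := 2) (by simp [hn]) hW
    (by simp [Program.writes]) (fun j m' => m' bFlag 0 = popCount j X)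
    ?_ (by simp [popCount]) ?_)).mono (by omega) fun _ _ h => h
  · rintro j m' b x (rfl | rfl) h <;> simpa using h
  · intro j hj m' hf hij h9 hI
    have h13 : m' bX = m bX := by simp [hf bX (by simp [Program.writes])]
    have hle : popCount j X ≤ j := (Finset.card_filter_le _ _).trans (by simp)
    refine Run.cond (s := 1) ?_ ?_ <;> intro hc <;>
      simp only [Expr.eval_and, Expr.eval_var, h13, hX, h9] at hc
    · refine Run.store ?_ ?_
      · simp only [Expr.eval_add, Expr.eval_var, Expr.eval_const, hI]
        omega
      · rw [popCount, Finset.range_add_one, Finset.filter_insert,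
          if_pos (Nat.and_two_pow_ne_zero.1 hc), Finset.card_insert_of_notMem (by simp)]
        simp [hI, popCount]
    · refine Run.skip ?_
      rw [popCount, Finset.range_add_one, Finset.filter_insert,
        if_neg fun h => Nat.and_two_pow_ne_zero.2 h hc, hI, popCount]

/-- Computes the `k`-th power of the table entry of the set in `bX`. -/
def powerEntry (k : ℕ) : Program :=
  .store bY (.const 0) (.const 1) ;;
  .forLoop bK (.const k) (.store bY (.const 0) (.var bY * .load bTab (.var bX)))

theorem run_powerEntry {c : ℕ} (hk : k < 2 ^ W) (hck : ∀ j ≤ k, c ^ j < 2 ^ W)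
    (h : m bTab (m bX 0) = c) :
    Run W (powerEntry k) m (3 + k * 3) fun m' => m' bY 0 = c ^ k := by
  refine (Run.store_seq (by simpa using hck 0 (by simp)) (Run.forLoop (s := 1) k
    (fun j m' => m' bY 0 = c ^ j) hk (by simp [Program.writes]) (by simp) (by simp) ?_)).le
    (by omega)
  intro j hj m' hf _ hI
  have h13 : m' bX = m bX := by simp [hf bX (by simp [Program.writes])]
  have h15 : m' bTab = m bTab := by simp [hf bTab (by simp [Program.writes])]
  have he : (Expr.var bY * .load bTab (.var bX)).eval m' = c ^ (j + 1) := by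
    simp [hI, h13, h15, h, pow_succ]
  refine Run.store ?_ ?_
  · rw [he]
    exact hck _ hj
  · simp [he]

/-- Sums the powers over the even and over the odd sets. -/
def sumPowers (k : ℕ) : Program :=
  .store bEven (.const 0) (.const 0) ;;
  .store bOdd (.const 0) (.const 0) ;;
  .forList (countBits ;; powerEntry k ;;
    .cond (.var bFlag % .const 2)
      (.store bOdd (.const 0) (.var bOdd + .var bY))
      (.store bEven (.const 0) (.var bEven + .var bY)))

theorem sum_map_le_of_le {l : List ℕ} {f : ℕ → ℕ} {B : ℕ} (h : ∀ x ∈ l, f x ≤ B) :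
    (l.map f).sum ≤ l.length * B := by
  have := List.sum_le_card_nsmul (l.map f) B (by simpa using h)
  simpa using this

/-- At most `2 ^ n` summands of size at most `2 ^ (n * k)` occur, which explains the required number
of bits. -/
theorem run_sumPowers (hn : m 0 0 = n) (hW : (n + 1) * (k + 1) + 1 ≤ W)
    (hl : HoldsList (G.dominatingList n) m) (ht : ∀ X < 2 ^ n, m bTab X = G.zeta n X) :
    Run W (sumPowers k) m (4 + G.dominatingMasks.card * (n * 5 + k * 3 + 12)) fun m' =>
      m' bEven 0 =
        ∑ X ∈ G.dominatingMasks, (if Even (popCount n X) then G.zeta n X ^ k else 0) ∧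
      m' bOdd 0 =
        ∑ X ∈ G.dominatingMasks, (if Even (popCount n X) then 0 else G.zeta n X ^ k) := by
  have hW' : n + 2 ≤ W := by nlinarith
  have h2 : 2 ^ n < 2 ^ W := two_pow_lt_of_le hW' (by omega)
  have hbig : 2 ^ n * 2 ^ (n * k) < 2 ^ W := by
    rw [← pow_add]
    exact Nat.pow_lt_pow_right (by simp) (by nlinarith)
  have hpow : ∀ X, ∀ j ≤ k, G.zeta n X ^ j ≤ 2 ^ (n * k) := fun X j hj =>
    calc G.zeta n X ^ j ≤ (2 ^ n) ^ j := Nat.pow_le_pow_left (G.zeta_le _ _) j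
      _ ≤ (2 ^ n) ^ k := Nat.pow_le_pow_right (by positivity) hj
      _ = _ := by rw [pow_mul]
  have hpow' : ∀ X, ∀ j ≤ k, G.zeta n X ^ j < 2 ^ W := fun X j hj =>
    ((hpow X j hj).trans (Nat.le_mul_of_pos_left _ (by positivity))).trans_lt hbig
  set l := G.dominatingList n with hl'
  set fe : ℕ → ℕ := fun X => if Even (popCount n X) then G.zeta n X ^ k else 0 with hfe
  set fo : ℕ → ℕ := fun X => if Even (popCount n X) then 0 else G.zeta n X ^ k with hfo
  have hlen : l.length ≤ 2 ^ n := length_dominatingList_le_two_pow n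
  have hsum : ∀ f : ℕ → ℕ, (∀ X, f X ≤ 2 ^ (n * k)) → ∀ j,
      ((l.take j).map f).sum < 2 ^ W := by
    intro f hf j
    refine lt_of_le_of_lt ((sum_map_le_of_le fun X _ => hf X).trans ?_) hbig
    refine Nat.mul_le_mul_right _ (le_trans ?_ hlen)
    simp
  have hse := hsum fe fun X => by
    simp only [fe]
    split
    · exact hpow X k le_rfl
    · simp
  have hso := hsum fo fun X => by
    simp only [fo]
    split
    · simp
    · exact hpow X k le_rfl
  refine (Run.store_seq (by simp) (Run.store_seq (by simp)
    (Run.forList (s := (4 + n * 5) + ((3 + k * 3) + (1 + 1))) (l := l)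
    (hl.congr (by simp) (by simp)) (hlen.trans_lt h2) (fun X hX => (dominatingList_lt hX).trans h2)
    (by simp [Program.writes, countBits, Program.writes_forBits, powerEntry])
    (fun j m' => m' bEven 0 = ((l.take j).map fe).sum ∧ m' bOdd 0 = ((l.take j).map fo).sum) ?_
    (by simp) ?_))).mono ?_ ?_
  · rintro j m' b x (rfl | rfl) h <;> simpa using h
  · rintro j hj m' hf hX ⟨he, ho⟩
    have hmem : l[j] ∈ l := List.getElem_mem hj
    refine Run.seq ((run_countBits (n := n) (W := W) ?_ hW' hX).mono le_rfl
      fun m₁ hf₁ hcount _ => Run.seq ((run_powerEntry (c := G.zeta n l[j]) ?_ (hpow' _)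
        ?_).mono le_rfl fun m₂ hf₂ hy _ => ?_))
    · rw [hf 0 (by simp [Program.writes, countBits, Program.writes_forBits, powerEntry])]
      simp [hn]
    · exact lt_of_le_of_lt (by nlinarith) (Nat.lt_two_pow_self (n := W))
    · rw [hf₁ bX (by simp [Program.writes, countBits, Program.writes_forBits]), hX,
        hf₁ bTab (by simp [Program.writes, countBits, Program.writes_forBits]),
        hf bTab (by simp [Program.writes, countBits, Program.writes_forBits, powerEntry])]
      simpa using ht _ (dominatingList_lt hmem)
    have h14 : m₂ bFlag 0 = popCount n l[j] := by
      rw [hf₂ bFlag (by simp [Program.writes, powerEntry]), hcount]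
    have h16 : m₂ bEven 0 = ((l.take j).map fe).sum := by
      rw [hf₂ bEven (by simp [Program.writes, powerEntry]),
        hf₁ bEven (by simp [Program.writes, countBits, Program.writes_forBits]), he]
    have h17 : m₂ bOdd 0 = ((l.take j).map fo).sum := by
      rw [hf₂ bOdd (by simp [Program.writes, powerEntry]),
        hf₁ bOdd (by simp [Program.writes, countBits, Program.writes_forBits]), ho]
    have hes : ((l.take (j + 1)).map fe).sum = ((l.take j).map fe).sum + fe l[j] := by
      rw [List.take_succ_eq_append_getElem hj, List.map_append, List.sum_append]
      simp
    have hos : ((l.take (j + 1)).map fo).sum = ((l.take j).map fo).sum + fo l[j] := by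
      rw [List.take_succ_eq_append_getElem hj, List.map_append, List.sum_append]
      simp
    have hse' := hse (j + 1)
    have hso' := hso (j + 1)
    rw [hes] at hse'
    rw [hos] at hso'
    refine Run.cond ?_ ?_ <;> intro hc <;>
      simp only [Expr.eval_mod, Expr.eval_var, Expr.eval_const, h14] at hc
    · have hev : ¬ Even (popCount n l[j]) := by
        rw [Nat.even_iff]
        exact hc
      have hv : fo l[j] = G.zeta n l[j] ^ k := if_neg hev
      have hv' : fe l[j] = 0 := if_neg hev
      rw [hv] at hso' hos
      rw [hv'] at hes
      refine Run.store (by simpa [h17, hy] using hso') ⟨?_, ?_⟩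
      · rw [hes]
        simp [h16]
      · rw [hos]
        simp [h17, hy]
    · have hev : Even (popCount n l[j]) := by
        rw [Nat.even_iff]
        exact hc
      have hv : fo l[j] = 0 := if_pos hev
      have hv' : fe l[j] = G.zeta n l[j] ^ k := if_pos hev
      rw [hv] at hos
      rw [hv'] at hse' hes
      refine Run.store (by simpa [h16, hy] using hse') ⟨?_, ?_⟩
      · rw [hes]
        simp [h16, hy]
      · rw [hos]
        simp [h17]
  · rw [hl', G.length_dominatingList]
    have : G.dominatingMasks.card * (4 + n * 5 + (3 + k * 3 + (1 + 1)) + 3) ≤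
        G.dominatingMasks.card * (n * 5 + k * 3 + 12) := Nat.mul_le_mul_left _ (by omega)
    omega
  · rintro m' - ⟨he, ho⟩
    rw [List.take_length] at he ho
    rw [he, ho, hl', G.sum_dominatingList, G.sum_dominatingList]
    exact ⟨rfl, rfl⟩

/-- Decides `k`-colorability by inclusion and exclusion over the dominating sets. -/
def inclusionExclusion (k : ℕ) : Program :=
  computeMasks ;; listDominating ;; initTable ;; zetaTransform ;; sumPowers k ;;
  .store 0 (.const 0) (.const 1 - (Expr.var bEven).eqTest (.var bOdd))

theorem run_inclusionExclusion (hk : k ≠ 0) (hG : HoldsGraph G m)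
    (hW : (n + 1) * (k + 1) + 1 ≤ W) (hl : m bList = 0) (ht : m bTab = 0) :
    Run W (inclusionExclusion k) m
      ((n + 1) ^ 2 * (G.dominatingMasks.card + 1) * (60 + k * 3)) fun m' =>
        (m' 0 0 ≠ 0 ↔ G.Colorable k) := by
  have hW' : n + 2 ≤ W := by nlinarith
  have h1 := one_lt_two_pow_of hW'
  refine Run.le (Run.seq <| (run_computeMasks hG hW').mono le_rfl fun m₁ hf₁ h₁ _ =>
    Run.seq <| (run_listDominating (G := G) (hG.congr ?_ ?_) h₁ hW' ?_).mono le_rfl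
      fun m₂ hf₂ h₂ _ =>
    Run.seq <| (run_initTable (G := G) (n := n) ?_ ?_ hW' h₂ ?_).mono le_rfl fun m₃ hf₃ h₃ _ =>
    Run.seq <| (run_zetaTransform (G := G) (n := n) ?_ hW' (h₂.congr ?_ ?_) h₃).mono le_rfl
      fun m₄ hf₄ h₄ _ =>
    Run.seq <| (run_sumPowers (G := G) (n := n) ?_ hW (h₂.congr ?_ ?_) h₄).mono le_rfl
      fun m₅ hf₅ h₅ _ => Run.store ?_ ?_) ?_
  rotate_right
  · set D := G.dominatingMasks.card
    ring_nf
    nlinarith [Nat.zero_le (n * D), Nat.zero_le (n * D * k), Nat.zero_le (n ^ 2 * D),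
      Nat.zero_le (n ^ 2 * D * k), Nat.zero_le (n * k), Nat.zero_le (n ^ 2 * k), Nat.zero_le k,
      Nat.zero_le (n ^ 2), Nat.zero_le (D * k)]
  -- The facts `f₁` to `f₄` carry the contents of a bank past the stages that do not write to it.
  all_goals
    try have f₁ := fun b hb => hf₁ b (by
      simpa [computeMasks, computeMask, Program.writes] using hb)
    try have f₂ := fun b hb => hf₂ b (by
      simpa [listDominating, extendList, testMissed, Program.writes] using hb)
    try have f₃ := fun b hb => hf₃ b (by
      simpa [initTable, testIndep, Program.writes, Program.writes_forBits, Program.writes_forList]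
        using hb)
    try have f₄ := fun b hb => hf₄ b (by
      simpa [zetaTransform, Program.writes, Program.writes_forBits, Program.writes_forList]
        using hb)
  · exact f₁ 0 (by simp)
  · exact f₁ 1 (by simp)
  · rw [f₁ bList (by simp), hl]
  · rw [f₂ 0 (by simp), f₁ 0 (by simp), hG.size]
  · rw [f₂ bNbhd (by simp)]
    exact h₁
  · rw [f₂ bTab (by simp), f₁ bTab (by simp), ht]
  · rw [f₃ 0 (by simp), f₂ 0 (by simp), f₁ 0 (by simp), hG.size]
  · exact f₃ bList (by simp)
  · exact f₃ bLen (by simp)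
  · rw [f₄ 0 (by simp), f₃ 0 (by simp), f₂ 0 (by simp), f₁ 0 (by simp), hG.size]
  · rw [f₄ bList (by simp), f₃ bList (by simp)]
  · rw [f₄ bLen (by simp), f₃ bLen (by simp)]
  · rw [Expr.eval_sub, Expr.eval_const]
    omega
  · rw [G.colorable_iff_mask hk, ← h₅.1, ← h₅.2]
    by_cases h : m₅ bEven 0 = m₅ bOdd 0 <;> simp [h]

end RAM

/-! ### Guessing the colors of some vertices -/

/-- The number of elements of `S` below `v`. -/
def rankIn (S : Finset ℕ) (v : ℕ) : ℕ := (S.filter (· < v)).card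

theorem rankIn_succ_of_mem {S : Finset ℕ} {v : ℕ} (h : v ∈ S) :
    rankIn S (v + 1) = rankIn S v + 1 := by
  have : S.filter (· < v + 1) = insert v (S.filter (· < v)) := by
    ext u
    simp only [Finset.mem_filter, Finset.mem_insert, Nat.lt_succ_iff_lt_or_eq]
    constructor
    · rintro ⟨hu, h | h⟩
      · exact Or.inr ⟨hu, h⟩
      · exact Or.inl h
    · rintro (rfl | ⟨hu, h⟩)
      · exact ⟨h, Or.inr rfl⟩
      · exact ⟨hu, Or.inl h⟩
  rw [rankIn, this, Finset.card_insert_of_notMem (by simp), rankIn]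

theorem rankIn_succ_of_notMem {S : Finset ℕ} {v : ℕ} (h : v ∉ S) :
    rankIn S (v + 1) = rankIn S v := by
  rw [rankIn, rankIn]
  congr 1
  refine Finset.filter_congr fun u hu => ?_
  have : u ≠ v := by rintro rfl; exact h hu
  omega

theorem rankIn_mono (S : Finset ℕ) : Monotone (rankIn S) := fun _ _ h =>
  Finset.card_le_card (Finset.monotone_filter_right _ fun _ _ h' => lt_of_lt_of_le h' h)

theorem rankIn_eq_card {S : Finset ℕ} {n : ℕ} (h : S ⊆ Finset.range n) : rankIn S n = S.card := by
  rw [rankIn, Finset.filter_true_of_mem fun u hu => by simpa using h hu]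

/-- The color of `v` in the guess number `r`. -/
def guessedColor (S : Finset ℕ) (k r v : ℕ) : ℕ := r / k ^ rankIn S v % k

/-- The guess is the number whose base `k` digits are the colors of the elements of `S` in
increasing order; a new element adds a leading digit. -/
theorem exists_guess {S : Finset ℕ} {k : ℕ} (c : ℕ → ℕ) (hc : ∀ v, c v < k) (j : ℕ) :
    ∃ r < k ^ rankIn S j, ∀ v < j, v ∈ S → guessedColor S k r v = c v := by
  have hk : 0 < k := by have := hc 0; omega
  induction j with
  | zero => exact ⟨0, by positivity, by simp⟩
  | succ j ih =>
    obtain ⟨r, hr, h⟩ := ih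
    by_cases hj : j ∈ S
    · refine ⟨r + c j * k ^ rankIn S j, ?_, fun v hv hvS => ?_⟩
      · rw [rankIn_succ_of_mem hj, pow_succ]
        have := hc j
        calc r + c j * k ^ rankIn S j < (c j + 1) * k ^ rankIn S j := by linarith
          _ ≤ k * k ^ rankIn S j := Nat.mul_le_mul_right _ this
          _ = _ := mul_comm _ _
      · rcases Nat.lt_succ_iff_lt_or_eq.1 hv with hv | rfl
        · rw [← h v hv hvS, guessedColor, guessedColor]
          have h₁ : rankIn S v + 1 ≤ rankIn S j := by
            rw [← rankIn_succ_of_mem hvS]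
            exact rankIn_mono S hv
          obtain ⟨d, hd⟩ := Nat.exists_eq_add_of_le h₁
          -- The new digit stands strictly above the digit of `v`, so after division by `k ^ rankIn
          -- S v` it contributes a multiple of `k`.
          have h₂ : c j * k ^ rankIn S j = k * (c j * k ^ d) * k ^ rankIn S v := by
            rw [hd]
            ring
          rw [h₂, Nat.add_mul_div_right _ _ (by positivity), Nat.add_mul_mod_self_left]
        · rw [guessedColor, Nat.add_mul_div_right _ _ (by positivity), Nat.div_eq_of_lt hr,
            zero_add, Nat.mod_eq_of_lt (hc v)]
    · refine ⟨r, by rwa [rankIn_succ_of_notMem hj], fun v hv hvS => h v ?_ hvS⟩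
      rcases Nat.lt_succ_iff_lt_or_eq.1 hv with hv | rfl
      · exact hv
      · exact absurd hvS hj

namespace SimpleGraph
variable {n : ℕ} (G : SimpleGraph (Fin n)) (S : Finset ℕ) (k r : ℕ)

/-- The vertex `v` may get the color `c`, if the vertices in `S` get the guessed colors. -/
def Allowed (v c : ℕ) : Prop :=
  c < k ∧ (v ∈ S → guessedColor S k r v = c) ∧
    ∀ u < n, ¬ (G.NatAdj v u ∧ u ∈ S ∧ guessedColor S k r u = c)

open Classical in
/-- The lists of allowed colors. -/
noncomputable def guessLists (v : Fin n) : Finset (Fin ((k - 1) * n)) :=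
  Finset.univ.filter fun c => G.Allowed S k r v c

variable {G S k}

@[simp] theorem mem_guessLists {r : ℕ} {v : Fin n} {c : Fin ((k - 1) * n)} :
    c ∈ G.guessLists S k r v ↔ G.Allowed S k r v c := by simp [guessLists]

/-- A vertex of `S` keeps at most its guessed color, and `1 ≤ k - 1`. Any other vertex loses the
color of a neighbour in `S`. -/
theorem card_guessLists_le (hk : 2 ≤ k) (hS : S ⊆ Finset.range n)
    (hd : ∀ u < n, u ∉ S → ∃ s ∈ S, G.NatAdj u s) (r : ℕ) (v : Fin n) :
    (G.guessLists S k r v).card ≤ k - 1 := by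
  rw [← Finset.card_map Fin.valEmbedding]
  by_cases hv : (v : ℕ) ∈ S
  · refine (Finset.card_le_card (t := {guessedColor S k r v}) fun c hc => ?_).trans (by simp; omega)
    simp only [Finset.mem_map, mem_guessLists, Fin.valEmbedding_apply] at hc
    obtain ⟨c, hc, rfl⟩ := hc
    simpa using (hc.2.1 hv).symm
  · obtain ⟨s, hs, hadj⟩ := hd v v.2 hv
    have hlt : guessedColor S k r s < k := Nat.mod_lt _ (by omega)
    refine (Finset.card_le_card (t := (Finset.range k).erase (guessedColor S k r s))
      fun c hc => ?_).trans (by rw [Finset.card_erase_of_mem (by simpa using hlt)]; simp)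
    simp only [Finset.mem_map, mem_guessLists, Fin.valEmbedding_apply] at hc
    obtain ⟨c, hc, rfl⟩ := hc
    rw [Finset.mem_erase, Finset.mem_range]
    exact ⟨fun h => hc.2.2 s (by simpa using hS hs) ⟨hadj, hs, h.symm⟩, hc.1⟩

/-- The graph is `k`-colorable if and only if some guess extends to a coloring. -/
theorem colorable_iff_exists_guess (hk : 2 ≤ k) (hS : S ⊆ Finset.range n) (hn : n ≠ 1) :
    G.Colorable k ↔ ∃ r < k ^ S.card, ListColorable G (G.guessLists S k r) := by
  constructor
  · rintro ⟨c⟩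
    obtain ⟨r, hr, h⟩ := exists_guess (S := S)
      (fun v => if h : v < n then (c ⟨v, h⟩ : ℕ) else 0) (k := k) (fun v => by
        split
        · exact Fin.is_lt _
        · omega) n
    rw [rankIn_eq_card hS] at hr
    -- The palette of the list instance has `(k - 1) * n` names. It contains all `k` colors as soon
    -- as `n ≥ 2`, but not for `n = 1`.
    have hq : ∀ v, (c v : ℕ) < (k - 1) * n := fun v => by
      have h₁ := (c v).2
      have h₂ := v.2
      have h₃ : (k - 1) * 2 ≤ (k - 1) * n := Nat.mul_le_mul_left _ (by omega)
      omega
    refine ⟨r, hr, Coloring.mk (fun v => ⟨c v, hq v⟩) fun {u v} huv he => ?_, fun v => ?_⟩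
    · exact c.valid huv (Fin.ext (by simpa using he))
    · rw [mem_guessLists]
      refine ⟨(c v).2, fun hv => ?_, ?_⟩
      · rw [h v v.2 hv, dif_pos v.2]
        rfl
      · rintro u hu ⟨hadj, huS, he⟩
        rw [h u hu huS, dif_pos hu] at he
        exact c.valid hadj.2.2 (Fin.ext he.symm)
  · rintro ⟨r, -, c, hc⟩
    refine ⟨Coloring.mk (fun v => ⟨c v, (mem_guessLists.1 (hc v)).1⟩) fun {u v} huv he => ?_⟩
    exact c.valid huv (Fin.ext (by simpa using he))

theorem exists_guessLists_iff {r a : ℕ} :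
    (∃ (v : Fin n) (c : Fin ((k - 1) * n)), c ∈ G.guessLists S k r v ∧
      a = (v : ℕ) * ((k - 1) * n) + (c : ℕ)) ↔
    a < n * ((k - 1) * n) ∧ G.Allowed S k r (a / ((k - 1) * n)) (a % ((k - 1) * n)) := by
  set q := (k - 1) * n with hq
  constructor
  · rintro ⟨v, c, hc, rfl⟩
    have h₁ : ((v : ℕ) * q + c) / q = v := by
      rw [mul_comm, Nat.mul_add_div (by have := c.2; omega), Nat.div_eq_of_lt c.2, add_zero]
    have h₂ : ((v : ℕ) * q + c) % q = c := by
      rw [Nat.mul_add_mod_self_right, Nat.mod_eq_of_lt c.2]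
    rw [h₁, h₂]
    refine ⟨?_, mem_guessLists.1 hc⟩
    calc (v : ℕ) * q + c < ((v : ℕ) + 1) * q := by have := c.2; linarith
      _ ≤ n * q := Nat.mul_le_mul_right _ v.2
  · rintro ⟨h₁, h₂⟩
    replace h₁ : a < n * q := h₁
    have hq0 : 0 < q := Nat.pos_of_ne_zero fun h => by
      rw [h, mul_zero] at h₁
      exact absurd h₁ (Nat.not_lt_zero _)
    refine ⟨⟨a / q, Nat.div_lt_of_lt_mul (by rwa [mul_comm])⟩, ⟨a % q, Nat.mod_lt _ hq0⟩,
      mem_guessLists.2 h₂, ?_⟩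
    exact (Nat.div_add_mod' a q).symm

end SimpleGraph

namespace RAM
variable {n W s k R r : ℕ} {G : SimpleGraph (Fin n)} {m : Mem} {p : Program} {S : Finset ℕ}

/-- The number of guesses. -/
notation "bR" => 20
/-- The number of the current guess. -/
notation "bGuess" => 21
/-- The remaining digits of the guess. -/
notation "bDigits" => 22
/-- The guessed colors. -/
notation "bColor" => 23
/-- The number of colors of the list coloring instance. -/
notation "bPalette" => 24
/-- The answer. -/
notation "bAnswer" => 25

/-- Computes the guessed colors. -/
def guessColors (k : ℕ) : Program :=
  .store bDigits (.const 0) (.var bGuess) ;;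
  .forLoop bV (.var 0)
    (.store bColor (.var bV) (.var bDigits % .const k) ;;
    .cond (.load bMark (.var bV)) (.store bDigits (.const 0) (.var bDigits / .const k)) .skip)

theorem run_guessColors (hn : m 0 0 = n) (hW : n + 2 ≤ W) (hr : r < 2 ^ W) (hmr : m bGuess 0 = r)
    (hS : ∀ u < n, m bMark u = truth (u ∈ S)) :
    Run W (guessColors k) m (3 + n * 5) fun m' => ∀ v < n, m' bColor v = guessedColor S k r v := by
  have hn' := lt_two_pow_of_add_two_le hW
  refine (Run.store_seq (by rwa [Expr.eval_var, hmr]) (Run.forLoop (s := 1 + (1 + 1)) n (fun j m' =>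
    m' bDigits 0 = r / k ^ rankIn S j ∧ ∀ v < j, m' bColor v = guessedColor S k r v)
    (by omega) (by simp [Program.writes]) (by simp [hmr, rankIn]) ?_ ?_)).mono (by omega)
    fun _ _ h => h.2
  · intro j hj m' hf _
    simp [hf 0 (by simp [Program.writes]), hn]
  · rintro j hj m' hf hij ⟨hd, hc⟩
    have hm : m' bMark j = truth (j ∈ S) := by
      simp [hf bMark (by simp [Program.writes]), hS j hj]
    have hnew : ∀ v < j + 1,
        (m'.write bColor j (r / k ^ rankIn S j % k)) bColor v = guessedColor S k r v := by
      intro v hv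
      rw [Mem.write_self, Function.update_apply]
      split_ifs with h
      · rw [h, guessedColor]
      · exact hc v (by omega)
    refine Run.store_seq ?_ ?_
    · simp only [Expr.eval_mod, Expr.eval_var, Expr.eval_const, hd]
      exact ((Nat.mod_le _ _).trans (Nat.div_le_self _ _)).trans_lt hr
    · simp only [Expr.eval_mod, Expr.eval_var, Expr.eval_const, hd, hij]
      refine Run.cond (s := 1) ?_ ?_ <;> intro hcond <;>
        simp only [Expr.eval_load, Expr.eval_var, ne_eq, Nat.reduceEqDiff, not_false_eq_true,
          Mem.write_of_ne, hij, hm, truth_eq_zero, not_not] at hcond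
      · refine Run.store ?_ ⟨?_, ?_⟩
        · simp only [Expr.eval_div, Expr.eval_var, ne_eq, Nat.reduceEqDiff, not_false_eq_true,
            Mem.write_of_ne, hd, Expr.eval_const]
          exact ((Nat.div_le_self _ _).trans (Nat.div_le_self _ _)).trans_lt hr
        · simp [hd, rankIn_succ_of_mem hcond, Nat.div_div_eq_div_mul, pow_succ]
        · simpa using hnew
      · refine Run.skip ⟨?_, ?_⟩
        · simp [hd, rankIn_succ_of_notMem hcond]
        · simpa using hnew

/-! ### Writing the input of the stamped program -/

/-- The part of a bank with stamp `r`. -/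
def slice (f : ℕ → ℕ) (R r : ℕ) : ℕ → ℕ := fun a => f (a * R + r)

theorem slice_update_self (f : ℕ → ℕ) (hr : r < R) (a x : ℕ) :
    slice (Function.update f (a * R + r) x) R r = Function.update (slice f R r) a x := by
  funext a'
  simp only [slice, Function.update_apply]
  congr 1
  simp only [add_left_inj, mul_eq_mul_right_iff, eq_iff_iff]
  exact or_iff_left (by omega)

theorem slice_update_ne (f : ℕ → ℕ) {r' : ℕ} (hr : r < R) (hr' : r' < R) (h : r' ≠ r) (a x : ℕ) :
    slice (Function.update f (a * R + r) x) R r' = slice f R r' := by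
  funext a'
  simp only [slice, Function.update_apply]
  rw [if_neg]
  intro he
  have hmod := congrArg (· % R) he
  simp only [Nat.mul_add_mod_self_right, Nat.mod_eq_of_lt hr', Nat.mod_eq_of_lt hr] at hmod
  exact h hmod

/-- Fills the first `N` cells of the current slice of bank `b`. -/
def Program.fill (b : ℕ) (N : Expr) (p : Program) (val : Expr) : Program :=
  .forLoop bI N (p ;; .store b ((Expr.var bI).stampAddr bR bGuess) val)

theorem Program.writes_fill (b : ℕ) (N : Expr) (p : Program) (val : Expr) :
    (Program.fill b N p val).writes = bI :: ((p.writes ++ [b]) ++ [bI]) := rfl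

/-- The slice is empty at the start, so only its first `N` cells need to be written. The bound `32 ≤
b` keeps the target away from the banks of the loop variable, the stamp and the modulus. -/
theorem Run.fill {b N : ℕ} {e val : Expr} (hN : N < 2 ^ W) (hb : 32 ≤ b)
    (hp : bI ∉ p.writes ∧ b ∉ p.writes ∧ bR ∉ p.writes ∧ bGuess ∉ p.writes)
    (hR : m bR 0 = R) (hmr : m bGuess 0 = r) (hr : r < R) (h₀ : slice (m b) R r = 0)
    (g : ℕ → ℕ) (hg : ∀ i < N, g i < 2 ^ W) (hg₀ : ∀ i, N ≤ i → g i = 0)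
    (he : ∀ m', (∀ b' ∉ bI :: b :: p.writes, m' b' = m b') → e.eval m' = N)
    (hstep : ∀ i < N, ∀ m', (∀ b' ∉ bI :: b :: p.writes, m' b' = m b') → m' bI 0 = i →
      Run W p m' s fun m'' => val.eval m'' = g i) :
    Run W (.fill b e p val) m (2 + N * (s + 3)) fun m' => slice (m' b) R r = g ∧
      ∀ r' < R, r' ≠ r → slice (m' b) R r' = slice (m b) R r' := by
  have hbI : b ≠ bI := by omega
  have hmem : ∀ b', b' ∉ bI :: b :: p.writes →
      b' ∉ bI :: (p ;; .store b ((Expr.var bI).stampAddr bR bGuess) val).writes := by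
    intro b' h
    simp only [List.mem_cons, not_or] at h
    simp [Program.writes, h]
  refine (Run.forLoop (s := s + 1) N (fun j m' =>
    slice (m' b) R r = (fun a => if a < j then g a else 0) ∧
      ∀ r' < R, r' ≠ r → slice (m' b) R r' = slice (m b) R r') hN
      (by simp [Program.writes, hp]; omega) ?_ ?_ ?_).mono (by exact le_rfl) ?_
  · rw [Mem.write_of_ne _ _ _ hbI, h₀]
    exact ⟨by funext a; simp, fun _ _ _ => rfl⟩
  · exact fun j _ m' hf _ => he m' fun b' hb' => hf b' (hmem b' hb')
  · rintro j hj m' hf hij ⟨h₁, h₂⟩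
    refine Run.seq ((hstep j hj m' (fun b' hb' => hf b' (hmem b' hb')) hij).mono le_rfl
      fun m₁ hf₁ hv _ => Run.store ?_ ?_)
    · rw [hv]
      exact hg j hj
    · have ha : ((Expr.var bI).stampAddr bR bGuess).eval m₁ = j * R + r := by
        simp only [Expr.stampAddr, Expr.eval_add, Expr.eval_mul, Expr.eval_var]
        rw [hf₁ bI hp.1, hij, hf₁ bR hp.2.2.1, hf₁ bGuess hp.2.2.2,
          hf bR (hmem _ (by simp [hp]; omega)), hf bGuess (hmem _ (by simp [hp]; omega)), hR, hmr]
      rw [ha, hv, Mem.write_of_ne _ _ _ hbI, Mem.write_self, hf₁ b hp.2.1]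
      refine ⟨?_, fun r' hr' hne => ?_⟩
      · rw [slice_update_self _ hr, h₁]
        funext a
        rw [Function.update_apply]
        rcases lt_trichotomy a j with h | rfl | h
        · simp [h, h.ne, h.trans (Nat.lt_succ_self j)]
        · simp
        · rw [if_neg h.ne', if_neg (by omega), if_neg (by omega)]
      · rw [slice_update_ne _ hr hr' hne, h₂ r' hr' hne]
  · rintro m' - ⟨h₁, h₂⟩
    refine ⟨?_, h₂⟩
    rw [h₁]
    funext a
    split_ifs with h
    · rfl
    · exact (hg₀ a (not_lt.1 h)).symm

theorem Expr.eval_ltTest_le (m : Mem) (x y : Expr) : (x.ltTest y).eval m ≤ 1 := by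
  rw [Expr.eval_ltTest]
  split <;> simp

/-- Computes whether the vertex and the color with the combined number `bI` are allowed. -/
def listEntry (k : ℕ) : Program :=
  .store bV (.const 0) (.var bI / .var bPalette) ;;
  .store bX (.const 0) (.var bI % .var bPalette) ;;
  .store bFlag (.const 0) ((Expr.var bX).ltTest (.const k) *
    (.const 1 - .load bMark (.var bV) *
      (.const 1 - (Expr.load bColor (.var bV)).eqTest (.var bX)))) ;;
  .forLoop bU (.var 0)
    (.store bFlag (.const 0) (.var bFlag * (.const 1 - adjExpr * (.load bMark (.var bU) *
      (Expr.load bColor (.var bU)).eqTest (.var bX)))))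

theorem run_listEntry (hG : HoldsGraph G m) (hW : n + 2 ≤ W) {q i : ℕ} (hi : i < n * q)
    (hiW : i < 2 ^ W) (hq : m bPalette 0 = q) (hmi : m bI 0 = i)
    (hS : ∀ u < n, m bMark u = truth (u ∈ S))
    (hc : ∀ v < n, m bColor v = guessedColor S k r v) :
    Run W (listEntry k) m (5 + n * 3) fun m' =>
      m' bFlag 0 = truth (G.Allowed S k r (i / q) (i % q)) := by
  have hn' := lt_two_pow_of_add_two_le hW
  have h1 := one_lt_two_pow_of hW
  have hv : i / q < n := Nat.div_lt_of_lt_mul (by rwa [mul_comm])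
  refine (Run.store_seq ?_ (Run.store_seq ?_ (Run.store_seq ?_ (Run.forLoop (s := 1) n (fun j m' =>
    m' bFlag 0 = truth ((i % q < k ∧ (i / q ∈ S → guessedColor S k r (i / q) = i % q)) ∧
      ∀ u < j, ¬ (G.NatAdj (i / q) u ∧ u ∈ S ∧ guessedColor S k r u = i % q)))
    (by omega) (by simp [Program.writes]) ?_ ?_ ?_)))).mono (by omega) ?_
  · simp only [Expr.eval_div, Expr.eval_var, hmi, hq]
    exact (Nat.div_le_self _ _).trans_lt hiW
  · simp only [Expr.eval_mod, Expr.eval_var, ne_eq, Nat.reduceEqDiff, not_false_eq_true,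
      Mem.write_of_ne, hmi, hq]
    exact (Nat.mod_le _ _).trans_lt hiW
  · refine lt_of_le_of_lt ?_ h1
    rw [Expr.eval_mul, Expr.eval_sub]
    exact Nat.mul_le_mul (Expr.eval_ltTest_le _ _ _) (Nat.sub_le 1 _)
  · simp [hmi, hq, hS _ hv, hc _ hv, ← truth_eq_ite, one_sub_truth, truth_mul]
  · intro j _ m' hf _
    simp [hf 0 (by simp [Program.writes]), hG.size]
  · intro j hj m' hf hij hI
    have hG' : HoldsGraph G m' := hG.congr (by simp [hf 0 (by simp [Program.writes])])
      (by simp [hf 1 (by simp [Program.writes])])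
    have h3 : m' bMark j = truth (j ∈ S) := by
      simp [hf bMark (by simp [Program.writes]), hS j hj]
    have h5 : m' bV 0 = i / q := by simp [hf bV (by simp [Program.writes]), hmi, hq]
    have h13 : m' bX 0 = i % q := by simp [hf bX (by simp [Program.writes]), hmi, hq]
    have h23 : m' bColor j = guessedColor S k r j := by
      simp [hf bColor (by simp [Program.writes]), hc j hj]
    have he : (Expr.var bFlag * (.const 1 - adjExpr * (.load bMark (.var bU) *
        (Expr.load bColor (.var bU)).eqTest (.var bX)))).eval m' =
        truth ((i % q < k ∧ (i / q ∈ S → guessedColor S k r (i / q) = i % q)) ∧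
          ∀ u < j + 1, ¬ (G.NatAdj (i / q) u ∧ u ∈ S ∧ guessedColor S k r u = i % q)) := by
      simp only [Expr.eval_mul, Expr.eval_var, Expr.eval_sub, Expr.eval_const,
        adjExpr_eval hG' hv hj h5 hij, Expr.eval_load, Expr.eval_eqTest, hI, hij, h3, h23, h13,
        ← truth_eq_ite, truth_mul, one_sub_truth]
      refine truth_congr ?_
      rw [Nat.forall_lt_succ_right, and_assoc]
    refine Run.store ?_ ?_
    · rw [he]
      exact truth_lt h1
    · simp [he]
  · intro m' _ h
    rw [h]
    exact truth_congr (by rw [SimpleGraph.Allowed, and_assoc])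

/-- Writes the list coloring instance for the current guess into the current slice. -/
def prepare (k : ℕ) : Program :=
  guessColors k ;;
  .fill 32 (.const 1) .skip (.var 0) ;;
  .fill 33 (.var 0 * .var 0) .skip (.load 1 (.var bI)) ;;
  .fill 34 (.var 0 * .var bPalette) (listEntry k) (.var bFlag)

theorem holdsGraph_of_eq (h₀ : m 0 0 = n) (h₁ : m 1 = graphInput G 1) : HoldsGraph G m := by
  classical
  refine ⟨h₀, fun u hu v hv => ?_⟩
  rw [h₁, graphInput, if_neg (by simp), truth_eq_ite]
  refine if_congr ?_ rfl rfl
  constructor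
  · rintro ⟨-, u', v', hadj, h⟩
    have hu' : u = u' := by
      have h' := congrArg (· / n) h
      have hn : 0 < n := by omega
      simpa [mul_comm _ n, Nat.mul_add_div hn, Nat.div_eq_of_lt hv, Nat.div_eq_of_lt v'.2] using h'
    have hv' : v = v' := by
      have h' := congrArg (· % n) h
      simpa [Nat.mul_add_mod_self_right, Nat.mod_eq_of_lt hv, Nat.mod_eq_of_lt v'.2] using h'
    rw [hu', hv']
    simpa using hadj
  · rintro ⟨hu, hv, hadj⟩
    exact ⟨rfl, ⟨u, hu⟩, ⟨v, hv⟩, hadj, rfl⟩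

theorem graphInput_one_le (a : ℕ) : graphInput G 1 a ≤ 1 := by
  unfold graphInput
  rw [if_neg (by simp)]
  split <;> simp

theorem graphInput_one_eq_zero {a : ℕ} (h : n * n ≤ a) : graphInput G 1 a = 0 := by
  unfold graphInput
  rw [if_neg (by simp), if_neg]
  rintro ⟨-, u, v, -, rfl⟩
  have hu := u.2
  have hv := v.2
  nlinarith

/-- After the three fills the slice is the complete initial memory of a list coloring run, including
its zeros: slices of the remaining high banks were empty before and stay so. -/
theorem run_prepare (h₀ : m 0 0 = n) (h₁ : m 1 = graphInput G 1) (hW : n + 2 ≤ W)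
    (hbig : n * ((k - 1) * n) < 2 ^ W) (hbig' : n * n < 2 ^ W) (hR : m bR 0 = R)
    (hRW : R < 2 ^ W)
    (hmr : m bGuess 0 = r) (hr : r < R) (hq : m bPalette 0 = (k - 1) * n)
    (hS : ∀ u < n, m bMark u = truth (u ∈ S)) (hz : ∀ b, 32 ≤ b → slice (m b) R r = 0) :
    Run W (prepare k) m (20 + n * 5 + n * n * 4 + n * ((k - 1) * n) * (n * 3 + 8)) fun m' =>
      (∀ b a, m' (b + 32) (a * R + r) = listInput G (G.guessLists S k r) b a) ∧
      ∀ b, 32 ≤ b → ∀ r' < R, r' ≠ r → slice (m' b) R r' = slice (m b) R r' := by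
  classical
  have hn' := lt_two_pow_of_add_two_le hW
  have h1 := one_lt_two_pow_of hW
  have hmin : ∀ i, i < n * n → graphInput G 1 i < 2 ^ W :=
    fun i _ => (graphInput_one_le i).trans_lt h1
  set q := (k - 1) * n with hqdef
  refine Run.le (Run.seq <| (run_guessColors (k := k) h₀ hW (hr.trans hRW) hmr hS).mono le_rfl
    fun m₁ hf₁ hc₁ _ =>
    Run.seq <| (Run.fill (s := 1) (N := 1) (R := R) (r := r) h1 le_rfl (by simp [Program.writes])
      ?_ ?_ hr ?_ (fun a => if a = 0 then n else 0) ?_ ?_ (by simp) ?_).mono le_rfl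
    fun m₂ hf₂ hs₂ _ =>
    Run.seq <| (Run.fill (s := 1) (N := n * n) (R := R) (r := r) hbig' (by simp)
      (by simp [Program.writes]) ?_ ?_ hr ?_ (graphInput G 1) hmin
      (fun i hi => graphInput_one_eq_zero hi) ?_ ?_).mono le_rfl fun m₃ hf₃ hs₃ _ =>
    (Run.fill (s := 5 + n * 3) (N := n * q) (R := R) (r := r) hbig (by simp)
      (by simp [Program.writes, listEntry]) ?_ ?_ hr ?_
      (fun a => truth (a < n * q ∧ G.Allowed S k r (a / q) (a % q)))
      (fun _ _ => truth_lt h1) (fun i hi => truth_of_not fun h => absurd h.1 (not_lt.2 hi))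
      ?_ ?_).mono le_rfl fun m₄ hf₄ hs₄ => ?_) ?_
  rotate_right
  · rw [hqdef]
    have : n * ((k - 1) * n) * (5 + n * 3 + 3) = n * ((k - 1) * n) * (n * 3 + 8) := by ring
    omega
  all_goals
    try have f₁ := fun b hb => hf₁ b (by simpa [guessColors, Program.writes] using hb)
    try have f₂ := fun b hb => hf₂ b (by simpa [Program.writes_fill, Program.writes] using hb)
    try have f₃ := fun b hb => hf₃ b (by simpa [Program.writes_fill, Program.writes] using hb)
    try have f₄ := fun b hb => hf₄ b (by
      simpa [Program.writes_fill, listEntry, Program.writes] using hb)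
  · rw [f₁ bR (by simp), hR]
  · rw [f₁ bGuess (by simp), hmr]
  · rw [f₁ 32 (by simp), hz 32 le_rfl]
  · intro i _
    split_ifs <;> omega
  · intro i hi
    rw [if_neg (by omega)]
  · intro i hi m' hf hi'
    refine Run.skip ?_
    rw [Expr.eval_var, hf 0 (by simp [Program.writes]), f₁ 0 (by simp), h₀, if_pos (by omega)]
  · rw [f₂ bR (by simp), f₁ bR (by simp), hR]
  · rw [f₂ bGuess (by simp), f₁ bGuess (by simp), hmr]
  · rw [f₂ 33 (by simp), f₁ 33 (by simp), hz 33 (by simp)]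
  · intro m' hf
    simp only [Expr.eval_mul, Expr.eval_var]
    rw [hf 0 (by simp [Program.writes]), f₂ 0 (by simp), f₁ 0 (by simp), h₀]
  · intro i hi m' hf hi'
    refine Run.skip ?_
    rw [Expr.eval_load, Expr.eval_var, hi', hf 1 (by simp [Program.writes]), f₂ 1 (by simp),
      f₁ 1 (by simp), h₁]
  · rw [f₃ bR (by simp), f₂ bR (by simp), f₁ bR (by simp), hR]
  · rw [f₃ bGuess (by simp), f₂ bGuess (by simp), f₁ bGuess (by simp), hmr]
  · rw [f₃ 34 (by simp), f₂ 34 (by simp), f₁ 34 (by simp), hz 34 (by simp)]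
  · intro m' hf
    simp only [Expr.eval_mul, Expr.eval_var]
    rw [hf 0 (by simp [Program.writes, listEntry]), hf bPalette (by simp [Program.writes, listEntry]),
      f₃ 0 (by simp), f₂ 0 (by simp), f₁ 0 (by simp), h₀, f₃ bPalette (by simp),
      f₂ bPalette (by simp), f₁ bPalette (by simp), hq]
  · intro i hi m' hf hi'
    refine (run_listEntry (k := k) (r := r) (S := S) (holdsGraph_of_eq (G := G) ?_ ?_) hW hi
      (hi.trans hbig) ?_ hi' ?_ ?_).mono le_rfl fun m'' _ h => ?_
    · rw [hf 0 (by simp [Program.writes, listEntry]), f₃ 0 (by simp), f₂ 0 (by simp),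
        f₁ 0 (by simp), h₀]
    · rw [hf 1 (by simp [Program.writes, listEntry]), f₃ 1 (by simp), f₂ 1 (by simp),
        f₁ 1 (by simp), h₁]
    · rw [hf bPalette (by simp [Program.writes, listEntry]), f₃ bPalette (by simp),
        f₂ bPalette (by simp), f₁ bPalette (by simp), hq]
    · rw [hf bMark (by simp [Program.writes, listEntry]), f₃ bMark (by simp),
        f₂ bMark (by simp), f₁ bMark (by simp)]
      exact hS
    · rw [hf bColor (by simp [Program.writes, listEntry]), f₃ bColor (by simp),
        f₂ bColor (by simp)]
      exact hc₁
    · rw [Expr.eval_var, h]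
      exact truth_congr (by simp [hi])
  · refine ⟨fun b a => ?_, fun b hb r' hr' hne => ?_⟩
    · change slice (m₄ (b + 32)) R r a = _
      rcases b with _ | _ | _ | b
      · rw [f₄ _ (by simp), f₃ _ (by simp), hs₂.1]
        by_cases ha : a = 0 <;> simp [listInput, graphInput, ha]
      · rw [f₄ _ (by simp), hs₃.1]
        simp [listInput]
      · rw [hs₄.1, listInput, if_pos rfl]
        exact truth_eq_ite.trans (if_congr SimpleGraph.exists_guessLists_iff.symm rfl rfl)
      · rw [f₄ _ (by simp), f₃ _ (by simp), f₂ _ (by simp),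
          f₁ _ (by simp), hz _ (by omega)]
        simp [listInput, graphInput]
    · by_cases h32 : b = 32
      · subst h32
        rw [f₄ _ (by simp), f₃ _ (by simp), hs₂.2 r' hr' hne, f₁ _ (by simp)]
      by_cases h33 : b = 33
      · subst h33
        rw [f₄ _ (by simp), hs₃.2 r' hr' hne, f₂ _ (by simp), f₁ _ (by simp)]
      by_cases h34 : b = 34
      · subst h34
        rw [hs₄.2 r' hr' hne, f₃ _ (by simp), f₂ _ (by simp), f₁ _ (by simp)]
      · rw [f₄ _ (by omega), f₃ _ (by omega), f₂ _ (by omega),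
          f₁ _ (by omega)]

end RAM

/-! ### Extending the guesses with a list coloring program -/

namespace RAM
variable {n N W s k R r : ℕ} {G : SimpleGraph (Fin n)} {m : Mem} {p : Program} {S : Finset ℕ}

theorem Run.exec {Q : Mem → Prop} (h : Run W p m s Q) (hp : p.ReadsBelow N)
    (hm : m.Bounded N W) : ∃ t ≤ s * (p.weight * (W + 1)), ∃ m', Exec p m t m' ∧
      m'.Bounded N W ∧ (∀ b ∉ p.writes, m' b = m b) ∧ Q m' := by
  obtain ⟨t, ht, m', he, hQ⟩ := h
  obtain ⟨hb, t', ht', he'⟩ := he.exec hp hm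
  exact ⟨t', ht'.trans (Nat.mul_le_mul_right _ ht), m', he', hb, he.frame, hQ⟩

/-- Computes the number of guesses and the number of colors. -/
def countGuesses (k : ℕ) : Program :=
  .store bR (.const 0) (.const 1) ;;
  .forLoop bV (.var 0)
    (.cond (.load bMark (.var bV)) (.store bR (.const 0) (.var bR * .const k)) .skip) ;;
  .store bPalette (.const 0) (.const (k - 1) * .var 0)

theorem run_countGuesses (hk : 2 ≤ k) (hn : m 0 0 = n) (hW : n + 2 ≤ W)
    (hkW : k ^ n < 2 ^ W) (hbig : (k - 1) * n < 2 ^ W)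
    (hS : ∀ u < n, m bMark u = truth (u ∈ S)) (hSn : S ⊆ Finset.range n) :
    Run W (countGuesses k) m (4 + n * 4) fun m' =>
      m' bR 0 = k ^ S.card ∧ m' bPalette 0 = (k - 1) * n := by
  have hn' := lt_two_pow_of_add_two_le hW
  have h1 := one_lt_two_pow_of hW
  have hle : ∀ j ≤ n, k ^ rankIn S j < 2 ^ W := fun j hj => by
    refine (Nat.pow_le_pow_right (by omega) ?_).trans_lt hkW
    calc rankIn S j ≤ (Finset.range j).card := Finset.card_le_card fun u hu => by
          simpa using (Finset.mem_filter.1 hu).2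
      _ ≤ n := by simpa using hj
  refine Run.le (Run.store_seq (by simpa using h1) <| Run.seq <|
    (Run.forLoop (s := 2) n (fun j m' => m' bR 0 = k ^ rankIn S j)
    (by omega) (by simp [Program.writes]) (by simp [rankIn]) ?_ ?_).mono le_rfl
    fun m₁ hf₁ h₁ _ => Run.store (by
      simpa [hf₁ 0 (by simp [Program.writes]), hn] using hbig) ⟨?_, ?_⟩)
    (show _ ≤ _ by omega)
  · intro j hj m' hf _
    simp [hf 0 (by simp [Program.writes]), hn]
  · intro j hj m' hf hij hI
    have hm : m' bMark j = truth (j ∈ S) := by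
      simp [hf bMark (by simp [Program.writes]), hS j hj]
    refine (Run.cond (s := 1) (fun hc => ?_) fun hc => ?_).le (by omega) <;>
      simp only [Expr.eval_load, Expr.eval_var, hij, hm, ne_eq, truth_eq_zero, not_not] at hc
    · have hr : k ^ rankIn S j * k = k ^ rankIn S (j + 1) := by
        rw [rankIn_succ_of_mem hc, pow_succ]
      refine Run.store ?_ ?_
      · simpa [hI, hr] using hle (j + 1) hj
      · simp [hI, hr]
    · refine Run.skip ?_
      simp [hI, rankIn_succ_of_notMem hc]
  · simp [h₁, rankIn_eq_card hSn]
  · simp [hf₁ 0 (by simp [Program.writes]), hn]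

/-- Tests whether the current guess extends to a coloring. -/
def tryGuess (k : ℕ) (A : Program) : Program :=
  prepare k ;; A.stamp 32 bR bGuess ;;
    .cond (.load 32 (.var bGuess)) (.store bAnswer (.const 0) (.const 1)) .skip

/-- Decides `k`-colorability with a program for `(k - 1)`-list coloring. -/
def guessAndExtend (k : ℕ) (A : Program) : Program :=
  countGuesses k ;; .forLoop bGuess (.var bR) (tryGuess k A) ;;
    .store 0 (.const 0) (.var bAnswer)

theorem readsBelow_prepare (k : ℕ) : (prepare k).ReadsBelow 32 := by
  repeat' first | exact trivial | decide | refine ⟨?_, ?_⟩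

theorem readsBelow_countGuesses (k : ℕ) : (countGuesses k).ReadsBelow 32 := by
  repeat' first | exact trivial | decide | refine ⟨?_, ?_⟩

theorem readsBelow_chooseVertices (k : ℕ) : (chooseVertices k).ReadsBelow 32 := by
  repeat' first | exact trivial | decide | refine ⟨?_, ?_⟩

theorem readsBelow_inclusionExclusion (k : ℕ) : (inclusionExclusion k).ReadsBelow 32 := by
  repeat' first | exact trivial | decide | refine ⟨?_, ?_⟩

/-- The situation before guess `j`: so far the answer is whether one of the previous guesses
extends to a coloring. -/
structure Guessing (G : SimpleGraph (Fin n)) (S : Finset ℕ) (k R W j : ℕ) (m : Mem) : Prop where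
  bounded : m.Bounded 32 W
  size : m 0 0 = n
  graph : m 1 = graphInput G 1
  mark : ∀ u < n, m bMark u = truth (u ∈ S)
  number : m bR 0 = R
  palette : m bPalette 0 = (k - 1) * n
  index : m bGuess 0 = j
  empty : ∀ b, 32 ≤ b → ∀ r < R, j ≤ r → slice (m b) R r = 0
  answer : m bAnswer 0 ≠ 0 ↔ ∃ r < j, ListColorable G (G.guessLists S k r)

theorem prepare_writes_notMem (k : ℕ) :
    0 ∉ (prepare k).writes ∧ 1 ∉ (prepare k).writes ∧ bMark ∉ (prepare k).writes ∧
    bR ∉ (prepare k).writes ∧ bPalette ∉ (prepare k).writes ∧ bGuess ∉ (prepare k).writes ∧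
    bAnswer ∉ (prepare k).writes ∧ ∀ b, 35 ≤ b → b ∉ (prepare k).writes := by
  refine ⟨?_, ?_, ?_, ?_, ?_, ?_, ?_, fun b hb => ?_⟩ <;>
    simp [prepare, guessColors, listEntry, Program.writes, Program.writes_fill]
  omega

/-- The number of elementary steps of the preparation of a list coloring instance. -/
def prepareSteps (k n : ℕ) : ℕ := 20 + n * 5 + n * n * 4 + n * ((k - 1) * n) * (n * 3 + 8)

/-- The program `A` may store numbers of more than `W` bits, so the cost is tracked directly from
here on. The simulation contributes `8 * T` and reading its answer at most one more `T`, up to the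
factor `W + 1` and lower terms. -/
theorem Guessing.exec_tryGuess {A : Program} {T j : ℕ} (h : Guessing G S k R W j m) (hj : j < R)
    (hRW : R < 2 ^ W) (hW : n + 2 ≤ W) (hbig : n * ((k - 1) * n) < 2 ^ W) (hbig' : n * n < 2 ^ W)
    (hA : Decides A (listInput G (G.guessLists S k j)) T
      (ListColorable G (G.guessLists S k j))) :
    ∃ t ≤ (prepareSteps k n * (prepare k).weight + 9 * T + 9) * (W + 1), ∃ m',
      Exec (tryGuess k A) m t m' ∧
        Guessing G S k R W (j + 1) (m'.write bGuess 0 (j + 1)) ∧ m'.Bounded 32 W ∧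
        m' bGuess 0 = j := by
  have hn' := lt_two_pow_of_add_two_le hW
  have h1 := one_lt_two_pow_of hW
  obtain ⟨t₁, ht₁, m₁, he₁, hb₁, hf₁, hc₁, hs₁⟩ := (run_prepare h.size h.graph hW hbig hbig'
    h.number hRW h.index hj h.palette h.mark fun b hb => h.empty b hb j hj le_rfl).exec
    (readsBelow_prepare k) h.bounded
  obtain ⟨w0, w1, wM, wR, wP, wG, wA, -⟩ := prepare_writes_notMem k
  have hst : Stamped 32 bR bGuess R j m₁ (listInput G (G.guessLists S k j)) :=
    ⟨by rw [hf₁ _ wR, h.number], by rw [hf₁ _ wG, h.index], hj, by simp, by simp, hc₁⟩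
  obtain ⟨t, l, hAe, ht, hans⟩ := hA
  obtain ⟨t₂, ht₂, m₂, he₂, hst₂, hf₂, hs₂⟩ := hst.exec hAe
  have hb₂ : m₂.Bounded 32 W := fun b hb a => by
    rw [hf₂ b hb]
    exact hb₁ b hb a
  have hG₂ : m₂ bGuess 0 = j := hst₂.index
  have hval : (Expr.load 32 (.var bGuess)).eval m₂ = l 0 0 := by
    simpa [hG₂] using hst₂.cell 0 0
  -- The answer cell of `A` may hold a large number, but its number of bits exceeds that of the
  -- input by at most the running time.
  have hcost : (Expr.load 32 (.var bGuess)).cost m₂ ≤ 4 + 3 * W + T := by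
    have hl : (l 0 0).size ≤ W + T := by
      refine (hAe.size_le 0 0).trans (add_le_add ?_ ht)
      simpa [listInput, graphInput] using Nat.size_le.2 (show n < 2 ^ W by omega)
    have hjW : j.size ≤ W := Nat.size_le.2 (hj.trans hRW)
    have := hst₂.cell 0 0
    simp only [Nat.zero_add, Nat.zero_mul] at this
    simp only [Expr.cost, Expr.var, Expr.eval, hG₂, this, Nat.size_zero]
    omega
  have hRs : R.size ≤ W := Nat.size_le.2 hRW
  have hframe : ∀ b < 32, b ∉ (prepare k).writes → m₂ b = m b := fun b hb hbw => by
    rw [hf₂ b hb, hf₁ b hbw]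
  have hempty : ∀ b, 32 ≤ b → ∀ r < R, j + 1 ≤ r → slice (m₂ b) R r = 0 := by
    intro b hb r hr hjr
    rw [← h.empty b hb r hr (by omega), ← hs₁ b hb r hr (by omega)]
    obtain ⟨b, rfl⟩ := Nat.exists_eq_add_of_le' hb
    funext a
    exact hs₂ _ a r hr (by omega)
  have hA₂ : m₂ bAnswer 0 ≠ 0 ↔ ∃ r < j, ListColorable G (G.guessLists S k r) := by
    rw [hframe bAnswer (by simp) wA]
    exact h.answer
  have hstep : 8 * (1 + R.size) * t ≤ 8 * T * (W + 1) := by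
    calc 8 * (1 + R.size) * t ≤ 8 * (1 + W) * T := by gcongr
      _ = _ := by ring
  have hbound : ∀ c ≤ 5, t₁ + (t₂ + ((Expr.load 32 (.var bGuess)).cost m₂ + 1 + c)) ≤
      (prepareSteps k n * (prepare k).weight + 9 * T + 9) * (W + 1) := by
    intro c hc
    have e : (prepareSteps k n * (prepare k).weight + 9 * T + 9) * (W + 1) =
      prepareSteps k n * ((prepare k).weight * (W + 1)) + 8 * T * (W + 1) + T * W + T +
        9 * W + 9 := by ring
    rw [e]
    change t₁ ≤ prepareSteps k n * _ at ht₁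
    have := Nat.zero_le (T * W)
    omega
  -- Common conclusion of both outcomes of the test, which differ only in the bank of the answer.
  have key : ∀ m₃ : Mem, (∀ b ≠ bAnswer, m₃ b = m₂ b) → m₃.Bounded 32 W →
      (m₃ bAnswer 0 ≠ 0 ↔ ∃ r < j + 1, ListColorable G (G.guessLists S k r)) →
      Guessing G S k R W (j + 1) (m₃.write bGuess 0 (j + 1)) ∧ m₃.Bounded 32 W ∧
        m₃ bGuess 0 = j := by
    intro m₃ h₃ hb₃ hA₃
    refine ⟨⟨fun b hb a => ?_, ?_, ?_, ?_, ?_, ?_, by simp, ?_, by simpa using hA₃⟩, hb₃, by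
      rw [h₃ _ (by simp), hG₂]⟩
    · unfold Mem.write
      split
      · omega
      · exact hb₃ b hb a
    · simp [h₃ 0, hframe 0 (by simp) w0, h.size]
    · simp [h₃ 1, hframe 1 (by simp) w1, h.graph]
    · simpa [h₃ bMark, hframe bMark (by simp) wM] using h.mark
    · simp [h₃ bR, hframe bR (by simp) wR, h.number]
    · simp [h₃ bPalette, hframe bPalette (by simp) wP, h.palette]
    · intro b hb
      rw [Mem.write_of_ne _ _ _ (by omega), h₃ b (by omega)]
      exact hempty b hb
  by_cases hP : ListColorable G (G.guessLists S k j)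
  · refine ⟨_, ?_, _, .seq he₁ (.seq he₂ (.condTrue (by rw [hval]; exact hans.2 hP)
      (.store _ _ _ _))), key _ (fun b hb => Mem.write_of_ne _ _ _ hb) (fun b hb a => ?_) ?_⟩
    · refine hbound _ ?_
      simp [Expr.cost, Expr.eval]
    · unfold Mem.write
      split
      · exact h1
      · exact hb₂ b hb a
    · simpa using ⟨j, by simp, hP⟩
  · refine ⟨_, hbound 1 (by simp), _, .seq he₁ (.seq he₂ (.condFalse (by
      rw [hval]; by_contra h; exact hP (hans.1 h)) (.skip _))), key _ (fun _ _ => rfl) hb₂ ?_⟩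
    rw [hA₂, Nat.exists_lt_succ_right]
    exact (or_iff_left hP).symm

/-- `Run.forLoop` does not apply to a body that contains `A`, so the loop is unrolled by induction
on the number `d` of remaining guesses. -/
theorem Guessing.exec_loop {A : Program} {T : ℕ} (hRW : R < 2 ^ W) (hW : n + 2 ≤ W)
    (hbig : n * ((k - 1) * n) < 2 ^ W) (hbig' : n * n < 2 ^ W)
    (hA : ∀ j, Decides A (listInput G (G.guessLists S k j)) T
      (ListColorable G (G.guessLists S k j))) :
    ∀ d j, j + d = R → ∀ m, Guessing G S k R W j m →
      ∃ t ≤ (d + 1) * ((prepareSteps k n * (prepare k).weight + 9 * T + 60) * (W + 1)), ∃ m',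
        Exec (.loop ((Expr.var bGuess).ltTest (.var bR)) (tryGuess k A ;;
          .store bGuess (.const 0) (Expr.var bGuess + Expr.const 1))) m t m' ∧
        Guessing G S k R W R m' := by
  have hcost : ∀ m : Mem, m.Bounded 32 W →
      ((Expr.var bGuess).ltTest (.var bR)).cost m ≤ 20 * (W + 1) := fun m hm =>
    (Expr.cost_le hm ((Expr.var bGuess).ltTest (.var bR)) ⟨⟨by decide, trivial⟩, by decide, trivial⟩).trans
      (Nat.mul_le_mul_right _ (by decide))
  intro d
  induction d with
  | zero =>
    intro j hj m h
    obtain rfl : j = R := by omega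
    refine ⟨_, ?_, m, .loopFalse ?_, h⟩
    · have := hcost m h.bounded
      have e := Nat.zero_le ((prepareSteps k n * (prepare k).weight + 9 * T) * (W + 1))
      nlinarith
    · simp [h.index, h.number]
  | succ d ih =>
    intro j hj m h
    obtain ⟨t₁, ht₁, m₁, he₁, h₁, hb₁, hi₁⟩ :=
      h.exec_tryGuess (by omega) hRW hW hbig hbig' (hA j)
    have hw : m₁.write bGuess 0 (j + 1) =
        m₁.write bGuess ((Expr.const 0).eval m₁) ((Expr.var bGuess + Expr.const 1).eval m₁) := by
      simp [hi₁]
    obtain ⟨t₂, ht₂, m₂, he₂, h₂⟩ := ih (j + 1) (by omega) _ h₁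
    rw [hw] at he₂
    refine ⟨_, ?_, m₂, .loopTrue ?_ (.seq he₁ (.store _ _ _ _)) he₂, h₂⟩
    · have := hcost m h.bounded
      have hj : j.size ≤ W := Nat.size_le.2 ((show j < R by omega).trans hRW)
      have hj' : (j + 1).size ≤ W := Nat.size_le.2 ((show j + 1 ≤ R by omega).trans_lt hRW)
      have : (Expr.const 0).cost m₁ + (Expr.var bGuess + Expr.const 1).cost m₁ +
          (1 + ((Expr.const 0).eval m₁).size +
            ((Expr.var bGuess + Expr.const 1).eval m₁).size) ≤ 20 * (W + 1) := by
        have e : (Expr.var bGuess + Expr.const 1).cost m₁ =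
            1 + (1 + (m₁ bGuess 0).size) + (1 + 1) +
              (1 + (m₁ bGuess 0).size + 1 + (m₁ bGuess 0 + 1).size) := by
          change Expr.cost m₁ (.op .add (.load bGuess (.const 0)) (.const 1)) = _
          simp [Expr.cost, Expr.eval, Op.eval]
        rw [e]
        simp only [Expr.cost, Expr.eval_const, Expr.eval_add, Expr.eval_var, hi₁, Nat.size_zero]
        omega
      set X := (prepareSteps k n * (prepare k).weight + 9 * T) * (W + 1)
      have e₁ : (prepareSteps k n * (prepare k).weight + 9 * T + 9) * (W + 1) =
        X + 9 * (W + 1) := by ring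
      have e₂ : (d + 1 + 1) * ((prepareSteps k n * (prepare k).weight + 9 * T + 60) * (W + 1)) =
        (d + 1) * ((prepareSteps k n * (prepare k).weight + 9 * T + 60) * (W + 1)) +
          (X + 60 * (W + 1)) := by ring
      omega
    · simp [h.index, h.number]
      omega

end RAM

/-! ### The complete coloring program. -/

namespace RAM
variable {n W k q : ℕ} {G : SimpleGraph (Fin n)} {m : Mem} {S : Finset ℕ}

theorem exec_guessAndExtend {A : Program} {T : ℕ} (hk : 2 ≤ k) (hb : m.Bounded 32 W)
    (h₀ : m 0 0 = n) (h₁ : m 1 = graphInput G 1) (hS : ∀ u < n, m bMark u = truth (u ∈ S))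
    (hSn : S ⊆ Finset.range n) (hd : ∀ u < n, u ∉ S → ∃ s ∈ S, G.NatAdj u s) (hn : n ≠ 1)
    (hz : ∀ b, 32 ≤ b → m b = 0) (hans : m bAnswer = 0) (hW : n + 2 ≤ W) (hkW : k ^ n < 2 ^ W)
    (hbig : n * ((k - 1) * n) < 2 ^ W) (hbig' : n * n < 2 ^ W)
    (hA : ∀ L : Fin n → Finset (Fin ((k - 1) * n)), (∀ v, (L v).card ≤ k - 1) →
      Decides A (listInput G L) T (ListColorable G L)) :
    ∃ t ≤ k ^ S.card * (2 * (prepareSteps k n * (prepare k).weight + 9 * T + 80 +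
        (4 + n * 4) * (countGuesses k).weight) * (W + 1)), ∃ m',
      Exec (guessAndExtend k A) m t m' ∧ (m' 0 0 ≠ 0 ↔ G.Colorable k) := by
  have hn' := lt_two_pow_of_add_two_le hW
  have hlist : ∀ j, Decides A (listInput G (G.guessLists S k j)) T
      (ListColorable G (G.guessLists S k j)) :=
    fun j => hA _ fun v => SimpleGraph.card_guessLists_le hk hSn hd j v
  have hRW : k ^ S.card < 2 ^ W := by
    refine (Nat.pow_le_pow_right (by omega) ?_).trans_lt hkW
    simpa using Finset.card_le_card hSn
  have hR0 : 0 < k ^ S.card := pow_pos (by omega) _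
  have hq : (k - 1) * n < 2 ^ W := by
    rcases Nat.eq_zero_or_pos n with h | h
    · simp [h]
    · exact (Nat.le_mul_of_pos_left _ h).trans_lt hbig
  obtain ⟨t₁, ht₁, m₁, he₁, hb₁, hf₁, hR, hP⟩ :=
    (run_countGuesses hk h₀ hW hkW hq hS hSn).exec (readsBelow_countGuesses k) hb
  have hw : ∀ b, b ∉ [bR, bV, bPalette] → m₁ b = m b := fun b hb => hf₁ b (by
    simp only [List.mem_cons, List.not_mem_nil, or_false, not_or] at hb
    simp [countGuesses, Program.writes, hb])
  have hG : Guessing G S k (k ^ S.card) W 0 (m₁.write bGuess 0 0) := by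
    refine ⟨fun b hb a => ?_, ?_, ?_, ?_, ?_, ?_, by simp, fun b hb r _ _ => ?_, ?_⟩
    · unfold Mem.write
      split
      · positivity
      · exact hb₁ b hb a
    · simp [hw 0, h₀]
    · simp [hw 1, h₁]
    · simpa [hw bMark] using hS
    · simp [hR]
    · simp [hP]
    · rw [Mem.write_of_ne _ _ _ (by omega), hw b (by simp; omega), hz b hb]
      rfl
    · simp [hw bAnswer, hans]
  obtain ⟨t₂, ht₂, m₂, he₂, h₂⟩ :=
    Guessing.exec_loop hRW hW hbig hbig' hlist (k ^ S.card) 0 (by simp) _ hG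
  have hstore : (m₂ bAnswer 0).size ≤ W := Nat.size_le.2 (h₂.bounded _ (by simp) _)
  refine ⟨_, ?_, _, .seq he₁ (.seq (.seq (.store m₁ bGuess (.const 0) (.const 0)) he₂)
    (.store m₂ 0 (.const 0) (.var bAnswer))), ?_⟩
  · have hc₁ : (Expr.const 0).cost m₁ + (Expr.const 0).cost m₁ +
        (1 + ((Expr.const 0).eval m₁).size + ((Expr.const 0).eval m₁).size) ≤ 3 := by
      simp [Expr.cost, Expr.eval]
    have hc₂ : (Expr.const 0).cost m₂ + (Expr.var bAnswer).cost m₂ +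
        (1 + ((Expr.const 0).eval m₂).size + ((Expr.var bAnswer).eval m₂).size) ≤
          10 * (W + 1) := by
      simp only [Expr.var, Expr.cost, Expr.eval, Nat.size_zero]
      omega
    refine (Nat.add_le_add ht₁ (Nat.add_le_add (Nat.add_le_add hc₁ ht₂) hc₂)).trans ?_
    set X := prepareSteps k n * (prepare k).weight + 9 * T with hX
    set R := k ^ S.card
    set c := (4 + n * 4) * (countGuesses k).weight with hc
    have e₁ : (4 + n * 4) * ((countGuesses k).weight * (W + 1)) = c * (W + 1) := by
      rw [hc]; ring
    have e₂ : R * (2 * (X + 80 + c) * (W + 1)) = R * ((X + 60) * (W + 1)) +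
      R * ((X + 60) * (W + 1)) + R * (c * (W + 1)) + R * (c * (W + 1)) + R * (40 * (W + 1)) := by
      ring
    -- There is at least one guess, so the costs that arise only once can be charged to the guesses.
    have e₃ : c * (W + 1) ≤ R * (c * (W + 1)) := Nat.le_mul_of_pos_left _ hR0
    have e₄ : (X + 60) * (W + 1) ≤ R * ((X + 60) * (W + 1)) := Nat.le_mul_of_pos_left _ hR0
    have e₅ : 40 * (W + 1) ≤ R * (40 * (W + 1)) := Nat.le_mul_of_pos_left _ hR0
    rw [e₁, e₂, add_mul R 1, one_mul]
    omega
  · rw [SimpleGraph.colorable_iff_exists_guess hk hSn hn, ← h₂.answer]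
    simp

/-- Decides `k`-colorability with a program for `(k - 1)`-list coloring: guesses the colors of a
dominating set if it is small, and counts otherwise. -/
def colorProgram (q k : ℕ) (A : Program) : Program :=
  chooseVertices q ;; .cond ((Expr.var 0).ltTest (.const q * .var bCount))
    (inclusionExclusion k) (guessAndExtend k A)

theorem bounded_graphInput {W : ℕ} (hW : n + 2 ≤ W) : (graphInput G).Bounded N W := by
  have hn' := lt_two_pow_of_add_two_le hW
  intro b _ a
  unfold graphInput
  split_ifs <;> omega

/-- The choice `W = 3 * ((n + 1) * (k + 1))` leaves room for the alternating sums, for the number of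
guesses and for the addresses of the adjacency and incidence matrices. The final disjunction records
which branch was taken and why it is fast. -/
theorem exec_colorProgram {A : Program} {T : ℕ} (hk : 2 ≤ k) (hq : 2 ≤ q)
    (hW : 3 * ((n + 1) * (k + 1)) = W)
    (hA : ∀ L : Fin n → Finset (Fin ((k - 1) * n)), (∀ v, (L v).card ≤ k - 1) →
      Decides A (listInput G L) T (ListColorable G L)) :
    ∃ t m', Exec (colorProgram q k A) (graphInput G) t m' ∧ (m' 0 0 ≠ 0 ↔ G.Colorable k) ∧
      ((∃ s, q * s ≤ n ∧ t ≤ ((5 + n * (n * 6 + 14)) * (chooseVertices q).weight +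
          (((Expr.var 0).ltTest (.const q * .var bCount)).weight + 1) +
          k ^ s * (2 * (prepareSteps k n * (prepare k).weight + 9 * T + 80 +
            (4 + n * 4) * (countGuesses k).weight))) * (W + 1)) ∨
      (G.FewDominating q ∧ t ≤ ((5 + n * (n * 6 + 14)) * (chooseVertices q).weight +
          (((Expr.var 0).ltTest (.const q * .var bCount)).weight + 1) +
          ((n + 1) ^ 2 * (G.dominatingMasks.card + 1) * (60 + k * 3)) *
            (inclusionExclusion k).weight) * (W + 1))) := by
  have hnk : (n + 1) * (k + 1) = n * k + n + k + 1 := by ring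
  have hnk' : n * 2 ≤ n * k := Nat.mul_le_mul_left _ hk
  have hW₁ : (n + 1) * (k + 1) + 1 ≤ W := by omega
  have hW₂ : n + 2 ≤ W := by omega
  have hn' := lt_two_pow_of_add_two_le hW₂
  have hn2 : n ≤ 2 ^ n := Nat.lt_two_pow_self.le
  have hk2 : k - 1 ≤ 2 ^ k := (Nat.sub_le _ _).trans Nat.lt_two_pow_self.le
  have hkW : k ^ n < 2 ^ W := by
    calc k ^ n ≤ (2 ^ k) ^ n := Nat.pow_le_pow_left Nat.lt_two_pow_self.le _
      _ = 2 ^ (k * n) := (pow_mul _ _ _).symm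
      _ < 2 ^ W := Nat.pow_lt_pow_right (by simp) (by rw [mul_comm]; omega)
  have hbig : n * ((k - 1) * n) < 2 ^ W := by
    calc n * ((k - 1) * n) ≤ 2 ^ n * (2 ^ k * 2 ^ n) := by gcongr
      _ = 2 ^ (n + (k + n)) := by rw [pow_add, pow_add]
      _ < 2 ^ W := Nat.pow_lt_pow_right (by simp) (by omega)
  have hbig' : n * n < 2 ^ W := by
    calc n * n ≤ 2 ^ n * 2 ^ n := by gcongr
      _ = 2 ^ (n + n) := by rw [pow_add]
      _ < 2 ^ W := Nat.pow_lt_pow_right (by simp) (by omega)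
  have hzero : ∀ b, 2 ≤ b → graphInput G b = 0 := fun b hb => by
    funext a
    simp [graphInput, show b ≠ 0 by omega, show b ≠ 1 by omega]
  have hsize : graphInput G 0 0 = n := by simp [graphInput]
  obtain ⟨t₁, ht₁, m₁, he₁, hb₁, hf₁, S, hSn, hS, hc, hd, hfew⟩ :=
    (run_chooseVertices (q := q) (holdsGraph_of_eq hsize rfl) (by omega) (by omega)
      (hzero _ (by simp)) (hzero _ (by simp))).exec (readsBelow_chooseVertices q)
      (bounded_graphInput (N := 32) hW₂)
  have hw : ∀ b, (b < 2 ∨ 8 ≤ b) → m₁ b = graphInput G b := fun b hb => hf₁ b (by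
    simp [chooseVertices, greedy, markUndominated, Program.writes, countUndominated,
      markNeighbours]
    omega)
  have h₀ : m₁ 0 0 = n := by rw [hw 0 (by simp), hsize]
  have h₁ : m₁ 1 = graphInput G 1 := hw 1 (by simp)
  have hreads : ((Expr.var 0).ltTest (.const q * .var bCount)).ReadsBelow 32 :=
    ⟨⟨by decide, trivial⟩, trivial, by decide, trivial⟩
  have hcost := Expr.cost_le hb₁ _ hreads
  have heval : ((Expr.var 0).ltTest (.const q * .var bCount)).eval m₁ =
      if n < q * S.card then 1 else 0 := by
    simp [h₀, hc]
  set w := ((Expr.var 0).ltTest (.const q * .var bCount)).weight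
  by_cases h : n < q * S.card
  · obtain ⟨t₂, ht₂, m₂, he₂, -, -, h₂⟩ := (run_inclusionExclusion (k := k) (by omega)
      (holdsGraph_of_eq h₀ h₁) hW₁ (by rw [hw _ (by simp), hzero _ (by simp)])
      (by rw [hw _ (by simp), hzero _ (by simp)])).exec (readsBelow_inclusionExclusion k) hb₁
    refine ⟨_, _, .seq he₁ (.condTrue (by simp [heval, h]) he₂), h₂,
      Or.inr ⟨hfew.resolve_left (by omega), ?_⟩⟩
    calc _ ≤ _ := Nat.add_le_add ht₁ (Nat.add_le_add (Nat.add_le_add_right hcost 1) ht₂)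
      _ ≤ _ := by
        linarith [Nat.zero_le W]
  -- A dominating set of a one-vertex graph is nonempty, so `q ≥ 2` sends this graph to the other
  -- branch. This is where the palette would be too small.
  · have hn1 : n ≠ 1 := by
      rintro rfl
      have : 0 < S.card := by
        rw [Finset.card_pos]
        by_cases h0 : 0 ∈ S
        · exact ⟨0, h0⟩
        · obtain ⟨s, hs, -⟩ := hd 0 (by simp) h0
          exact ⟨s, hs⟩
      nlinarith
    obtain ⟨t₂, ht₂, m₂, he₂, h₂⟩ := exec_guessAndExtend hk hb₁ h₀ h₁ hS hSn hd hn1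
      (fun b hb => by rw [hw b (by omega), hzero b (by omega)])
      (by rw [hw _ (by simp), hzero _ (by simp)]) hW₂ hkW hbig hbig' hA
    refine ⟨_, _, .seq he₁ (.condFalse (by simp [heval, h]) he₂), h₂,
      Or.inl ⟨S.card, by omega, ?_⟩⟩
    calc _ ≤ _ := Nat.add_le_add ht₁ (Nat.add_le_add (Nat.add_le_add_right hcost 1) ht₂)
      _ ≤ _ := by
        linarith [Nat.zero_le W]

end RAM

/-! ### Uniform time bounds, and the case of one color. -/

namespace RAM
variable {n W k q : ℕ} {G : SimpleGraph (Fin n)} {m : Mem}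

theorem prepareSteps_le (k n : ℕ) : prepareSteps k n ≤ (29 + 11 * k) * (n + 1) ^ 3 := by
  have h : n * ((k - 1) * n) * (n * 3 + 8) ≤ n * (k * n) * (n * 3 + 8) := by
    gcongr
    omega
  unfold prepareSteps
  nlinarith [Nat.zero_le (k * n), Nat.zero_le (k * n ^ 2), Nat.zero_le (k * n ^ 3),
    Nat.zero_le (n ^ 2), Nat.zero_le (n ^ 3)]

/-- The constant depends on `k` and `q` only, not on `A`. The step counts contribute `(n + 1) ^ 3`
and the word length `W` one more factor `n + 1`. -/
theorem exists_time_bound (hk : 2 ≤ k) (hq : 2 ≤ q) : ∃ C : ℕ, ∀ (A : Program) (T n : ℕ)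
    (G : SimpleGraph (Fin n)),
    (∀ L : Fin n → Finset (Fin ((k - 1) * n)), (∀ v, (L v).card ≤ k - 1) →
      Decides A (listInput G L) T (ListColorable G L)) →
    ∃ t m', Exec (colorProgram q k A) (graphInput G) t m' ∧ (m' 0 0 ≠ 0 ↔ G.Colorable k) ∧
      ((∃ s, q * s ≤ n ∧ t ≤ C * (n + 1) ^ 4 * (k ^ s * (T + 1))) ∨
      (G.FewDominating q ∧ t ≤ C * (n + 1) ^ 4 * (G.dominatingMasks.card + 1))) := by
  set a := (chooseVertices q).weight with ha
  set w := ((Expr.var 0).ltTest (.const q * .var bCount)).weight with hw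
  set p := (prepare k).weight with hp
  set c := (countGuesses k).weight with hc
  set i := (inclusionExclusion k).weight with hi
  refine ⟨(25 * a + (w + 1) + 2 * ((29 + 11 * k) * p + 89 + 4 * c) + (60 + k * 3) * i) *
    (4 * (k + 1)), fun A T n G hA => ?_⟩
  obtain ⟨t, m', he, hans, ht⟩ := exec_colorProgram (q := q) hk hq rfl hA
  refine ⟨t, m', he, hans, ht.imp (fun ⟨s, hs, ht⟩ => ⟨s, hs, ht.trans ?_⟩)
    fun ⟨hf, ht⟩ => ⟨hf, ht.trans ?_⟩⟩
  all_goals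
    rw [← ha, ← hw]
    have hW : 3 * ((n + 1) * (k + 1)) + 1 ≤ 4 * (k + 1) * (n + 1) := by nlinarith
    have hP : 1 ≤ (n + 1) ^ 3 := Nat.one_le_pow _ _ (by simp)
    have h₁ : 5 + n * (n * 6 + 14) ≤ 25 * (n + 1) ^ 3 := by
      nlinarith [Nat.zero_le (n ^ 2), Nat.zero_le (n ^ 3)]
  · rw [← hp, ← hc]
    have hY : 1 ≤ k ^ s * (T + 1) := Nat.mul_pos (pow_pos (by omega) _) (by simp)
    set P := (n + 1) ^ 3 with hPdef
    have h₂ := prepareSteps_le k n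
    rw [← hPdef] at h₂
    have h₃ : 4 + n * 4 ≤ 4 * P := by
      nlinarith [Nat.zero_le (n ^ 2), Nat.zero_le (n ^ 3)]
    have h₄ : prepareSteps k n * p + 9 * T + 80 + (4 + n * 4) * c ≤
        ((29 + 11 * k) * p + 89 + 4 * c) * P * (T + 1) := by
      have e₁ : prepareSteps k n * p ≤ (29 + 11 * k) * P * p * (T + 1) :=
        (Nat.mul_le_mul_right _ h₂).trans (Nat.le_mul_of_pos_right _ (by simp))
      have e₂ : (4 + n * 4) * c ≤ 4 * P * c * (T + 1) :=
        (Nat.mul_le_mul_right _ h₃).trans (Nat.le_mul_of_pos_right _ (by simp))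
      have e₃ : 9 * T + 80 ≤ 89 * (T + 1) * P :=
        (show _ ≤ 89 * (T + 1) by omega).trans (Nat.le_mul_of_pos_right _ hP)
      linarith
    have h₅ : (5 + n * (n * 6 + 14)) * a ≤ 25 * P * a * (k ^ s * (T + 1)) :=
      (Nat.mul_le_mul_right _ h₁).trans (Nat.le_mul_of_pos_right _ hY)
    have h₆ : w + 1 ≤ (w + 1) * P * (k ^ s * (T + 1)) :=
      (Nat.le_mul_of_pos_right _ hP).trans (Nat.le_mul_of_pos_right _ hY)
    have h₇ : k ^ s * (2 * (prepareSteps k n * p + 9 * T + 80 + (4 + n * 4) * c)) ≤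
        k ^ s * (2 * (((29 + 11 * k) * p + 89 + 4 * c) * P * (T + 1))) := by gcongr
    have h₈ := Nat.zero_le ((60 + k * 3) * i * P * (k ^ s * (T + 1)))
    calc _ ≤ ((25 * a + (w + 1) + 2 * ((29 + 11 * k) * p + 89 + 4 * c) + (60 + k * 3) * i) *
          P * (k ^ s * (T + 1))) * (4 * (k + 1) * (n + 1)) := by
          refine Nat.mul_le_mul ?_ hW
          linarith
      _ = _ := by
        rw [hPdef]
        ring
  · rw [← hi]
    set D := G.dominatingMasks.card
    have hPP : (n + 1) ^ 2 ≤ (n + 1) ^ 3 := Nat.pow_le_pow_right (by simp) (by simp)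
    set P := (n + 1) ^ 3 with hPdef
    have h₅ : (5 + n * (n * 6 + 14)) * a ≤ 25 * P * a * (D + 1) :=
      (Nat.mul_le_mul_right _ h₁).trans (Nat.le_mul_of_pos_right _ (by simp))
    have h₆ : w + 1 ≤ (w + 1) * P * (D + 1) :=
      (Nat.le_mul_of_pos_right _ hP).trans (Nat.le_mul_of_pos_right _ (by simp))
    have h₇ : (n + 1) ^ 2 * (D + 1) * (60 + k * 3) * i ≤ P * (D + 1) * (60 + k * 3) * i := by
      gcongr
    have h₈ := Nat.zero_le (2 * ((29 + 11 * k) * p + 89 + 4 * c) * P * (D + 1))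
    calc _ ≤ ((25 * a + (w + 1) + 2 * ((29 + 11 * k) * p + 89 + 4 * c) + (60 + k * 3) * i) *
          P * (D + 1)) * (4 * (k + 1) * (n + 1)) := by
          refine Nat.mul_le_mul ?_ hW
          linarith
      _ = _ := by
        rw [hPdef]
        ring

/-- Decides whether the graph has no edges. -/
def testEdgeless : Program :=
  .forLoop bI (.var 0 * .var 0)
    (.cond (.load 1 (.var bI)) (.store bFlag (.const 0) (.const 1)) .skip) ;;
  .store 0 (.const 0) (.const 1 - .var bFlag)

theorem _root_.SimpleGraph.colorable_one_iff_graphInput (G : SimpleGraph (Fin n)) :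
    G.Colorable 1 ↔ ¬ ∃ a < n * n, graphInput G 1 a ≠ 0 := by
  have h : (∃ a < n * n, graphInput G 1 a ≠ 0) ↔ ∃ u v, G.Adj u v := by
    constructor
    · rintro ⟨a, -, ha⟩
      unfold graphInput at ha
      rw [if_neg (by simp)] at ha
      obtain ⟨-, u, v, huv, -⟩ := of_not_not fun hn => ha (if_neg hn)
      exact ⟨u, v, huv⟩
    · rintro ⟨u, v, huv⟩
      refine ⟨u * n + v, ?_, ?_⟩
      · have hu := u.2
        have hv := v.2
        nlinarith
      · unfold graphInput
        rw [if_neg (by simp), if_pos ⟨rfl, u, v, huv, rfl⟩]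
        simp
  rw [h]
  constructor
  · rintro ⟨c⟩ ⟨u, v, huv⟩
    exact c.valid huv (Subsingleton.elim _ _)
  · exact fun h => ⟨SimpleGraph.Coloring.mk (fun _ => 0) fun {u v} huv => (h ⟨u, v, huv⟩).elim⟩

theorem readsBelow_testEdgeless : testEdgeless.ReadsBelow 32 := by
  repeat' first | exact trivial | decide | refine ⟨?_, ?_⟩

theorem exec_testEdgeless (G : SimpleGraph (Fin n)) :
    ∃ t ≤ testEdgeless.weight * 12 * (n + 1) ^ 3, ∃ m', Exec testEdgeless (graphInput G) t m' ∧
      (m' 0 0 ≠ 0 ↔ G.Colorable 1) := by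
  have hn' := lt_two_pow_of_add_two_le (show n + 2 ≤ 2 * n + 2 by omega)
  have hnn : n * n < 2 ^ (2 * n + 2) := by
    calc n * n ≤ 2 ^ n * 2 ^ n := Nat.mul_le_mul Nat.lt_two_pow_self.le Nat.lt_two_pow_self.le
      _ = 2 ^ (n + n) := by rw [pow_add]
      _ < _ := Nat.pow_lt_pow_right (by simp) (by omega)
  have hsize : graphInput G 0 0 = n := by simp [graphInput]
  have hrun : Run (2 * n + 2) testEdgeless (graphInput G) (2 + n * n * (2 + 2) + 1) fun m' =>
      (m' 0 0 ≠ 0 ↔ G.Colorable 1) := by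
    refine Run.seq ((Run.forLoop (s := 2) (n * n) (fun j m' =>
      m' bFlag 0 = truth (∃ a < j, graphInput G 1 a ≠ 0)) hnn (by simp [Program.writes])
      (by simp [graphInput]) ?_ ?_).mono le_rfl fun m' _ h _ => Run.store ?_ ?_)
    · intro j _ m' hf _
      simp [hf 0 (by simp [Program.writes]), hsize]
    · intro j hj m' hf hij hI
      have h₁ : m' 1 = graphInput G 1 := hf 1 (by simp [Program.writes])
      refine (Run.cond (s := 1) (fun hc => Run.store (by simp) ?_) fun hc => Run.skip ?_).le
        (by omega) <;> rw [Expr.eval_load, Expr.eval_var, hij, h₁] at hc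
      · simp only [ne_eq, Nat.reduceEqDiff, not_false_eq_true, Mem.write_of_ne, Mem.write_self,
          Expr.eval_const, Function.update_self]
        exact (truth_of ⟨j, by simp, hc⟩).symm
      · simp only [ne_eq, Nat.reduceEqDiff, not_false_eq_true, Mem.write_of_ne, hI]
        exact truth_congr (by
          rw [Nat.exists_lt_succ_right]
          exact (or_iff_left (by simpa using hc)).symm)
    · rw [Expr.eval_sub]
      exact (Nat.sub_le _ _).trans_lt (by simp)
    · simp only [Expr.eval_const, Expr.eval_sub, Expr.eval_var, h, Mem.write_self,
        Function.update_self, one_sub_truth, ne_eq, truth_eq_zero, not_not,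
        G.colorable_one_iff_graphInput]
  obtain ⟨t, ht, m', he, -, -, h⟩ := hrun.exec readsBelow_testEdgeless
    (bounded_graphInput (by omega))
  refine ⟨t, ht.trans ?_, m', he, h⟩
  calc _ ≤ (4 * (n + 1) ^ 2) * (testEdgeless.weight * (3 * (n + 1))) := by
        gcongr
        · nlinarith
        · omega
    _ = _ := by ring

end RAM

/-! ### Running times -/

section growth
open Filter Asymptotics

/-- Each of the `i` blocks costs a factor `1 - 1 / B ≤ γ ^ M`, and `n ≤ M * i`. -/
theorem SimpleGraph.FewDominating.card_le {n q : ℕ} {G : SimpleGraph (Fin n)}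
    (h : G.FewDominating q) {γ : ℝ} (h₀ : 0 < γ) (h₁ : γ ≤ 1)
    (hγ : 1 - 1 / 2 ^ (8 * q ^ 2 + 1) ≤ γ ^ (8 * q ^ 2 * (8 * q ^ 2 + 1))) :
    (G.dominatingMasks.card : ℝ) ≤ (2 * γ) ^ n := by
  obtain ⟨i, hi, hcard⟩ := h
  obtain ⟨B, hB⟩ : ∃ B : ℕ, B = 2 ^ (8 * q ^ 2 + 1) := ⟨_, rfl⟩
  rw [← hB] at hcard
  set M := 8 * q ^ 2 * (8 * q ^ 2 + 1)
  have hB0 : 0 < B := hB ▸ pow_pos two_pos _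
  have hBr : (B : ℝ) = 2 ^ (8 * q ^ 2 + 1) := by rw [hB]; push_cast; rfl
  have hcard' : (G.dominatingMasks.card : ℝ) * (B : ℝ) ^ i ≤ 2 ^ n * ((B : ℝ) - 1) ^ i := by
    have := (Nat.cast_le (α := ℝ)).2 hcard
    push_cast [Nat.cast_pred hB0] at this
    exact this
  have hBp : (0 : ℝ) < B := by exact_mod_cast hB0
  have hB1 : (1 : ℝ) ≤ B := by exact_mod_cast hB0
  rw [← hBr] at hγ
  have hx : ((B : ℝ) - 1) = (1 - 1 / B) * B := by field_simp
  have hx0 : (0 : ℝ) ≤ 1 - 1 / B := by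
    rw [sub_nonneg, div_le_one hBp]
    exact hB1
  rw [hx, mul_pow, ← mul_assoc] at hcard'
  have h₂ := le_of_mul_le_mul_right hcard' (pow_pos hBp i)
  calc (G.dominatingMasks.card : ℝ) ≤ 2 ^ n * (1 - 1 / B) ^ i := h₂
    _ ≤ 2 ^ n * (γ ^ M) ^ i := by gcongr
    _ = 2 ^ n * γ ^ (M * i) := by rw [pow_mul γ M i]
    _ ≤ 2 ^ n * γ ^ n := by
      gcongr ?_ * ?_
      exact pow_le_pow_of_le_one h₀.le h₁ hi
    _ = (2 * γ) ^ n := (mul_pow _ _ _).symm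

/-- Bernoulli's inequality for `γ = 1 - (1 - x) / (M + 2)`; the denominator `M + 2` keeps `γ`
positive even for `M = 0`. -/
theorem exists_lt_one_le_pow (x : ℝ) (hx : 0 ≤ x) (hx1 : x < 1) (M : ℕ) :
    ∃ γ : ℝ, 0 < γ ∧ γ < 1 ∧ x ≤ γ ^ M := by
  have hM : (0 : ℝ) < M + 1 := by positivity
  have h₀ : 0 < (1 - x) / (M + 2) := div_pos (by linarith) (by linarith)
  have h₁ : (1 - x) / (M + 2) < 1 := (div_lt_one (by linarith)).2 (by linarith)
  refine ⟨1 + -((1 - x) / (M + 2)), by linarith, by linarith, ?_⟩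
  refine le_trans ?_ (one_add_mul_le_pow (by linarith) M)
  have : (M : ℝ) * ((1 - x) / (M + 2)) ≤ 1 - x := by
    rw [mul_div_assoc', div_le_iff₀ (by linarith)]
    nlinarith
  linarith

/-- A polynomial factor is absorbed by any increase of the base. -/
theorem isBigO_poly_mul {c : ℕ} {ρ y : ℝ} (hρ : 0 ≤ ρ) (hy : ρ < y) {f : ℕ → ℝ}
    (hf : f =O[atTop] fun n => ρ ^ n) (C : ℝ) :
    (fun n : ℕ => C * ((n : ℝ) + 1) ^ c * f n) =O[atTop] fun n => y ^ n := by
  have h₁ : (fun n : ℕ => (n : ℝ) + 1) =O[atTop] fun n : ℕ => (n : ℝ) := by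
    refine IsBigO.of_bound 2 ?_
    filter_upwards [eventually_ge_atTop 1] with n hn
    have : (1 : ℝ) ≤ n := by exact_mod_cast hn
    rw [Real.norm_of_nonneg (by positivity), Real.norm_of_nonneg (by positivity)]
    linarith
  have h₂ : (fun n : ℕ => (n : ℝ) ^ c * ρ ^ n) =O[atTop] fun n : ℕ => y ^ n :=
    (isLittleO_pow_const_mul_const_pow_const_pow_of_norm_lt c (by
      rwa [Real.norm_of_nonneg hρ])).isBigO
  refine IsBigO.trans ?_ h₂
  exact ((h₁.pow c).const_mul_left C).mul hf

end growth

-- The base `y` is fixed before `A` and `T`. Replacing `2 - ε` by `max (2 - ε) 1` makes all bases at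
-- least `1`, so that additive constants are absorbed as well.
open Filter Asymptotics in
theorem RAM.exists_solvesColoring {k : ℕ} (hk : 2 ≤ k) (ε : ℝ) (hε : 0 < ε) :
    ∃ y : ℝ, 0 < y ∧ y < 2 ∧ ∀ (A : RAM.Program) (T : ℕ → ℕ),
      SolvesListColoring (k - 1) A T →
      (fun n => (T n : ℝ)) =O[atTop] (fun n : ℕ => (max (2 - ε) 1) ^ n) →
      ∃ (B : RAM.Program) (T' : ℕ → ℕ), SolvesColoring k B T' ∧
        (fun n => (T' n : ℝ)) =O[atTop] (fun n : ℕ => y ^ n) := by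
  set d := max (2 - ε) 1 with hd
  have hd1 : 1 ≤ d := le_max_right _ _
  have hd2 : d < 2 := max_lt (by linarith) (by norm_num)
  -- The midpoint of `1` and `2 / d`: larger than `1`, and still `K * d < 2`.
  set K := (1 + 2 / d) / 2 with hK
  have hd0 : 0 < d := by linarith
  have hKd : K * d < 2 := by
    have : K * d = (d + 2) / 2 := by rw [hK]; field_simp
    linarith
  have hK1 : 1 < K := by
    have : 1 < 2 / d := (one_lt_div hd0).2 hd2
    linarith
  -- With `k ≤ K ^ q`, the guesses for at most `n / q` vertices number at most `K ^ n`. Adding `2`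
  -- to `q₀` ensures `q ≥ 2`.
  obtain ⟨q₀, hq₀⟩ := pow_unbounded_of_one_lt (k : ℝ) hK1
  set q := q₀ + 2
  have hKq : (k : ℝ) ≤ K ^ q := hq₀.le.trans (pow_le_pow_right₀ hK1.le (by omega))
  obtain ⟨γ, hγ0, hγ1, hγ⟩ := exists_lt_one_le_pow (1 - 1 / 2 ^ (8 * q ^ 2 + 1))
    (by
      rw [sub_nonneg]
      exact (div_le_one (by positivity)).2 (one_le_pow₀ (by norm_num)))
    (by
      have : (0 : ℝ) < 1 / 2 ^ (8 * q ^ 2 + 1) := by positivity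
      linarith) (8 * q ^ 2 * (8 * q ^ 2 + 1))
  obtain ⟨C, hC⟩ := exists_time_bound hk (show 2 ≤ q by omega)
  set ρ := max (K * d) (2 * γ) with hρ
  have hρ2 : ρ < 2 := max_lt hKd (by linarith)
  have hKd1 : 1 ≤ K * d := one_le_mul_of_one_le_of_one_le hK1.le hd1
  have hρ1 : 1 ≤ ρ := hKd1.trans (le_max_left _ _)
  -- The gap between `ρ` and the midpoint of `ρ` and `2` pays for the polynomial factor.
  refine ⟨(ρ + 2) / 2, by linarith, by linarith, fun A T hA hT => ?_⟩
  -- The time bound must cover both branches, since the branch depends on the graph and not only on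
  -- `n`.
  set F : ℕ → ℝ := fun n => K ^ n * (T n + 1) + ((2 * γ) ^ n + 1) with hF
  refine ⟨colorProgram q k A, fun n => ⌊(C : ℝ) * ((n : ℝ) + 1) ^ 4 * F n⌋₊,
    fun n G => ?_, ?_⟩
  · obtain ⟨t, m', he, hans, ht⟩ := hC A (T n) n G (hA n G)
    refine ⟨t, m', he, Nat.le_floor ?_, hans⟩
    rcases ht with ⟨s, hs, ht⟩ | ⟨hf, ht⟩
    · refine (Nat.cast_le.2 ht).trans ?_
      push_cast
      refine mul_le_mul_of_nonneg_left ?_ (by positivity)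
      have hks : (k : ℝ) ^ s ≤ K ^ n := by
        calc (k : ℝ) ^ s ≤ (K ^ q) ^ s := by gcongr
          _ = K ^ (q * s) := (pow_mul _ _ _).symm
          _ ≤ K ^ n := pow_le_pow_right₀ hK1.le hs
      have : (0 : ℝ) ≤ (2 * γ) ^ n + 1 := by positivity
      have := mul_le_mul_of_nonneg_right hks (show (0 : ℝ) ≤ T n + 1 by positivity)
      simp only [hF]
      linarith
    · refine (Nat.cast_le.2 ht).trans ?_
      push_cast
      refine mul_le_mul_of_nonneg_left ?_ (by positivity)
      have h₁ := hf.card_le hγ0 hγ1.le hγ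
      have : (0 : ℝ) ≤ K ^ n * (T n + 1) := by positivity
      simp only [hF]
      linarith
  · have hpow : ∀ {a : ℝ}, 0 ≤ a → a ≤ ρ →
        (fun n : ℕ => a ^ n) =O[atTop] fun n : ℕ => ρ ^ n := fun ha h =>
      IsBigO.of_norm_le fun n => by
        rw [Real.norm_of_nonneg (by positivity)]
        gcongr
    have hone : (fun _ : ℕ => (1 : ℝ)) =O[atTop] fun n : ℕ => ρ ^ n := by
      simpa using hpow zero_le_one hρ1
    have hT1 : (fun n => (T n : ℝ) + 1) =O[atTop] fun n : ℕ => d ^ n :=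
      hT.add (IsBigO.of_norm_le fun n => by
        rw [norm_one]
        exact one_le_pow₀ hd1)
    have hF' : F =O[atTop] fun n : ℕ => ρ ^ n := by
      refine IsBigO.add (IsBigO.trans ?_ (hpow (by positivity) (le_max_left (K * d) (2 * γ))))
        ((hpow (by positivity) (le_max_right _ _)).add hone)
      simp only [mul_pow]
      exact (isBigO_refl _ _).mul hT1
    refine IsBigO.trans (IsBigO.of_norm_le fun n => ?_)
      (isBigO_poly_mul (c := 4) (by linarith) (show ρ < (ρ + 2) / 2 by linarith) hF' C)
    rw [Real.norm_of_nonneg (by positivity)]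
    exact Nat.floor_le (by positivity)

-- One color suffices exactly for edgeless graphs, which is tested in polynomial time; the base `3 /
-- 2` is an arbitrary number between `1` and `2`.
open Filter Asymptotics in
theorem RAM.exists_solvesColoring_one :
    ∃ (B : RAM.Program) (T' : ℕ → ℕ), SolvesColoring 1 B T' ∧
      (fun n => (T' n : ℝ)) =O[atTop] (fun n : ℕ => (3 / 2 : ℝ) ^ n) := by
  refine ⟨testEdgeless, fun n => testEdgeless.weight * 12 * (n + 1) ^ 3, fun n G => ?_, ?_⟩
  · obtain ⟨t, ht, m', he, h⟩ := exec_testEdgeless G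
    exact ⟨t, m', he, ht, h⟩
  · have := isBigO_poly_mul (c := 3) (ρ := 1) (y := 3 / 2) zero_le_one (by norm_num)
      (f := fun _ => 1) (by simpa using isBigO_refl (fun _ : ℕ => (1 : ℝ)) atTop)
      ((testEdgeless.weight * 12 : ℕ) : ℝ)
    simpa using this

theorem theorem3 (k : ℕ) (hk : 1 ≤ k) (ε : ℝ) (hε : 0 < ε) (hε2 : ε < 2) :
    ∃ ε' : ℝ, 0 < ε' ∧ ε' < 2 ∧
      ∀ (A : RAM.Program) (T : ℕ → ℕ),
        SolvesListColoring (k - 1) A T →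
        (fun n => (T n : ℝ)) =O[Filter.atTop] (fun n : ℕ => (2 - ε) ^ n) →
        ∃ (B : RAM.Program) (T' : ℕ → ℕ),
          SolvesColoring k B T' ∧
          (fun n => (T' n : ℝ)) =O[Filter.atTop] (fun n : ℕ => (2 - ε') ^ n) := by
  rcases hk.eq_or_lt with rfl | hk
  -- For `k = 1` guessing is no help, as a fixed color does not fit into lists of size `0`; the
  -- edgeless test replaces it.
  · refine ⟨1 / 2, by norm_num, by norm_num, fun _ _ _ _ => ?_⟩
    rw [show (2 - 1 / 2 : ℝ) = 3 / 2 by norm_num]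
    exact RAM.exists_solvesColoring_one
  · obtain ⟨y, hy0, hy2, h⟩ := RAM.exists_solvesColoring hk ε hε
    refine ⟨2 - y, by linarith, by linarith, fun A T hA hT => ?_⟩
    rw [sub_sub_cancel]
    -- Passing to the larger base `max (2 - ε) 1` requires `2 - ε` to be nonnegative, which follows
    -- from `ε < 2`.
    refine h A T hA (hT.trans (Asymptotics.IsBigO.of_norm_le fun n => ?_))
    rw [Real.norm_of_nonneg (pow_nonneg (by linarith) n)]
    exact pow_le_pow_left₀ (by linarith) (le_max_left _ _) n
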